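/- Let $\sigma_c,\sigma_s,\sigma_m>0$ and $0<r_i<r_e$ satisfy the neutrality condition $$(2\sigma_s+\sigma_c)(\sigma_m-\sigma_s)+\rho^3(\sigma_s-\sigma_c)(2\sigma_s+\sigma_m)=0,\qquad \rho=r_i/r_e .$$ Let $S^2$ be the unit sphere in $\mathbb R^3$ and let $W^{2,\infty}(S^2)$ be the space of functions $f$ on $S^2$ (represented by their continuous representatives) with $$\|f\|_{2,\infty}:=\|f\|_\infty+\|\nabla_T f\|_\infty+\|\nabla_T^2 f\|_\infty<\infty,$$ where $\nabla_T f$ and $\nabla_T^2 f$ are the (weak) tangential gradient and tangential Hessian. Let $W_6\subset W^{2,\infty}(S^2)$ be the span of the functions $$\tfrac1{\sqrt{15}},\quad \hat x_1\hat x_2,\quad \hat x_2\hat x_3,\quad \tfrac1{2\sqrt3}(-\hat x_1^2-\hat x_2^2+2\hat x_3^2),\quad \hat x_1\hat x_3,\quad \tfrac12(\hat x_1^2-\hat x_2^2),$$ with the norm $\|\cdot\|_{2,\infty}$. For functions $b$ and $h$ on $S^2$, let $D_b$ and $\Omega_h$ be the regions enclosed by the surfaces $\{(r_i+b(\hat x))\hat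 x:|\hat x|=1\}$ and $\{(r_e+h(\hat x))\hat x:|\hat x|=1\}$, respectively. Let $D,\Omega\subset\mathbb R^3$ be bounded simply connected domains with $\overline D\subset\Omega$, and let $\sigma=\sigma_c$ in $D$, $\sigma=\sigma_s$ in $\Omega\setminus D$, $\sigma=\sigma_m$ in $\mathbb R^3\setminus\Omega$. The polarization tensor of $(D,\Omega)$ is the $3\times3$ matrix $M$ such that, for every unit vector $a$, the weak solution $u\in H^1_{\mathrm{loc}}(\mathbb R^3)$ of $$\nabla\cdot\sigma\nabla u=0\ \text{ in }\mathbb R^3,\qquad u(x)-a\cdot x=O(|x|^{-2})\ \text{ as }|x|\to\infty,$$ satisfies $$u(x)-a\cdot x=\frac1{4\pi}\frac{\langle Ma,x\rangle}{|x|^3}+O(|x|^{-3})\ \text{ as }|x|\to\infty .$$ The pair $(D,\Omega)$ is called PT-vanishing if $M=0$. Then there is $\varepsilon>0$ such that for each $h\in W^{2,\infty}(S^2)$ with $\|h\|_{2,\infty}<\varepsilon$ there is $b=b(h)\in W_6$ such that $D_{b(h)}$ and $\Omega_h$ are bounded simply connected domains with $\overline{D_{b(h)}}\subset\Omega_h$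 and $(D_{b(h)},\Omega_h)$ is PT-vanishing; moreover, the mapping $h\mapsto b(h)$ is continuous from $\{h\in W^{2,\infty}(S^2):\|h\|_{2,\infty}<\varepsilon\}$ to $W_6$. -/

import Mathlib

open MeasureTheory Asymptotics
open scoped ContDiff

noncomputable section

namespace CoreShell

/-- Three-dimensional Euclidean space. -/
abbrev E3 : Type := EuclideanSpace ℝ (Fin 3)

/-- The unit sphere in Euclidean 3-space. -/
abbrev S2 : Type := Metric.sphere (0 : E3) 1

/-- The surface measure of the unit sphere (of total mass `4π`). -/
abbrev surf : Measure S2 := (volume : Measure E3).toSphere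

/-! ### The Sobolev space of functions on the sphere with two bounded weak derivatives -/

/-- Orthogonal projection of `ℝ³` onto the tangent plane of the sphere at `p`. -/
def tangentProj (p : S2) : E3 →L[ℝ] E3 :=
  ContinuousLinearMap.id ℝ E3 - (innerSL ℝ (p : E3)).smulRight (p : E3)

/-- `g` is the weak tangential gradient of `f` on the sphere. Since the mean curvature (sum of the
principal curvatures) is `2`, the divergence theorem gives `∫ ∇_T(f φ) dS = ∫ 2 f φ p dS(p)`, hence
`∫ f ∇_T φ dS = ∫ (2 f φ p - φ ∇_T f) dS` for smooth `f` and `φ`; smooth functions on the sphere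
are the restrictions of smooth functions on `ℝ³`. The identity forces `g` to be tangential almost
everywhere and determines it up to null sets. -/
structure HasWeakTangentGrad (f : S2 → ℝ) (g : S2 → E3) : Prop where
  integrable_fun : Integrable f surf
  integrable_grad : Integrable g surf
  integral_eq : ∀ φ : E3 → ℝ, ContDiff ℝ ∞ φ →
    ∫ p : S2, f p • tangentProj p (gradient φ (p : E3)) ∂surf =
      ∫ p : S2, ((2 * f p * φ p) • (p : E3) - φ p • g p) ∂surf

/-- `B` is the weak tangential derivative of the `ℝ³`-valued function `V` on the sphere,
`B p v` being the derivative of `V` at `p` in the (tangential part of the) direction `v`: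
for each fixed vector `c`, the scalar function `⟪V, c⟫` has weak tangential gradient `Bᵀ c`. -/
def HasWeakTangentDeriv (V : S2 → E3) (B : S2 → E3 →L[ℝ] E3) : Prop :=
  ∀ c : E3, HasWeakTangentGrad (fun p => inner ℝ (V p) c)
    (fun p => ContinuousLinearMap.adjoint (B p) c)

/-- `H` is the weak tangential (covariant) Hessian of the function with weak tangential gradient
`g`: the tangential part of the tangential derivative of `g`. -/
def IsWeakHessian (g : S2 → E3) (H : S2 → E3 →L[ℝ] E3) : Prop :=
  ∃ B : S2 → E3 →L[ℝ] E3, HasWeakTangentDeriv g B ∧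
    ∀ᵐ p ∂surf, H p = (tangentProj p).comp (B p)

/-- The norm `‖f‖_{2,∞} = ‖f‖_∞ + ‖∇_T f‖_∞ + ‖∇_T² f‖_∞`, with value `∞` if the weak derivatives
do not exist or one of the terms is infinite. (Weak derivatives are unique up to null
sets, so the infimum runs over at most one value.) -/
def norm2inf (f : S2 → ℝ) : ENNReal :=
  ⨅ (g : S2 → E3) (H : S2 → E3 →L[ℝ] E3) (_ : HasWeakTangentGrad f g) (_ : IsWeakHessian g H),
    eLpNorm f ⊤ surf + eLpNorm g ⊤ surf + eLpNorm H ⊤ surf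

/-- The space `W^{2,∞}(S²)`; each class modulo null sets is represented by its unique continuous
member, so that pointwise values make sense. -/
def W2inf : Set (S2 → ℝ) := {f | Continuous f ∧ norm2inf f < ⊤}

/-! ### The six-dimensional space of perturbations -/

/-- The spherical harmonics `Y₁, …, Y₆` of order `0` and `2`. -/
def Y : Fin 6 → S2 → ℝ :=
  ![fun _ => 1 / √15,
    fun p => p.1 0 * p.1 1,
    fun p => p.1 1 * p.1 2,
    fun p => 1 / (2 * √3) * (-(p.1 0) ^ 2 - (p.1 1) ^ 2 + 2 * (p.1 2) ^ 2),
    fun p => p.1 0 * p.1 2,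
    fun p => 1 / 2 * ((p.1 0) ^ 2 - (p.1 1) ^ 2)]

/-- The space spanned by `Y₁, …, Y₆`. -/
def W6 : Submodule ℝ (S2 → ℝ) := Submodule.span ℝ (Set.range Y)

/-! ### Domains -/

/-- The perturbation of the ball `{|x| < r}` by `h`: the region enclosed by the surface
`{(r + h p) p : |p| = 1}`. -/
def perturbedBall (r : ℝ) (h : S2 → ℝ) : Set E3 :=
  {x | ∃ (p : S2) (t : ℝ), 0 ≤ t ∧ t < r + h p ∧ x = t • (p : E3)}

/-- `(D, Ω)` is a core-shell inclusion: `D` and `Ω` are bounded simply connected domains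
and the closure of `D` lies in `Ω`. -/
structure IsCoreShell (D Ω : Set E3) : Prop where
  isOpen_core : IsOpen D
  isOpen_outer : IsOpen Ω
  isBounded_core : Bornology.IsBounded D
  isBounded_outer : Bornology.IsBounded Ω
  simplyConnected_core : SimplyConnectedSpace D
  simplyConnected_outer : SimplyConnectedSpace Ω
  closure_subset : closure D ⊆ Ω

/-! ### The conductivity problem and the polarization tensor -/

open Classical in
/-- The conductivity: `σc` in the core `D`, `σs` in the shell `Ω \ D`, `σm` outside `Ω`. -/
def conductivity (D Ω : Set E3) (σc σs σm : ℝ) (x : E3) : ℝ :=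
  if x ∈ D then σc else if x ∈ Ω then σs else σm

/-- `u` belongs to `H¹_loc(ℝ³)` and `G` is its weak gradient. -/
structure HasWeakGrad (u : E3 → ℝ) (G : E3 → E3) : Prop where
  memLp_fun : ∀ K : Set E3, IsCompact K → MemLp u 2 (volume.restrict K)
  memLp_grad : ∀ K : Set E3, IsCompact K → MemLp G 2 (volume.restrict K)
  integral_eq : ∀ φ : E3 → ℝ, ContDiff ℝ ∞ φ → HasCompactSupport φ →
    ∫ x, u x • gradient φ x = -∫ x, φ x • G x

/-- The filter of "`|x| → ∞`, up to null sets". -/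
def atInfinity : Filter E3 := Bornology.cobounded E3 ⊓ ae volume

/-- `u` is a weak solution of the conductivity problem `∇ · σ ∇u = 0` in `ℝ³`,
`u(x) - a · x = O(|x|⁻²)` as `|x| → ∞`. -/
def IsSolution (σ : E3 → ℝ) (a : E3) (u : E3 → ℝ) : Prop :=
  (∃ G : E3 → E3, HasWeakGrad u G ∧
    ∀ φ : E3 → ℝ, ContDiff ℝ ∞ φ → HasCompactSupport φ →
      ∫ x, σ x * inner ℝ (G x) (gradient φ x) = 0) ∧
  (fun x => u x - inner ℝ a x) =O[atInfinity] fun x => (‖x‖ ^ 2)⁻¹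

/-- `M` is the polarization tensor of the conductivity distribution `σ`: for every unit vector `a`
the conductivity problem is solvable, and its solution has the dipole expansion
`u(x) - a · x = (4π)⁻¹ ⟨M a, x⟩ / |x|³ + O(|x|⁻³)` as `|x| → ∞`. -/
def IsPolarizationTensor (σ : E3 → ℝ) (M : Matrix (Fin 3) (Fin 3) ℝ) : Prop :=
  ∀ a : E3, ‖a‖ = 1 →
    (∃ u : E3 → ℝ, IsSolution σ a u) ∧
    ∀ u : E3 → ℝ, IsSolution σ a u →
      (fun x => u x - inner ℝ a x -
          1 / (4 * Real.pi) * inner ℝ (Matrix.toEuclideanLin M a) x / ‖x‖ ^ 3)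
        =O[atInfinity] fun x => (‖x‖ ^ 3)⁻¹

/-- The pair `(D, Ω)` is a core-shell inclusion whose polarization tensor is zero. -/
def IsPTVanishing (D Ω : Set E3) (σc σs σm : ℝ) : Prop :=
  IsCoreShell D Ω ∧ IsPolarizationTensor (conductivity D Ω σc σs σm) 0

end CoreShell

end

noncomputable section

namespace CoreShell

open Set Filter Topology

/-! ### Polar coordinates -/

/-! The polarization tensor is a quadratic form of the total field. A constant field `a` is not
square integrable, but the contrast `σ - σm` is supported in a ball, so `a` may be cut off to that
ball (`ballVec`). The total field `T` differs from the cut-off field by an element of `gradSpace`,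
the L² closure of gradients of test functions, and it is the Lax-Milgram solution of a variational
equation (`IsField`). Every solution of the conductivity problem is obtained from `T` through
Newton's kernel. Hence the tensor is represented by the pairing of `(σ - σm) T` with constant
fields, and it suffices to make this pairing vanish (`IsAdmissible.isPolarizationTensor_zero`).

If `σc = σs`, neutrality forces `σm = σs`; the conductivity is constant and the unperturbed core
works. Let `σc ≠ σs`. The core is moved by a diffeomorphism `y ↦ y + V_B(y)`, where `V_B` is radial,
supported inside the middle sphere of the shell, and moves the inner sphere by the quadratic form of
a symmetric matrix `B`; these forms restricted to the sphere lie in `W6`. By the energy principle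
the polarization form is unchanged when the conductivity is pulled back (`polarization_transport`).
The result is a function `pt σ B` on a fixed configuration, with the outer perturbation in `σ` and
the core perturbation in `B`, acting in disjoint regions.

At the concentric ball the field is explicit, and neutrality says that it equals `a` outside, so `pt
σ0 0 = 0`. The derivative in `B` there is an integral of the explicit field against the first
variation of the coefficient. After averaging over spheres the radial integrand is an exact
derivative in the core and in the shell, and only a term on the inner sphere survives: `B ↦ k₁ tr(B)
I + k₂ B` (`inner_mulOp_dA_total`, `dpt`). Its eigenvalues `k₂` on traceless matrices and `3 k₁ +
k₂` on multiples of `I` are nonzero exactly because `σc ≠ σs`.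

A simplified Newton iteration `B ↦ B - dptInv (pt σ B)` is then a contraction of a small ball of
symmetric matrices (`exists_core`). A change of the outer boundary is not small as a multiplication
operator on L², since `σ` jumps; it is small when applied to a fixed field, by dominated
convergence. The reciprocity identity `IsField.inner_sub_inner` and the stability estimate
`IsField.norm_sub_le` are arranged so that only this weaker smallness is needed. Consequently the
core depends continuously on `h` already in the sup norm, and on the finite-dimensional target the
matrix norm controls the `W^{2,∞}` norm. -/

/-- The measure `dS(p) dr` on the space of polar coordinates. -/
abbrev polarMeasure : Measure (S2 × ℝ) := surf.prod (volume.restrict (Ioi 0))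

lemma map_val_volumeIoiPow :
    (Measure.volumeIoiPow 2).map (Subtype.val : Ioi (0 : ℝ) → ℝ) =
      (volume.restrict (Ioi (0 : ℝ))).withDensity fun r => ENNReal.ofReal (r ^ 2) := by
  ext s hs
  rw [Measure.map_apply measurable_subtype_coe hs, Measure.volumeIoiPow,
    withDensity_apply _ (measurable_subtype_coe hs), withDensity_apply _ hs,
    Measure.restrict_restrict hs]
  rw [← MeasurableEmbedding.comap_restrict (MeasurableEmbedding.subtype_coe measurableSet_Ioi)]
  rw [lintegral_subtype_comap measurableSet_Ioi (fun r : ℝ => ENNReal.ofReal (r ^ 2)),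
    Measure.restrict_restrict measurableSet_Ioi, inter_comm]

/-- The polar homeomorphism covers only the complement of the origin, which is enough because a
point is a null set. Working on `S2 × ℝ` rather than with the subtype of positive radii keeps the
later one-dimensional calculus on `ℝ`. -/
lemma map_smul_polar :
    (polarMeasure.withDensity fun q => ENNReal.ofReal (q.2 ^ 2)).map
      (fun q : S2 × ℝ => q.2 • (q.1 : E3)) = volume := by
  have h1 : (polarMeasure.withDensity fun q => ENNReal.ofReal (q.2 ^ 2)) =
      (surf.prod (Measure.volumeIoiPow 2)).map (Prod.map id Subtype.val) := by
    rw [polarMeasure, ← prod_withDensity_right (g := fun r : ℝ => ENNReal.ofReal (r ^ 2))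
      (by fun_prop), ← map_val_volumeIoiPow]
    rw [← Measure.map_prod_map _ _ measurable_id measurable_subtype_coe, Measure.map_id]
  rw [h1, Measure.map_map (by fun_prop) (by fun_prop)]
  have h2 := (volume : Measure E3).measurePreserving_homeomorphUnitSphereProd
  have hd : Module.finrank ℝ E3 - 1 = 2 := by simp
  rw [hd] at h2
  rw [← h2.map_eq, Measure.map_map (by fun_prop) h2.measurable]
  have : ((fun q : S2 × ℝ => q.2 • (q.1 : E3)) ∘ Prod.map id Subtype.val) ∘
      (homeomorphUnitSphereProd E3) = Subtype.val := by
    ext1 x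
    have := congrArg Subtype.val ((homeomorphUnitSphereProd E3).symm_apply_apply x)
    rwa [homeomorphUnitSphereProd_symm_apply_coe] at this
  rw [this, map_comap_subtype_coe (by measurability), restrict_compl_singleton]

variable {F : Type*} [NormedAddCommGroup F] [NormedSpace ℝ F]

lemma aemeasurable_smul_polar :
    AEMeasurable (fun q : S2 × ℝ => q.2 • (q.1 : E3))
      (polarMeasure.withDensity fun q => ENNReal.ofReal (q.2 ^ 2)) := by
  fun_prop

lemma integral_polar {f : E3 → F} (hf : AEStronglyMeasurable f volume) :
    ∫ x, f x = ∫ q : S2 × ℝ, q.2 ^ 2 • f (q.2 • (q.1 : E3)) ∂polarMeasure := by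
  rw [← map_smul_polar] at hf
  rw [← map_smul_polar, integral_map aemeasurable_smul_polar hf,
    integral_withDensity_eq_integral_toReal_smul (by fun_prop) (by simp)]
  simp only [ENNReal.toReal_ofReal (sq_nonneg _)]

lemma integrable_polar_iff {f : E3 → F} (hf : AEStronglyMeasurable f volume) :
    Integrable f ↔
      Integrable (fun q : S2 × ℝ => q.2 ^ 2 • f (q.2 • (q.1 : E3))) polarMeasure := by
  have hf' := hf
  rw [← map_smul_polar] at hf
  rw [← map_smul_polar, integrable_map_measure hf aemeasurable_smul_polar,
    integrable_withDensity_iff_integrable_smul' (by fun_prop) (by simp)]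
  simp only [ENNReal.toReal_ofReal (sq_nonneg _), Function.comp_def]

lemma norm_coe_S2 (p : S2) : ‖(p : E3)‖ = 1 := by simp

lemma inner_self_S2 (p : S2) : inner ℝ (p : E3) (p : E3) = 1 := by
  rw [real_inner_self_eq_norm_sq, norm_coe_S2]; norm_num

lemma tangentProj_apply (p : S2) (v : E3) :
    tangentProj p v = v - inner ℝ (p : E3) v • (p : E3) := by
  simp [tangentProj]

lemma inner_tangentProj_comm (p : S2) (v w : E3) :
    inner ℝ (tangentProj p v) w = inner ℝ v (tangentProj p w) := by
  simp only [tangentProj_apply, inner_sub_left, inner_sub_right, inner_smul_left, inner_smul_right,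
    real_inner_comm w (p : E3), RCLike.conj_to_real]
  rw [real_inner_comm (p : E3) v]
  ring

lemma continuous_tangentProj : Continuous tangentProj := by
  unfold tangentProj
  fun_prop

/-! ### The divergence theorem on the sphere -/

lemma hasFDerivAt_norm_of_ne {x : E3} (hx : x ≠ 0) :
    HasFDerivAt (fun y : E3 => ‖y‖) (‖x‖⁻¹ • innerSL ℝ x) x := by
  have h := (hasStrictFDerivAt_norm_sq x).hasFDerivAt.sqrt (by positivity)
  simp only [Real.sqrt_sq (norm_nonneg _)] at h
  refine h.congr_fderiv ?_
  ext v
  have : ‖x‖ ≠ 0 := norm_ne_zero_iff.2 hx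
  simp
  field_simp

/-- Integration by parts against the constant function `1`. -/
lemma integral_hasFDerivAt_eq_zero {f : E3 → ℝ} {f' : E3 → E3 →L[ℝ] ℝ} {v : E3}
    (hf : ∀ x, HasFDerivAt f (f' x) x) (h : Integrable f) (h' : Integrable fun x => f' x v) :
    ∫ x, f' x v = 0 := by
  have := integral_bilinear_hasFDerivAt_right_eq_neg_left_of_integrable (μ := (volume : Measure E3))
    (f := fun _ => (1 : ℝ)) (f' := fun _ => 0) (g := f) (g' := f') (v := v)
    (B := ContinuousLinearMap.mul ℝ ℝ) (by simp) (by simpa using h') (by simpa using h)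
    (fun x _ => hasFDerivAt_const _ _) (fun x _ => hf x)
  simpa using this

/-- A smooth cutoff on the half line supported in `(1, 3)`. -/
def radialBump : ContDiffBump (2 : ℝ) := ⟨1 / 2, 1, by norm_num, by norm_num⟩

lemma radialBump_eq_zero {r : ℝ} (hr : r ≤ 1 ∨ 3 ≤ r) : radialBump r = 0 := by
  apply radialBump.zero_of_le_dist
  rw [Real.dist_eq]
  change (1 : ℝ) ≤ _
  rcases hr with hr | hr
  · rw [abs_of_nonpos (by linarith)]; linarith
  · rw [abs_of_nonneg (by linarith)]; linarith

lemma deriv_radialBump_eq_zero {r : ℝ} (hr : r < 1) : deriv radialBump r = 0 := by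
  have : (radialBump : ℝ → ℝ) =ᶠ[𝓝 r] fun _ => 0 := by
    filter_upwards [Iio_mem_nhds hr] with s hs using radialBump_eq_zero (Or.inl (le_of_lt hs))
  rw [this.deriv_eq]; simp

lemma hasDerivAt_radialBump (r : ℝ) : HasDerivAt radialBump (deriv radialBump r) r :=
  ((radialBump.contDiff (n := 1)).differentiable one_ne_zero r).hasDerivAt

lemma continuous_deriv_radialBump : Continuous (deriv radialBump) :=
  (radialBump.contDiff (n := 1)).continuous_deriv le_rfl

lemma hasCompactSupport_deriv_radialBump : HasCompactSupport (deriv radialBump) :=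
  radialBump.hasCompactSupport.deriv

lemma integral_radialBump_pos : 0 < ∫ r in Ioi (0 : ℝ), r * radialBump r := by
  have hc : Continuous fun r : ℝ => r * radialBump r := by
    have := radialBump.continuous; fun_prop
  have hi : Integrable fun r : ℝ => r * radialBump r :=
    hc.integrable_of_hasCompactSupport (radialBump.hasCompactSupport.mul_left)
  have h0 : ∀ r : ℝ, 0 ≤ r * radialBump r := by
    intro r
    rcases le_or_gt r 0 with hr | hr
    · rw [radialBump_eq_zero (Or.inl (by linarith))]; simp
    · exact mul_nonneg hr.le radialBump.nonneg
  have h1 : ∫ r in Ioi (0 : ℝ), r * radialBump r = ∫ r, r * radialBump r := by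
    apply setIntegral_eq_integral_of_forall_compl_eq_zero
    intro r hr
    rw [radialBump_eq_zero (Or.inl (le_trans (not_lt.1 hr) zero_le_one))]; simp
  rw [h1]
  apply hc.integral_pos_of_hasCompactSupport_nonneg_nonzero radialBump.hasCompactSupport.mul_left h0
    (x := 2)
  rw [radialBump.one_of_mem_closedBall]
  · norm_num
  · exact Metric.mem_closedBall_self radialBump.rIn_pos.le

lemma integral_deriv_radialBump :
    ∫ r in Ioi (0 : ℝ), r ^ 2 * deriv radialBump r =
      -2 * ∫ r in Ioi (0 : ℝ), r * radialBump r := by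
  have hc := radialBump.continuous
  have hc' := continuous_deriv_radialBump
  have hi : Integrable fun r : ℝ => r * radialBump r :=
    (by fun_prop : Continuous fun r : ℝ => r * radialBump r).integrable_of_hasCompactSupport
      (radialBump.hasCompactSupport.mul_left)
  have hi0 : Integrable fun r : ℝ => r ^ 2 * radialBump r :=
    (by fun_prop : Continuous fun r : ℝ => r ^ 2 * radialBump r).integrable_of_hasCompactSupport
      (radialBump.hasCompactSupport.mul_left)
  have hi' : Integrable fun r : ℝ => r ^ 2 * deriv radialBump r :=
    (by fun_prop : Continuous fun r : ℝ => r ^ 2 * deriv radialBump r).integrable_of_hasCompactSupport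
      (hasCompactSupport_deriv_radialBump.mul_left)
  have h1 : ∫ r in Ioi (0 : ℝ), r * radialBump r = ∫ r, r * radialBump r := by
    apply setIntegral_eq_integral_of_forall_compl_eq_zero
    intro r hr
    rw [radialBump_eq_zero (Or.inl (le_trans (not_lt.1 hr) zero_le_one))]; simp
  have h2 : ∫ r in Ioi (0 : ℝ), r ^ 2 * deriv radialBump r = ∫ r, r ^ 2 * deriv radialBump r := by
    apply setIntegral_eq_integral_of_forall_compl_eq_zero
    intro r hr
    rw [deriv_radialBump_eq_zero (lt_of_le_of_lt (not_lt.1 hr) zero_lt_one)]; simp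
  have h3 := integral_eq_zero_of_hasDerivAt_of_integrable
    (f := fun r : ℝ => r ^ 2 * radialBump r)
    (f' := fun r : ℝ => 2 * (r * radialBump r) + r ^ 2 * deriv radialBump r)
    (fun r => by
      refine ((hasDerivAt_pow 2 r).fun_mul (hasDerivAt_radialBump r)).congr_deriv ?_
      norm_num; ring) ((hi.const_mul 2).add hi') hi0
  rw [integral_add (hi.const_mul 2) hi', integral_const_mul] at h3
  rw [h1, h2]; linarith

/-- The divergence theorem on the sphere, whose mean curvature is `2`. -/
theorem integral_tangentProj_fderiv {ψ : E3 → ℝ} (hψ : ContDiff ℝ 1 ψ) (v : E3) :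
    ∫ p : S2, fderiv ℝ ψ (p : E3) (tangentProj p v) ∂surf =
      2 * ∫ p : S2, ψ p * inner ℝ (p : E3) v ∂surf := by
  -- The function on the sphere is extended with homogeneity 0 and multiplied by a radial cutoff.
  -- The integral over space of a directional derivative of this extension vanishes. In polar
  -- coordinates it splits into two products of a spherical and a radial integral, and the ratio of
  -- the two radial integrals is the factor 2 of the claim.
  set f : E3 → ℝ := fun x => radialBump ‖x‖ * ψ (‖x‖⁻¹ • x) with hfdef
  set f' : E3 → E3 →L[ℝ] ℝ := fun x =>
    (deriv radialBump ‖x‖ * ‖x‖⁻¹ * ψ (‖x‖⁻¹ • x)) • innerSL ℝ x +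
      (radialBump ‖x‖ * ‖x‖⁻¹) • (fderiv ℝ ψ (‖x‖⁻¹ • x)).comp
        (ContinuousLinearMap.id ℝ E3 - (innerSL ℝ (‖x‖⁻¹ • x)).smulRight (‖x‖⁻¹ • x)) with hf'def
  have hf0 : ∀ x, ‖x‖ ≤ 1 ∨ 3 ≤ ‖x‖ → f x = 0 := fun x hx => by
    simp [hfdef, radialBump_eq_zero hx]
  have hf : ∀ x, HasFDerivAt f (f' x) x := by
    intro x
    by_cases hx : x = 0
    · have h1 : f' x = 0 := by simp [hf'def, hx]
      rw [h1]
      refine (hasFDerivAt_const (0 : ℝ) x).congr_of_eventuallyEq ?_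
      filter_upwards [Metric.ball_mem_nhds x one_pos] with y hy
      rw [hx, mem_ball_zero_iff] at hy
      exact hf0 y (Or.inl hy.le)
    · have hn : ‖x‖ ≠ 0 := norm_ne_zero_iff.2 hx
      have h1 := hasFDerivAt_norm_of_ne hx
      have h2 := (hasDerivAt_radialBump ‖x‖).comp_hasFDerivAt x h1
      have h3 := ((hasDerivAt_inv hn).comp_hasFDerivAt x h1).fun_smul (hasFDerivAt_id x)
      have h4 := HasFDerivAt.comp (g := ψ) (f := fun y : E3 => ‖y‖⁻¹ • y) x
        ((hψ.differentiable one_ne_zero (‖x‖⁻¹ • x)).hasFDerivAt) h3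
      refine (h2.fun_mul h4).congr_fderiv ?_
      ext v
      simp only [hf'def, Function.comp_apply, id_eq, add_apply,
        smul_apply, ContinuousLinearMap.comp_apply,
        sub_apply, ContinuousLinearMap.smulRight_apply, innerSL_apply_apply,
        ContinuousLinearMap.id_apply, smul_eq_mul, map_add, map_smul, map_sub]
      field_simp
      ring
  have hfc : Continuous f := continuous_iff_continuousAt.2 fun x => (hf x).continuousAt
  have hfi : Integrable f := by
    apply hfc.integrable_of_hasCompactSupport
    apply HasCompactSupport.of_support_subset_isCompact (isCompact_closedBall (0 : E3) 3)
    intro x hx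
    rw [mem_closedBall_zero_iff]
    by_contra h
    exact hx (hf0 x (Or.inr (not_le.1 h).le))
  have hmeas : AEStronglyMeasurable (fun x => f' x v) volume := by
    have : (fun x => f' x v) = fun x => fderiv ℝ f x v := by
      ext x; rw [(hf x).fderiv]
    rw [this]
    exact (measurable_fderiv_apply_const ℝ f v).aestronglyMeasurable
  have hpol : ∀ᵐ q : S2 × ℝ ∂polarMeasure, q.2 ^ 2 • f' (q.2 • (q.1 : E3)) v =
      (ψ q.1 * inner ℝ (q.1 : E3) v) * (q.2 ^ 2 * deriv radialBump q.2) +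
        fderiv ℝ ψ (q.1 : E3) (tangentProj q.1 v) * (q.2 * radialBump q.2) := by
    have : ∀ᵐ q : S2 × ℝ ∂polarMeasure, q.2 ∈ Ioi (0 : ℝ) :=
      Measure.quasiMeasurePreserving_snd.ae (ae_restrict_mem measurableSet_Ioi)
    filter_upwards [this] with q hq
    have hq' : (0 : ℝ) < q.2 := hq
    have hn : ‖q.2 • (q.1 : E3)‖ = q.2 := by
      rw [norm_smul, norm_coe_S2, Real.norm_of_nonneg hq'.le, mul_one]
    have hs : q.2⁻¹ • q.2 • (q.1 : E3) = q.1 := by rw [smul_smul, inv_mul_cancel₀ hq'.ne', one_smul]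
    simp only [hf'def, hn, hs, add_apply,
        smul_apply, ContinuousLinearMap.comp_apply, innerSL_apply_apply,
        smul_eq_mul, inner_smul_left, RCLike.conj_to_real]
    change _ = _ + fderiv ℝ ψ (q.1 : E3) ((ContinuousLinearMap.id ℝ E3 -
      (innerSL ℝ (q.1 : E3)).smulRight (q.1 : E3)) v) * _
    field_simp
  have hc := radialBump.continuous
  have hc' := continuous_deriv_radialBump
  have hi : IntegrableOn (fun r : ℝ => r * radialBump r) (Ioi 0) :=
    ((by fun_prop : Continuous fun r : ℝ => r * radialBump r).integrable_of_hasCompactSupport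
      (radialBump.hasCompactSupport.mul_left)).integrableOn
  have hi' : IntegrableOn (fun r : ℝ => r ^ 2 * deriv radialBump r) (Ioi 0) :=
    ((by fun_prop : Continuous fun r : ℝ => r ^ 2 * deriv radialBump r).integrable_of_hasCompactSupport
      (hasCompactSupport_deriv_radialBump.mul_left)).integrableOn
  have hψc := hψ.continuous
  have hψd := hψ.continuous_fderiv one_ne_zero
  have hT := continuous_tangentProj
  have hA : Integrable (fun p : S2 => ψ p * inner ℝ (p : E3) v) surf :=
    (by fun_prop : Continuous fun p : S2 => ψ p * inner ℝ (p : E3) v).integrable_of_hasCompactSupport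
      (HasCompactSupport.of_compactSpace _)
  have hB : Integrable (fun p : S2 => fderiv ℝ ψ (p : E3) (tangentProj p v)) surf :=
    (by fun_prop : Continuous fun p : S2 =>
      fderiv ℝ ψ (p : E3) (tangentProj p v)).integrable_of_hasCompactSupport
      (HasCompactSupport.of_compactSpace _)
  have hi1 := hA.mul_prod hi'
  have hi2 := hB.mul_prod hi
  have hfi' : Integrable fun x => f' x v := by
    rw [integrable_polar_iff hmeas, integrable_congr hpol]
    exact hi1.add hi2
  have h0 := integral_hasFDerivAt_eq_zero hf hfi hfi'
  rw [integral_polar hmeas, integral_congr_ae hpol, integral_add hi1 hi2,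
    integral_prod_mul (fun p : S2 => ψ p * inner ℝ (p : E3) v)
      (fun r : ℝ => r ^ 2 * deriv radialBump r),
    integral_prod_mul (fun p : S2 => fderiv ℝ ψ (p : E3) (tangentProj p v))
      (fun r : ℝ => r * radialBump r),
    integral_deriv_radialBump] at h0
  have hpos := integral_radialBump_pos
  apply mul_right_cancel₀ hpos.ne'
  linarith

/-- Integration by parts on the sphere of radius `r`. -/
theorem integral_mul_fderiv_tangentProj {q φ : E3 → ℝ} (hq : ContDiff ℝ 1 q) (hφ : ContDiff ℝ 1 φ)
    (r : ℝ) (v : E3) :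
    r * ∫ p : S2, q p * fderiv ℝ φ (r • (p : E3)) (tangentProj p v) ∂surf =
      ∫ p : S2, φ (r • (p : E3)) *
        (2 * (q p * inner ℝ (p : E3) v) - fderiv ℝ q (p : E3) (tangentProj p v)) ∂surf := by
  -- The divergence theorem is applied to the product of `q` with the rescaled `φ`; the factor `r`
  -- comes from the chain rule.
  have h := integral_tangentProj_fderiv (ψ := fun x => q x * φ (r • x))
    (by fun_prop) v
  have hd : ∀ x w, fderiv ℝ (fun x => q x * φ (r • x)) x w =
      φ (r • x) * fderiv ℝ q x w + r * (q x * fderiv ℝ φ (r • x) w) := by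
    intro x w
    have h1 := (hq.differentiable one_ne_zero x).hasFDerivAt
    have h2 := HasFDerivAt.comp (g := φ) (f := fun y : E3 => r • y) x
      ((hφ.differentiable one_ne_zero (r • x)).hasFDerivAt) ((hasFDerivAt_id x).const_smul r)
    have h3 : HasFDerivAt (fun x => q x * φ (r • x)) _ x := h1.fun_mul h2
    rw [h3.fderiv]
    simp; ring
  simp only [hd] at h
  have c1 := hq.continuous
  have c2 := hφ.continuous
  have c3 := hq.continuous_fderiv one_ne_zero
  have c4 := hφ.continuous_fderiv one_ne_zero
  have hT := continuous_tangentProj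
  have int : ∀ F : S2 → ℝ, Continuous F → Integrable F surf := fun F hF =>
    hF.integrable_of_hasCompactSupport (HasCompactSupport.of_compactSpace _)
  rw [integral_add (int _ (by fun_prop)) (int _ (by fun_prop)), integral_const_mul] at h
  simp only [mul_sub]
  rw [integral_sub (int _ (by fun_prop)) (int _ (by fun_prop)), eq_sub_iff_add_eq, add_comm, h,
    ← integral_const_mul]
  congr 1; ext p; ring

/-! ### Moments of the surface measure -/

/-- The area of the unit sphere. -/
def sphereArea : ℝ := surf.real univ

lemma sphereArea_pos : 0 < sphereArea := by
  have : surf ≠ 0 := Measure.toSphere_ne_zero _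
  rw [sphereArea, measureReal_def]
  exact ENNReal.toReal_pos (by rwa [ne_eq, Measure.measure_univ_eq_zero]) (measure_ne_top _ _)

lemma integrable_surf {F : Type*} [NormedAddCommGroup F] {f : S2 → F}
    (hf : Continuous f) : Integrable f surf :=
  hf.integrable_of_hasCompactSupport (HasCompactSupport.of_compactSpace _)

/-- The divergence theorem for the linear function `⟪w, ·⟫` reads `|S²| ⟪w, v⟫ - I = 2 I` for the
integral `I` in question. -/
lemma integral_inner_mul_inner (v w : E3) :
    ∫ p : S2, inner ℝ v (p : E3) * inner ℝ w (p : E3) ∂surf = sphereArea / 3 * inner ℝ v w := by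
  have h := integral_tangentProj_fderiv (ψ := fun x => inner ℝ w x)
    (contDiff_const.inner ℝ contDiff_id) v
  have hd : ∀ x u : E3, fderiv ℝ (fun x => inner ℝ w x) x u = inner ℝ w u := fun x u => by
    have : HasFDerivAt (fun x : E3 => inner ℝ w x) (innerSL ℝ w) x := (innerSL ℝ w).hasFDerivAt
    rw [this.fderiv, innerSL_apply_apply]
  simp only [hd, tangentProj_apply, inner_sub_right, inner_smul_right] at h
  rw [integral_sub (integrable_surf (by fun_prop)) (integrable_surf (by fun_prop))] at h
  simp only [integral_const, smul_eq_mul] at h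
  change sphereArea * _ - _ = _ at h
  have e : ∀ p : S2, inner ℝ w (p : E3) * inner ℝ (p : E3) v =
      inner ℝ v (p : E3) * inner ℝ w (p : E3) := fun p => by rw [real_inner_comm v (p : E3)]; ring
  have e' : ∀ p : S2, inner ℝ (p : E3) v * inner ℝ w (p : E3) =
      inner ℝ v (p : E3) * inner ℝ w (p : E3) := fun p => by rw [real_inner_comm v (p : E3)]
  simp only [e, e'] at h
  rw [real_inner_comm w v]
  linarith

/-- The trace of an operator on `ℝ³`. -/
def trace3 : (E3 →L[ℝ] E3) →L[ℝ] ℝ :=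
  ∑ i : Fin 3, (innerSL ℝ (EuclideanSpace.basisFun (Fin 3) ℝ i)).comp
    (ContinuousLinearMap.apply ℝ E3 (EuclideanSpace.basisFun (Fin 3) ℝ i))

lemma trace3_apply (B : E3 →L[ℝ] E3) :
    trace3 B = ∑ i : Fin 3, inner ℝ (EuclideanSpace.basisFun (Fin 3) ℝ i)
      (B (EuclideanSpace.basisFun (Fin 3) ℝ i)) := by
  simp [trace3]

lemma trace3_id : trace3 (ContinuousLinearMap.id ℝ E3) = 3 := by
  rw [trace3_apply]
  simp

lemma integral_quadratic (B : E3 →L[ℝ] E3) :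
    ∫ p : S2, inner ℝ (p : E3) (B p) ∂surf = sphereArea / 3 * trace3 B := by
  set e := EuclideanSpace.basisFun (Fin 3) ℝ with he
  have h : ∀ p : S2, inner ℝ (p : E3) (B p) =
      ∑ i, inner ℝ (e i) (p : E3) * inner ℝ (ContinuousLinearMap.adjoint B (e i)) (p : E3) := by
    intro p
    rw [← e.sum_inner_mul_inner (p : E3) (B p)]
    refine Finset.sum_congr rfl fun i _ => ?_
    rw [ContinuousLinearMap.adjoint_inner_left, real_inner_comm]
  simp only [h]
  rw [integral_finsetSum _ fun i _ => integrable_surf (by fun_prop)]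
  simp only [integral_inner_mul_inner, trace3_apply, ContinuousLinearMap.adjoint_inner_right,
    ← Finset.mul_sum]
  rw [← he]
  congr 1
  refine Finset.sum_congr rfl fun i _ => real_inner_comm _ _

lemma hasFDerivAt_quadratic (B : E3 →L[ℝ] E3) (x : E3) :
    HasFDerivAt (fun x : E3 => inner ℝ x (B x))
      ((innerSL ℝ x).comp B + innerSL ℝ (B x)) x := by
  refine ((hasFDerivAt_id x).inner ℝ B.hasFDerivAt).congr_fderiv ?_
  ext v
  simp [real_inner_comm]

lemma contDiff_quadratic (B : E3 →L[ℝ] E3) {n : WithTop ℕ∞} :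
    ContDiff ℝ n (fun x : E3 => inner ℝ x (B x)) :=
  contDiff_id.inner ℝ B.contDiff

lemma contDiff_inner_left (a : E3) {n : WithTop ℕ∞} :
    ContDiff ℝ n (fun x : E3 => inner ℝ a x) :=
  contDiff_const.inner ℝ contDiff_id

/-- The divergence theorem for the cubic `⟪x, B x⟫ ⟪a, x⟫`: the quartic integral occurs with factor
3 in the tangential derivative and 2 on the curvature side. Five times it is therefore a combination
of second moments, each carrying `|S²| / 3`, which explains the `15`. -/
lemma integral_quartic {B : E3 →L[ℝ] E3} (hB : ∀ x y, inner ℝ (B x) y = inner ℝ x (B y))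
    (a v : E3) :
    ∫ p : S2, inner ℝ (p : E3) (B p) * (inner ℝ a (p : E3) * inner ℝ v (p : E3)) ∂surf =
      sphereArea / 15 * (trace3 B * inner ℝ a v + 2 * inner ℝ (B a) v) := by
  have h := integral_tangentProj_fderiv (ψ := fun x => inner ℝ x (B x) * inner ℝ a x)
    ((contDiff_quadratic B).mul (contDiff_inner_left a)) v
  have hd : ∀ x u : E3, fderiv ℝ (fun x => inner ℝ x (B x) * inner ℝ a x) x u =
      inner ℝ x (B x) * inner ℝ a u + inner ℝ a x * (2 * inner ℝ (B x) u) := fun x u => by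
    have h1 : HasFDerivAt (fun x : E3 => inner ℝ a x) (innerSL ℝ a) x := (innerSL ℝ a).hasFDerivAt
    rw [((hasFDerivAt_quadratic B x).fun_mul h1).fderiv]
    simp only [add_apply, smul_apply, ContinuousLinearMap.comp_apply,
      innerSL_apply_apply, smul_eq_mul, ← hB]
    ring
  simp only [hd] at h
  have e1 : ∀ p : S2, inner ℝ (p : E3) (B p) * inner ℝ a (tangentProj p v) +
        inner ℝ a (p : E3) * (2 * inner ℝ (B p) (tangentProj p v)) =
      inner ℝ (p : E3) (B p) * inner ℝ a v +
        2 * (inner ℝ a (p : E3) * inner ℝ (B v) (p : E3)) -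
        3 * (inner ℝ (p : E3) (B p) * (inner ℝ a (p : E3) * inner ℝ v (p : E3))) := by
    intro p
    simp only [tangentProj_apply, inner_sub_right, inner_smul_right]
    rw [hB p v, real_inner_comm (p : E3) (B v), real_inner_comm (p : E3) (B p),
      real_inner_comm (p : E3) v]
    ring
  have e2 : ∀ p : S2, inner ℝ (p : E3) (B p) * inner ℝ a (p : E3) * inner ℝ (p : E3) v =
      inner ℝ (p : E3) (B p) * (inner ℝ a (p : E3) * inner ℝ v (p : E3)) := by
    intro p; rw [real_inner_comm (p : E3) v]; ring
  simp only [e1, e2] at h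
  rw [integral_sub (integrable_surf (by fun_prop)) (integrable_surf (by fun_prop)),
    integral_add (integrable_surf (by fun_prop)) (integrable_surf (by fun_prop)),
    integral_const_mul, integral_const_mul, integral_mul_const, integral_quadratic,
    integral_inner_mul_inner] at h
  rw [hB a v]
  linarith

/-! ### Weak derivatives of restrictions of smooth functions -/

lemma continuous_gradient {q : E3 → ℝ} (hq : ContDiff ℝ 1 q) : Continuous (gradient q) :=
  (InnerProductSpace.toDual ℝ E3).symm.continuous.comp (hq.continuous_fderiv one_ne_zero)

lemma inner_gradient (q : E3 → ℝ) (x v : E3) : inner ℝ (gradient q x) v = fderiv ℝ q x v := by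
  simp [gradient]

/-- This is integration by parts on the unit sphere, tested against each fixed vector. -/
lemma hasWeakTangentGrad_of_contDiff {q : E3 → ℝ} (hq : ContDiff ℝ 1 q) :
    HasWeakTangentGrad (fun p => q p) (fun p => tangentProj p (gradient q p)) := by
  have c1 := hq.continuous
  have c2 := continuous_gradient hq
  have hT := continuous_tangentProj
  refine ⟨integrable_surf (by fun_prop), integrable_surf (by fun_prop), fun φ hφ => ?_⟩
  have c3 := hφ.continuous
  have c4 := continuous_gradient (hφ.of_le (by exact_mod_cast le_top))
  refine ext_inner_left ℝ fun v => ?_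
  rw [← integral_inner (integrable_surf (by fun_prop)),
    ← integral_inner (integrable_surf (by fun_prop))]
  have h := integral_mul_fderiv_tangentProj hq (hφ.of_le (by exact_mod_cast le_top)) 1 v
  simp only [one_mul, one_smul] at h
  simp only [inner_sub_right, inner_smul_right, ← inner_tangentProj_comm]
  refine Eq.trans (integral_congr_ae (ae_of_all _ fun p => ?_))
    (h.trans (integral_congr_ae (ae_of_all _ fun p => ?_)))
  · simp only []
    rw [real_inner_comm, inner_gradient]
  · simp only []
    rw [real_inner_comm _ (tangentProj p v), inner_gradient, real_inner_comm v]
    ring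

lemma hasWeakTangentDeriv_of_contDiff {G : E3 → E3} (hG : ContDiff ℝ 1 G) :
    HasWeakTangentDeriv (fun p => G p) (fun p => (fderiv ℝ G p).comp (tangentProj p)) := by
  intro c
  have h := hasWeakTangentGrad_of_contDiff (q := fun x => inner ℝ (G x) c)
    (hG.inner ℝ contDiff_const)
  convert h using 2 with p
  refine ext_inner_right ℝ fun v => ?_
  rw [ContinuousLinearMap.adjoint_inner_left, inner_tangentProj_comm, inner_gradient,
    ContinuousLinearMap.comp_apply]
  have h1 := ((hG.differentiable one_ne_zero (p : E3)).hasFDerivAt).inner ℝ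
    (hasFDerivAt_const c (p : E3))
  rw [h1.fderiv]
  simp [real_inner_comm]

lemma norm_tangentProj_apply_le (p : S2) (v : E3) : ‖tangentProj p v‖ ≤ 2 * ‖v‖ := by
  rw [tangentProj_apply]
  refine (norm_sub_le _ _).trans ?_
  rw [norm_smul, norm_coe_S2, mul_one]
  have := norm_inner_le_norm (𝕜 := ℝ) (p : E3) v
  rw [norm_coe_S2] at this
  linarith

/-- The quadratic form of an operator, restricted to the sphere. -/
def sphereQuad (B : E3 →L[ℝ] E3) : S2 → ℝ := fun p => inner ℝ (p : E3) (B p)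

lemma continuous_sphereQuad (B : E3 →L[ℝ] E3) : Continuous (sphereQuad B) := by
  unfold sphereQuad; fun_prop

lemma abs_sphereQuad_le (B : E3 →L[ℝ] E3) (p : S2) : |sphereQuad B p| ≤ ‖B‖ := by
  have h1 := abs_real_inner_le_norm (p : E3) (B p)
  have h2 := B.le_opNorm (p : E3)
  rw [norm_coe_S2] at h1 h2
  unfold sphereQuad; linarith

lemma sphereQuad_sub (B C : E3 →L[ℝ] E3) : sphereQuad (B - C) = sphereQuad B - sphereQuad C := by
  ext p; simp [sphereQuad, inner_sub_right]

/-- With `C = B + B†` the tangential gradient is the restriction of the polynomial field `C x - ⟪x,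
C x⟫ x`, whose derivative is explicit. The three terms of the norm are bounded by `1`, `4` and `36`
times `‖B‖`. This turns continuity of the matrix into continuity in `W6`. -/
lemma norm2inf_sphereQuad_le (B : E3 →L[ℝ] E3) :
    norm2inf (sphereQuad B) ≤ ENNReal.ofReal (41 * ‖B‖) := by
  set C : E3 →L[ℝ] E3 := B + ContinuousLinearMap.adjoint B with hC
  have hCn : ‖C‖ ≤ 2 * ‖B‖ := by
    refine (norm_add_le _ _).trans ?_
    rw [LinearIsometryEquiv.norm_map]; linarith
  set G : E3 → E3 := fun x => C x - inner ℝ x (C x) • x with hGdef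
  have hG : ContDiff ℝ 1 G :=
    C.contDiff.sub ((contDiff_quadratic C).smul contDiff_id)
  have hGd : ∀ x v, fderiv ℝ G x v =
      C v - (inner ℝ x (C x) • v + (inner ℝ x (C v) + inner ℝ (C x) v) • x) := by
    intro x v
    have h : HasFDerivAt G _ x := C.hasFDerivAt.fun_sub
      ((hasFDerivAt_quadratic C x).fun_smul (hasFDerivAt_id x))
    rw [h.fderiv]; simp
  have h1 : HasWeakTangentGrad (sphereQuad B) (fun p => G p) := by
    have key := hasWeakTangentGrad_of_contDiff (contDiff_quadratic B)
    suffices hfun : (fun p : S2 => G p) = fun p : S2 =>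
        tangentProj p (gradient (fun x : E3 => inner ℝ x (B x)) (p : E3)) by
      rw [hfun]; exact key
    funext p
    have : gradient (fun x : E3 => inner ℝ x (B x)) (p : E3) = C p := by
      refine ext_inner_right ℝ fun v => ?_
      rw [inner_gradient, (hasFDerivAt_quadratic B p).fderiv]
      simp [hC, inner_add_left, ContinuousLinearMap.adjoint_inner_left]
      ring
    rw [this, tangentProj_apply]
  have h2 : IsWeakHessian (fun p : S2 => G p)
      (fun p => (tangentProj p).comp ((fderiv ℝ G p).comp (tangentProj p))) :=
    ⟨_, hasWeakTangentDeriv_of_contDiff hG, ae_of_all _ fun _ => rfl⟩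
  have hCp : ∀ p : S2, ∀ v : E3, ‖C v‖ ≤ 2 * ‖B‖ * ‖v‖ := fun p v =>
    (C.le_opNorm v).trans (by gcongr)
  have hCi : ∀ v w : E3, |inner ℝ v (C w)| ≤ 2 * ‖B‖ * ‖v‖ * ‖w‖ := fun v w => by
    refine (abs_real_inner_le_norm _ _).trans ?_
    calc ‖v‖ * ‖C w‖ ≤ ‖v‖ * (2 * ‖B‖ * ‖w‖) := by
          gcongr; exact (C.le_opNorm w).trans (by gcongr)
      _ = _ := by ring
  have n1 : eLpNorm (sphereQuad B) ⊤ surf ≤ ENNReal.ofReal ‖B‖ := by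
    rw [eLpNorm_exponent_top]
    refine eLpNormEssSup_le_of_ae_bound (ae_of_all _ fun p => ?_)
    rw [Real.norm_eq_abs]; exact abs_sphereQuad_le B p
  have n2 : eLpNorm (fun p : S2 => G p) ⊤ surf ≤ ENNReal.ofReal (4 * ‖B‖) := by
    rw [eLpNorm_exponent_top]
    refine eLpNormEssSup_le_of_ae_bound (ae_of_all _ fun p => ?_)
    refine (norm_sub_le _ _).trans ?_
    rw [norm_smul, norm_coe_S2, Real.norm_eq_abs]
    have a1 := hCp p p
    have a2 := hCi p p
    rw [norm_coe_S2] at a1 a2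
    linarith
  have n3 : eLpNorm (fun p : S2 => (tangentProj p).comp ((fderiv ℝ G p).comp (tangentProj p)))
      ⊤ surf ≤ ENNReal.ofReal (36 * ‖B‖) := by
    rw [eLpNorm_exponent_top]
    refine eLpNormEssSup_le_of_ae_bound (ae_of_all _ fun p => ?_)
    refine ContinuousLinearMap.opNorm_le_bound _ (by positivity) fun v => ?_
    simp only [ContinuousLinearMap.comp_apply]
    set w := tangentProj p v with hw
    have hwn := norm_tangentProj_apply_le p v
    refine (norm_tangentProj_apply_le p _).trans ?_
    have hd : ‖fderiv ℝ G p w‖ ≤ 8 * ‖B‖ * ‖w‖ := by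
      rw [hGd]
      refine (norm_sub_le _ _).trans ?_
      have a1 := hCp p w
      have a2 : ‖(inner ℝ (p : E3) (C p) • w + (inner ℝ (p : E3) (C w) +
          inner ℝ (C p) w) • (p : E3))‖ ≤ 2 * ‖B‖ * ‖w‖ + (2 * ‖B‖ * ‖w‖ + 2 * ‖B‖ * ‖w‖) := by
        refine (norm_add_le _ _).trans ?_
        rw [norm_smul, norm_smul, norm_coe_S2, Real.norm_eq_abs, Real.norm_eq_abs, mul_one]
        have b1 := hCi p p
        have b2 := hCi p w
        have b3 := hCi w p
        rw [norm_coe_S2] at b1 b2 b3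
        rw [real_inner_comm] at b3
        gcongr
        · linarith
        · exact (abs_add_le _ _).trans (add_le_add (by linarith) (by linarith))
      linarith
    have : 0 ≤ ‖B‖ * ‖v‖ := by positivity
    nlinarith [mul_le_mul_of_nonneg_left hwn (norm_nonneg B)]
  refine (iInf₂_le_of_le (fun p : S2 => G p)
    (fun p => (tangentProj p).comp ((fderiv ℝ G p).comp (tangentProj p)))
    (iInf₂_le h1 h2)).trans ?_
  refine (add_le_add (add_le_add n1 n2) n3).trans ?_
  rw [← ENNReal.ofReal_add (by positivity) (by positivity),
    ← ENNReal.ofReal_add (by positivity) (by positivity)]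
  apply ENNReal.ofReal_le_ofReal; linarith

lemma eLpNorm_le_norm2inf (f : S2 → ℝ) : eLpNorm f ⊤ surf ≤ norm2inf f :=
  le_iInf fun _ => le_iInf fun _ => le_iInf fun _ => le_iInf fun _ =>
    le_add_right (le_add_right le_rfl)

/-- For continuous `f` the set where `|f|` exceeds its essential supremum is open and null, hence
empty because the surface measure charges open sets. Only this sup bound on `h` enters the rest of
the argument. -/
lemma abs_lt_of_norm2inf_lt {f : S2 → ℝ} (hf : Continuous f) {r : ℝ}
    (h : norm2inf f < ENNReal.ofReal r) (p : S2) : |f p| < r := by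
  have h1 := (eLpNorm_le_norm2inf f).trans_lt h
  have hr : 0 < r := by
    by_contra hr
    rw [ENNReal.ofReal_of_nonpos (not_lt.1 hr)] at h1
    exact not_lt_zero h1
  rw [eLpNorm_exponent_top] at h1
  by_contra hp
  have hopen : IsOpen {q : S2 | (eLpNormEssSup f surf).toReal < |f q|} :=
    isOpen_lt continuous_const hf.abs
  have hpos := hopen.measure_pos surf ⟨p, by
    refine lt_of_lt_of_le ?_ (not_lt.1 hp)
    rw [← ENNReal.toReal_ofReal hr.le]
    exact (ENNReal.toReal_lt_toReal h1.ne_top ENNReal.ofReal_ne_top).2 h1⟩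
  refine hpos.ne' (measure_mono_null (fun q hq => ?_)
    (meas_eLpNormEssSup_lt (f := f) (μ := surf)))
  simp only [mem_ofPred_eq] at hq ⊢
  rw [← ENNReal.ofReal_toReal h1.ne_top, ← ofReal_norm, Real.norm_eq_abs]
  exact (ENNReal.ofReal_lt_ofReal_iff (lt_of_le_of_lt ENNReal.toReal_nonneg hq)).2 hq

/-! ### The space of quadratic forms on the sphere -/

lemma sum_sq_S2 (p : S2) : (p : E3) 0 ^ 2 + (p : E3) 1 ^ 2 + (p : E3) 2 ^ 2 = 1 := by
  have h := EuclideanSpace.real_norm_sq_eq (p : E3)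
  rw [norm_coe_S2, Fin.sum_univ_three] at h
  linarith

/-- On the sphere the constant `Y 0` is a multiple of the sum of the squared coordinates; together
with `Y 3` and `Y 5` it recovers each square. -/
lemma coord_mul_coord_mem_W6 (i j : Fin 3) : (fun p : S2 => (p : E3) i * (p : E3) j) ∈ W6 := by
  have hY : ∀ k, Y k ∈ W6 := fun k => Submodule.subset_span ⟨k, rfl⟩
  have h15 : √15 ≠ 0 := by positivity
  have h3 : √3 ≠ 0 := by positivity
  have m01 : (fun p : S2 => (p : E3) 0 * (p : E3) 1) ∈ W6 := hY 1
  have m12 : (fun p : S2 => (p : E3) 1 * (p : E3) 2) ∈ W6 := hY 2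
  have m02 : (fun p : S2 => (p : E3) 0 * (p : E3) 2) ∈ W6 := hY 4
  have m22 : (fun p : S2 => (p : E3) 2 * (p : E3) 2) ∈ W6 := by
    have : (fun p : S2 => (p : E3) 2 * (p : E3) 2) =
        (√15 / 3) • Y 0 + (2 * √3 / 3) • Y 3 := by
      ext p
      have := sum_sq_S2 p
      simp [Y]
      field_simp
      linarith
    rw [this]
    exact W6.add_mem (W6.smul_mem _ (hY 0)) (W6.smul_mem _ (hY 3))
  have m00 : (fun p : S2 => (p : E3) 0 * (p : E3) 0) ∈ W6 := by
    have : (fun p : S2 => (p : E3) 0 * (p : E3) 0) =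
        (√15 / 2) • Y 0 - (1 / 2 : ℝ) • (fun p : S2 => (p : E3) 2 * (p : E3) 2) + Y 5 := by
      ext p
      have := sum_sq_S2 p
      simp [Y]
      field_simp
      linarith
    rw [this]
    exact W6.add_mem (W6.sub_mem (W6.smul_mem _ (hY 0)) (W6.smul_mem _ m22)) (hY 5)
  have m11 : (fun p : S2 => (p : E3) 1 * (p : E3) 1) ∈ W6 := by
    have : (fun p : S2 => (p : E3) 1 * (p : E3) 1) =
        √15 • Y 0 - (fun p : S2 => (p : E3) 2 * (p : E3) 2) -
          (fun p : S2 => (p : E3) 0 * (p : E3) 0) := by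
      ext p
      have := sum_sq_S2 p
      simp [Y]
      field_simp
      linarith
    rw [this]
    exact W6.sub_mem (W6.sub_mem (W6.smul_mem _ (hY 0)) m22) m00
  fin_cases i <;> fin_cases j
  · exact m00
  · exact m01
  · exact m02
  · convert m01 using 2; exact mul_comm _ _
  · exact m11
  · exact m12
  · convert m02 using 2; exact mul_comm _ _
  · convert m12 using 2; exact mul_comm _ _
  · exact m22

lemma sphereQuad_mem_W6 (B : E3 →L[ℝ] E3) : sphereQuad B ∈ W6 := by
  set e := EuclideanSpace.basisFun (Fin 3) ℝ with he
  have : sphereQuad B = ∑ i, ∑ j, (inner ℝ (e i) (B (e j))) •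
      (fun p : S2 => (p : E3) i * (p : E3) j) := by
    ext p
    have hp : (p : E3) = ∑ i, (p : E3) i • e i := (e.sum_repr (p : E3)).symm
    have : sphereQuad B p = inner ℝ (∑ i, (p : E3) i • e i) (B (∑ j, (p : E3) j • e j)) := by
      rw [← hp]; rfl
    rw [this, map_sum, sum_inner]
    simp only [inner_sum, map_smul, inner_smul_left, inner_smul_right, Finset.sum_apply,
      Pi.smul_apply, smul_eq_mul, RCLike.conj_to_real]
    refine Finset.sum_congr rfl fun i _ => Finset.sum_congr rfl fun j _ => ?_
    ring
  rw [this]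
  exact W6.sum_mem fun i _ => W6.sum_mem fun j _ => W6.smul_mem _ (coord_mul_coord_mem_W6 i j)

/-! ### Divergence of fields that are radially piecewise smooth -/

/-- Continuity of `F` across the exceptional radii prevents jump terms. The boundary term at `0` is
kept, since it produces the point mass of the Newtonian kernel. -/
lemma integral_Ioi_mul_deriv_off_countable {F F' χ χ' : ℝ → ℝ} {s : Set ℝ} (hs : s.Countable)
    (hF : ContinuousOn F (Ici 0)) (hF' : ∀ r ∈ Ioi 0 \ s, HasDerivAt F (F' r) r) {b : ℝ}
    (hFi : IntegrableOn F' (Ioc 0 b)) (hb : 0 < b) (hχ : ∀ r, HasDerivAt χ (χ' r) r)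
    (hχ' : Continuous χ') (hχb : ∀ r, b ≤ r → χ r = 0) (hχb' : ∀ r, b ≤ r → χ' r = 0) :
    ∫ r in Ioi 0, F r * χ' r = -(F 0 * χ 0) - ∫ r in Ioi 0, F' r * χ r := by
  have hχc : Continuous χ := continuous_iff_continuousAt.2 fun r => (hχ r).continuousAt
  have hFb : ContinuousOn F (Icc 0 b) := hF.mono Icc_subset_Ici_self
  have h1 : ∫ r in Ioi 0, F r * χ' r = ∫ r in (0)..b, F r * χ' r := by
    rw [intervalIntegral.integral_of_le hb.le]
    refine setIntegral_eq_of_subset_of_forall_sdiff_eq_zero measurableSet_Ioi Ioc_subset_Ioi_self ?_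
    intro r hr
    rw [hχb' r (le_of_not_ge fun h => hr.2 ⟨hr.1, h⟩), mul_zero]
  have h2 : ∫ r in Ioi 0, F' r * χ r = ∫ r in (0)..b, F' r * χ r := by
    rw [intervalIntegral.integral_of_le hb.le]
    refine setIntegral_eq_of_subset_of_forall_sdiff_eq_zero measurableSet_Ioi Ioc_subset_Ioi_self ?_
    intro r hr
    rw [hχb r (le_of_not_ge fun h => hr.2 ⟨hr.1, h⟩), mul_zero]
  have i1 : IntervalIntegrable (fun r => F r * χ' r) volume 0 b := by
    apply ContinuousOn.intervalIntegrable
    rw [uIcc_of_le hb.le]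
    exact hFb.mul hχ'.continuousOn
  have i2 : IntervalIntegrable (fun r => F' r * χ r) volume 0 b := by
    apply IntervalIntegrable.mul_continuousOn _ hχc.continuousOn
    exact (intervalIntegrable_iff_integrableOn_Ioc_of_le hb.le).2 hFi
  have h3 := integral_eq_of_hasDerivAt_off_countable_of_le (fun r => F r * χ r)
    (fun r => F' r * χ r + F r * χ' r) hb.le hs (hFb.mul hχc.continuousOn)
    (fun r hr => (hF' r ⟨hr.1.1, hr.2⟩).mul (hχ r)) (i2.add i1)
  rw [intervalIntegral.integral_add i2 i1, hχb b le_rfl] at h3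
  rw [h1, h2]
  linarith

lemma ae_polar_mem_Ioi : ∀ᵐ q : S2 × ℝ ∂polarMeasure, q.2 ∈ Ioi (0 : ℝ) :=
  Measure.quasiMeasurePreserving_snd.ae (ae_restrict_mem measurableSet_Ioi)

lemma ae_polar_notMem {s : Set ℝ} (hs : s.Countable) :
    ∀ᵐ q : S2 × ℝ ∂polarMeasure, q.2 ∉ s :=
  Measure.quasiMeasurePreserving_snd.ae
    (ae_restrict_of_ae (measure_eq_zero_iff_ae_notMem.1 (hs.measure_zero volume)))

/-- The weight `w` is bounded on the compact set of radii up to `b` and vanishes beyond it, so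
integrability of `u` on a bounded interval suffices. -/
lemma integrable_polar_mul {u : ℝ → ℝ} {b : ℝ} (hu : IntegrableOn u (Ioc 0 b))
    {w : S2 × ℝ → ℝ} (hw : Continuous w) (hwb : ∀ q : S2 × ℝ, b < q.2 → w q = 0) :
    Integrable (fun q : S2 × ℝ => w q * u q.2) polarMeasure := by
  obtain ⟨C, hC⟩ := (isCompact_univ.prod isCompact_Icc :
    IsCompact ((univ : Set S2) ×ˢ Icc 0 b)).exists_bound_of_continuousOn hw.continuousOn
  have h1 : Integrable (fun q : S2 × ℝ => (Ioc 0 b).indicator u q.2) polarMeasure := by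
    apply Integrable.comp_snd
    exact ((integrable_indicator_iff measurableSet_Ioc).2 hu).restrict
  have h2 : Integrable (fun q : S2 × ℝ => w q * (Ioc 0 b).indicator u q.2) polarMeasure := by
    refine h1.bdd_mul (c := max C 0) hw.aestronglyMeasurable ?_
    filter_upwards [ae_polar_mem_Ioi] with q hq
    by_cases h : q.2 ≤ b
    · exact (hC q ⟨mem_univ _, le_of_lt hq, h⟩).trans (le_max_left _ _)
    · rw [hwb q (not_le.1 h), norm_zero]; exact le_max_right _ _
  refine h2.congr ?_
  filter_upwards [ae_polar_mem_Ioi] with q hq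
  by_cases h : q.2 ≤ b
  · rw [indicator_of_mem (show q.2 ∈ Ioc 0 b from ⟨hq, h⟩)]
  · rw [hwb q (not_le.1 h), zero_mul, zero_mul]

lemma exists_radius_of_hasCompactSupport {φ : E3 → ℝ} (hφ : HasCompactSupport φ) :
    ∃ b : ℝ, 0 < b ∧ (∀ x, b ≤ ‖x‖ → φ x = 0) ∧ ∀ x, b ≤ ‖x‖ → fderiv ℝ φ x = 0 := by
  obtain ⟨b, hb, hsub⟩ := hφ.isCompact.isBounded.subset_ball_lt 0 (0 : E3)
  have h0 : ∀ x, b ≤ ‖x‖ → x ∉ tsupport φ := fun x hx h => by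
    have := hsub h
    rw [mem_ball_zero_iff] at this
    linarith
  exact ⟨b, hb, fun x hx => image_eq_zero_of_notMem_tsupport (h0 x hx), fun x hx =>
    image_eq_zero_of_notMem_tsupport fun h => h0 x hx (tsupport_fderiv_subset ℝ h)⟩

/-- Weak divergence of a vector field with radial part `F r / r² * n p` and tangential part
`G r / r * q p • P e`, where `F` is continuous and piecewise smooth. -/
theorem integral_fderiv_radialField {F F' G : ℝ → ℝ} {s : Set ℝ} (hs : s.Countable)
    (hF : ContinuousOn F (Ici 0)) (hF' : ∀ r ∈ Ioi 0 \ s, HasDerivAt F (F' r) r)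
    (hFi : ∀ b, IntegrableOn F' (Ioc 0 b)) (hG : ∀ b, IntegrableOn G (Ioc 0 b))
    {n : S2 → ℝ} (hn : Continuous n) {q : E3 → ℝ} (hq : ContDiff ℝ 1 q) (e : E3)
    {Z : E3 → E3} (hZm : AEStronglyMeasurable Z volume)
    (hZ : ∀ (p : S2) (r : ℝ), 0 < r → Z (r • (p : E3)) =
      (F r / r ^ 2 * n p) • (p : E3) + (G r / r * q p) • tangentProj p e)
    {ζ : E3 → ℝ} (hζm : AEStronglyMeasurable ζ volume)
    (hζ : ∀ (p : S2) (r : ℝ), 0 < r → r ∉ s → r ^ 2 * ζ (r • (p : E3)) =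
      F' r * n p - G r * (2 * (q p * inner ℝ (p : E3) e) - fderiv ℝ q (p : E3) (tangentProj p e)))
    {φ : E3 → ℝ} (hφ : ContDiff ℝ 1 φ) (hφc : HasCompactSupport φ) :
    ∫ x, fderiv ℝ φ x (Z x) = -(F 0 * φ 0 * ∫ p, n p ∂surf) - ∫ x, ζ x * φ x := by
  obtain ⟨b, hb, hb0, hb1⟩ := exists_radius_of_hasCompactSupport hφc
  have cφ := hφ.continuous
  have cφ' := hφ.continuous_fderiv one_ne_zero
  have cq := hq.continuous
  have cq' := hq.continuous_fderiv one_ne_zero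
  have hT := continuous_tangentProj
  have hnorm : ∀ (p : S2) (r : ℝ), b ≤ r → b ≤ ‖r • (p : E3)‖ := fun p r hr => by
    rw [norm_smul, norm_coe_S2, mul_one]; exact hr.trans (Real.le_norm_self r)
  set m : S2 → ℝ := fun p =>
    2 * (q p * inner ℝ (p : E3) e) - fderiv ℝ q (p : E3) (tangentProj p e) with hm
  have cm : Continuous m := by fun_prop
  have hFb : IntegrableOn F (Ioc 0 b) :=
    ((hF.mono Icc_subset_Ici_self).integrableOn_Icc).mono_set Ioc_subset_Icc_self
  have hrG : IntegrableOn (fun r => r * G r) (Ioc 0 b) := by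
    refine Integrable.bdd_mul (c := b) (hG b) (by fun_prop) ?_
    filter_upwards [ae_restrict_mem measurableSet_Ioc] with r hr
    rw [Real.norm_of_nonneg hr.1.le]; exact hr.2
  have i1 : Integrable (fun Q : S2 × ℝ => (n Q.1 * fderiv ℝ φ (Q.2 • (Q.1 : E3)) Q.1) * F Q.2)
      polarMeasure :=
    integrable_polar_mul hFb (by fun_prop) fun Q hQ => by
      rw [hb1 _ (hnorm _ _ hQ.le)]; simp
  have i2 : Integrable (fun Q : S2 × ℝ =>
      (q Q.1 * fderiv ℝ φ (Q.2 • (Q.1 : E3)) (tangentProj Q.1 e)) * (Q.2 * G Q.2))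
      polarMeasure :=
    integrable_polar_mul (u := fun r => r * G r) hrG (by fun_prop) fun Q hQ => by
      rw [hb1 _ (hnorm _ _ hQ.le)]; simp
  have i3 : Integrable (fun Q : S2 × ℝ => (n Q.1 * φ (Q.2 • (Q.1 : E3))) * F' Q.2)
      polarMeasure :=
    integrable_polar_mul (hFi b) (by fun_prop) fun Q hQ => by
      rw [hb0 _ (hnorm _ _ hQ.le)]; simp
  have i4 : Integrable (fun Q : S2 × ℝ => (m Q.1 * φ (Q.2 • (Q.1 : E3))) * G Q.2)
      polarMeasure :=
    integrable_polar_mul (hG b) (by fun_prop) fun Q hQ => by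
      rw [hb0 _ (hnorm _ _ hQ.le)]; simp
  -- The radial part is integrated by parts along each ray.
  have e1 : ∫ Q : S2 × ℝ, (n Q.1 * fderiv ℝ φ (Q.2 • (Q.1 : E3)) Q.1) * F Q.2 ∂polarMeasure =
      -(F 0 * φ 0 * ∫ p, n p ∂surf) -
        ∫ Q : S2 × ℝ, (n Q.1 * φ (Q.2 • (Q.1 : E3))) * F' Q.2 ∂polarMeasure := by
    rw [integral_prod _ i1, integral_prod _ i3]
    have h : ∀ p : S2, ∫ r in Ioi 0, (n p * fderiv ℝ φ (r • (p : E3)) p) * F r =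
        -(F 0 * φ 0) * n p - ∫ r in Ioi 0, (n p * φ (r • (p : E3))) * F' r := by
      intro p
      have h := integral_Ioi_mul_deriv_off_countable (χ := fun r => φ (r • (p : E3)))
        (χ' := fun r => fderiv ℝ φ (r • (p : E3)) p) hs hF hF' (hFi b) hb
        (fun r => by
          have h1 : HasDerivAt (fun r : ℝ => r • (p : E3)) ((1 : ℝ) • (p : E3)) r :=
            (hasDerivAt_id r).smul_const _
          rw [one_smul] at h1
          exact ((hφ.differentiable one_ne_zero _).hasFDerivAt).comp_hasDerivAt r h1)
        (by fun_prop) (fun r hr => hb0 _ (hnorm p r hr))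
        (fun r hr => by rw [hb1 _ (hnorm p r hr)]; simp)
      have e3 : ∀ r, n p * fderiv ℝ φ (r • (p : E3)) p * F r =
        n p * (F r * fderiv ℝ φ (r • (p : E3)) p) := fun r => by ring
      have e4 : ∀ r, n p * φ (r • (p : E3)) * F' r =
        n p * (F' r * φ (r • (p : E3))) := fun r => by ring
      simp only [e3, e4]
      rw [integral_const_mul, integral_const_mul, h, zero_smul]
      ring
    simp only [h]
    rw [integral_sub ((integrable_surf hn).const_mul _) i3.integral_prod_left, integral_const_mul]
    ring
  -- The tangential part is integrated by parts on each sphere of fixed radius.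
  have e2 : ∫ Q : S2 × ℝ, (q Q.1 * fderiv ℝ φ (Q.2 • (Q.1 : E3)) (tangentProj Q.1 e)) *
      (Q.2 * G Q.2) ∂polarMeasure =
        ∫ Q : S2 × ℝ, (m Q.1 * φ (Q.2 • (Q.1 : E3))) * G Q.2 ∂polarMeasure := by
    rw [integral_prod_symm _ i2, integral_prod_symm _ i4]
    congr 1; ext r
    have k := integral_mul_fderiv_tangentProj hq hφ r e
    have k' : ∀ p : S2, φ (r • (p : E3)) * (2 * (q p * inner ℝ (p : E3) e) -
        fderiv ℝ q (p : E3) (tangentProj p e)) = m p * φ (r • (p : E3)) := fun p => by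
      rw [hm]; ring
    simp only [k'] at k
    calc ∫ p : S2, q p * fderiv ℝ φ (r • (p : E3)) (tangentProj p e) * (r * G r) ∂surf
        = (∫ p : S2, q p * fderiv ℝ φ (r • (p : E3)) (tangentProj p e) ∂surf) * (r * G r) :=
          integral_mul_const _ _
      _ = (r * ∫ p : S2, q p * fderiv ℝ φ (r • (p : E3)) (tangentProj p e) ∂surf) * G r := by
          ring
      _ = (∫ p : S2, m p * φ (r • (p : E3)) ∂surf) * G r := by rw [k]
      _ = ∫ p : S2, m p * φ (r • (p : E3)) * G r ∂surf := (integral_mul_const _ _).symm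
  have hfm : AEStronglyMeasurable (fun x => fderiv ℝ φ x (Z x)) volume :=
    (isBoundedBilinearMap_apply.continuous.comp_aestronglyMeasurable
      (cφ'.aestronglyMeasurable.prodMk hZm))
  rw [integral_polar hfm, integral_polar (f := fun x => ζ x * φ x) (hζm.mul cφ.aestronglyMeasurable)]
  have c1 : (fun Q : S2 × ℝ => Q.2 ^ 2 • fderiv ℝ φ (Q.2 • (Q.1 : E3)) (Z (Q.2 • (Q.1 : E3))))
      =ᵐ[polarMeasure] fun Q => (n Q.1 * fderiv ℝ φ (Q.2 • (Q.1 : E3)) Q.1) * F Q.2 +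
        (q Q.1 * fderiv ℝ φ (Q.2 • (Q.1 : E3)) (tangentProj Q.1 e)) * (Q.2 * G Q.2) := by
    filter_upwards [ae_polar_mem_Ioi] with Q hQ
    have hQ' : Q.2 ≠ 0 := ne_of_gt hQ
    rw [hZ _ _ hQ, map_add, map_smul, map_smul]
    simp only [smul_eq_mul]
    field_simp
  have c2 : (fun Q : S2 × ℝ => Q.2 ^ 2 • (ζ (Q.2 • (Q.1 : E3)) * φ (Q.2 • (Q.1 : E3))))
      =ᵐ[polarMeasure] fun Q => (n Q.1 * φ (Q.2 • (Q.1 : E3))) * F' Q.2 -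
        (m Q.1 * φ (Q.2 • (Q.1 : E3))) * G Q.2 := by
    filter_upwards [ae_polar_mem_Ioi, ae_polar_notMem hs] with Q hQ hQs
    rw [smul_eq_mul, ← mul_assoc, hζ _ _ hQ hQs, hm]
    ring
  rw [integral_congr_ae c1]
  refine Eq.trans ?_ (congrArg _ (integral_congr_ae c2).symm)
  rw [integral_add i1 i2, integral_sub i3 i4, e1, e2]
  ring

/-! ### The Newtonian kernel -/

/-- The kernel `x / |x|³`. -/
def dipole (x : E3) : E3 := (‖x‖ ^ 3)⁻¹ • x

lemma measurable_dipole : Measurable dipole := by unfold dipole; fun_prop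

lemma norm_dipole (x : E3) : ‖dipole x‖ = (‖x‖ ^ 2)⁻¹ := by
  rw [dipole, norm_smul, Real.norm_of_nonneg (by positivity)]
  by_cases hx : ‖x‖ = 0
  · simp [hx]
  · field_simp

/-- The Jacobian `r²` absorbs the singularity as long as `k ≤ 2`. -/
lemma integrableOn_ball_inv_norm_pow {k : ℕ} (hk : k ≤ 2) (R : ℝ) :
    IntegrableOn (fun x : E3 => (‖x‖ ^ k)⁻¹) (Metric.ball 0 R) := by
  have := (integrableOn_fun_norm_addHaar (volume : Measure E3) (f := fun r => (r ^ k)⁻¹)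
    (r := R)).2
  apply this
  simp only [finrank_euclideanSpace, Fintype.card_fin, smul_eq_mul, Nat.add_one_sub_one]
  have h1 : IntegrableOn (fun r : ℝ => r ^ (2 - k)) (Ioo 0 R) :=
    ((continuous_pow (2 - k)).continuousOn.integrableOn_Icc).mono_set Ioo_subset_Icc_self
  refine h1.congr_fun (fun r hr => ?_) measurableSet_Ioo
  have : r ≠ 0 := ne_of_gt hr.1
  simp only []
  rw [eq_mul_inv_iff_mul_eq₀ (by positivity), ← pow_add, Nat.sub_add_cancel hk]

lemma locallyIntegrable_of_integrableOn_ball {F : Type*} [NormedAddCommGroup F] {f : E3 → F}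
    (hf : ∀ R, IntegrableOn f (Metric.ball 0 R)) : LocallyIntegrable f := by
  intro x
  refine ⟨Metric.ball 0 (‖x‖ + 1), Metric.isOpen_ball.mem_nhds ?_, hf _⟩
  rw [mem_ball_zero_iff]; linarith

lemma locallyIntegrable_inv_norm : LocallyIntegrable (fun x : E3 => ‖x‖⁻¹) :=
  locallyIntegrable_of_integrableOn_ball fun R => by
    simpa using integrableOn_ball_inv_norm_pow (k := 1) (by norm_num) R

lemma locallyIntegrable_dipole : LocallyIntegrable dipole :=
  locallyIntegrable_of_integrableOn_ball fun R =>
    (integrableOn_ball_inv_norm_pow (k := 2) le_rfl R).mono'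
      measurable_dipole.aestronglyMeasurable (ae_of_all _ fun x => (norm_dipole x).le)

lemma inner_decomp_tangentProj (p : S2) (v : E3) :
    v = inner ℝ (p : E3) v • (p : E3) + tangentProj p v := by
  rw [tangentProj_apply]; abel

lemma norm_smul_S2 (p : S2) {r : ℝ} (hr : 0 ≤ r) : ‖r • (p : E3)‖ = r := by
  rw [norm_smul, norm_coe_S2, Real.norm_of_nonneg hr, mul_one]

/-- The field `|x|⁻¹ v` has radial profile `F r = r`, which vanishes at `0`; so the origin
contributes nothing and the distributional derivative is the pointwise one. -/
lemma integral_inv_norm_mul_fderiv {φ : E3 → ℝ} (hφ : ContDiff ℝ 1 φ)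
    (hφc : HasCompactSupport φ) (v : E3) :
    ∫ x, ‖x‖⁻¹ * fderiv ℝ φ x v = ∫ x, inner ℝ (dipole x) v * φ x := by
  have h := integral_fderiv_radialField (F := fun r => r) (F' := fun _ => 1) (G := fun _ => 1)
    (s := ∅) countable_empty continuousOn_id (fun r _ => hasDerivAt_id r)
    (fun b => by simp [integrableOn_const_iff]) (fun b => by simp [integrableOn_const_iff])
    (n := fun p => inner ℝ (p : E3) v) (by fun_prop) (q := fun _ => 1) contDiff_const v
    (Z := fun x => ‖x‖⁻¹ • v) (by fun_prop)
    (fun p r hr => by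
      rw [norm_smul_S2 p hr.le]
      conv_lhs => rw [inner_decomp_tangentProj p v]
      rw [smul_add, smul_smul]
      congr 2 <;> field_simp)
    (ζ := fun x => -inner ℝ (dipole x) v) (by
      have := measurable_dipole; fun_prop)
    (fun p r hr _ => by
      simp only [dipole, norm_smul_S2 p hr.le, inner_smul_left, RCLike.conj_to_real,
        fderiv_fun_const]
      simp; field_simp; ring) hφ hφc
  simp only [map_smul, smul_eq_mul, zero_mul, neg_zero, zero_sub, neg_mul, integral_neg,
    neg_neg] at h
  exact h

/-- The flux of `x / |x|³` through every sphere about the origin is the same. The constant profile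
`F = 1` leaves only the boundary term at `0`, a point mass. -/
lemma integral_fderiv_dipole {φ : E3 → ℝ} (hφ : ContDiff ℝ 1 φ) (hφc : HasCompactSupport φ) :
    ∫ x, fderiv ℝ φ x (dipole x) = -(sphereArea * φ 0) := by
  have h := integral_fderiv_radialField (F := fun _ => 1) (F' := fun _ => 0) (G := fun _ => 0)
    (s := ∅) countable_empty continuousOn_const (fun r _ => hasDerivAt_const r _)
    (fun b => by simp) (fun b => by simp)
    (n := fun _ => 1) (by fun_prop) (q := fun _ => 1) contDiff_const 0
    (Z := dipole) measurable_dipole.aestronglyMeasurable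
    (fun p r hr => by
      rw [dipole, norm_smul_S2 p hr.le, smul_smul]
      simp; congr 1; field_simp)
    (ζ := fun x => 0) (by fun_prop)
    (fun p r hr _ => by simp) hφ hφc
  rw [h]
  simp [sphereArea, mul_comm]

/-! ### Newtonian potentials of test functions -/

/-- Smooth functions with compact support. -/
structure IsTest (φ : E3 → ℝ) : Prop where
  contDiff : ContDiff ℝ ∞ φ
  hasCompactSupport : HasCompactSupport φ

lemma contDiff_one_of_top {f : E3 → ℝ} (hf : ContDiff ℝ ∞ f) : ContDiff ℝ 1 f :=
  hf.of_le (by exact_mod_cast le_top)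

lemma contDiff_fderiv_apply {f : E3 → ℝ} (hf : ContDiff ℝ ∞ f) (v : E3) :
    ContDiff ℝ ∞ fun x => fderiv ℝ f x v :=
  (hf.fderiv_right (m := ∞) (by exact_mod_cast le_top)).clm_apply contDiff_const

lemma IsTest.contDiff_one {φ : E3 → ℝ} (h : IsTest φ) : ContDiff ℝ 1 φ := contDiff_one_of_top h.1

lemma IsTest.continuous {φ : E3 → ℝ} (h : IsTest φ) : Continuous φ := h.1.continuous

lemma IsTest.fderiv_apply {φ : E3 → ℝ} (h : IsTest φ) (v : E3) :
    IsTest fun x => fderiv ℝ φ x v :=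
  ⟨contDiff_fderiv_apply h.1 v, h.2.fderiv_apply (𝕜 := ℝ) v⟩

lemma IsTest.mul_right {φ ψ : E3 → ℝ} (h : IsTest φ) (hψ : ContDiff ℝ ∞ ψ) :
    IsTest fun x => φ x * ψ x :=
  ⟨h.1.mul hψ, h.2.mul_right⟩

lemma IsTest.comp_const_sub {φ : E3 → ℝ} (h : IsTest φ) (x : E3) : IsTest fun t => φ (x - t) :=
  ⟨h.1.comp (contDiff_const.sub contDiff_id), h.2.comp_homeomorph (Homeomorph.subLeft x)⟩

lemma IsTest.exists_bound {φ : E3 → ℝ} (h : IsTest φ) : ∃ C, ∀ x, |φ x| ≤ C :=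
  h.2.exists_bound_of_continuous h.continuous

lemma IsTest.integrable {φ : E3 → ℝ} (h : IsTest φ) : Integrable φ :=
  h.continuous.integrable_of_hasCompactSupport h.2

/-- The standard orthonormal basis of `ℝ³`. -/
abbrev stdB : OrthonormalBasis (Fin 3) ℝ E3 := EuclideanSpace.basisFun (Fin 3) ℝ

/-- The Laplacian. -/
def lap (f : E3 → ℝ) (x : E3) : ℝ :=
  ∑ i, fderiv ℝ (fun y => fderiv ℝ f y (stdB i)) x (stdB i)

/-- The Newtonian potential, up to normalization. -/
def pot (g : E3 → ℝ) (x : E3) : ℝ := ∫ t, ‖t‖⁻¹ * g (x - t)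

lemma pot_eq_convolution (g : E3 → ℝ) :
    pot g = MeasureTheory.convolution (fun t : E3 => ‖t‖⁻¹) g (ContinuousLinearMap.mul ℝ ℝ)
      volume := rfl

lemma contDiff_pot {g : E3 → ℝ} (hg : IsTest g) : ContDiff ℝ ∞ (pot g) := by
  rw [pot_eq_convolution]
  exact hg.2.contDiff_convolution_right (n := ⊤) _ locallyIntegrable_inv_norm hg.1

lemma fderiv_pot_apply {g : E3 → ℝ} (hg : IsTest g) (x v : E3) :
    fderiv ℝ (pot g) x v = pot (fun y => fderiv ℝ g y v) x := by
  have h := hg.2.hasFDerivAt_convolution_right (ContinuousLinearMap.mul ℝ ℝ)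
    locallyIntegrable_inv_norm hg.contDiff_one x
  rw [pot_eq_convolution, h.fderiv]
  exact convolution_precompR_apply _ locallyIntegrable_inv_norm (hg.2.fderiv (𝕜 := ℝ))
    (hg.contDiff_one.continuous_fderiv one_ne_zero) x v

lemma fderiv_comp_const_sub {g : E3 → ℝ} (hg : ContDiff ℝ 1 g) (x t v : E3) :
    fderiv ℝ (fun t => g (x - t)) t v = -fderiv ℝ g (x - t) v := by
  have h : HasFDerivAt (fun t => g (x - t)) _ t := HasFDerivAt.comp (g := g) t
    ((hg.differentiable one_ne_zero (x - t)).hasFDerivAt) ((hasFDerivAt_id t).const_sub x)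
  rw [h.fderiv]; simp

/-- The derivative is moved from the density to the kernel. -/
lemma fderiv_pot_eq_dipole {g : E3 → ℝ} (hg : IsTest g) (x v : E3) :
    fderiv ℝ (pot g) x v = -∫ t, inner ℝ (dipole t) v * g (x - t) := by
  have ht := hg.comp_const_sub x
  rw [fderiv_pot_apply hg, ← integral_inv_norm_mul_fderiv ht.contDiff_one ht.2 v, ← integral_neg]
  simp only [pot, fderiv_comp_const_sub hg.contDiff_one, mul_neg, neg_neg]

/-- One derivative is moved onto the kernel, giving the dipole field, and the other stays on `g`;
the point-mass divergence of the dipole field then evaluates the integral. -/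
lemma lap_pot {g : E3 → ℝ} (hg : IsTest g) (x : E3) : lap (pot g) x = -(sphereArea * g x) := by
  have ht := hg.comp_const_sub x
  have h := integral_fderiv_dipole ht.contDiff_one ht.2
  simp only [sub_zero] at h
  rw [← h, lap]
  have e1 : ∀ i, (fun y => fderiv ℝ (pot g) y (stdB i)) =
      pot (fun y => fderiv ℝ g y (stdB i)) := fun i => by
    ext y; rw [fderiv_pot_apply hg]
  simp only [e1, fderiv_pot_eq_dipole (hg.fderiv_apply _), Finset.sum_neg_distrib]
  rw [← integral_finsetSum, ← integral_neg]
  · congr 1; ext t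
    rw [fderiv_comp_const_sub hg.contDiff_one, ← stdB.sum_repr' (dipole t), map_sum]
    simp only [map_smul, smul_eq_mul]
    rw [stdB.sum_repr' (dipole t)]
    simp only [real_inner_comm]
  · intro i _
    have h1 : LocallyIntegrable (fun t : E3 => inner ℝ (dipole t) (stdB i)) := by
      intro y
      exact (locallyIntegrable_dipole y).imp fun s hs =>
        ⟨hs.1, Integrable.inner_const hs.2 _⟩
    have h2 := (hg.fderiv_apply (stdB i)).comp_const_sub x
    have := h1.integrable_smul_left_of_hasCompactSupport h2.continuous h2.2
    simpa only [smul_eq_mul, mul_comm] using this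

/-- For `‖x‖ ≥ 2 b`, with `b` a radius beyond which `g` vanishes, the integrand lives where `‖t‖ ≥
‖x‖ / 2`; this gives the factor `2 ^ k`. -/
lemma exists_kernel_bound {K : E3 → ℝ} {k : ℕ} (hK : ∀ t, |K t| ≤ (‖t‖ ^ k)⁻¹) {g : E3 → ℝ}
    (hg : IsTest g) : ∃ C R : ℝ, 0 < R ∧ ∀ x, R ≤ ‖x‖ → |∫ t, K t * g (x - t)| ≤ C / ‖x‖ ^ k := by
  obtain ⟨b, hb, hb0, -⟩ := exists_radius_of_hasCompactSupport hg.2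
  refine ⟨2 ^ k * ∫ t, |g t|, 2 * b, by positivity, fun x hx => ?_⟩
  have hx0 : 0 < ‖x‖ := by linarith
  have hgi : Integrable fun t => |g (x - t)| := (hg.comp_const_sub x).integrable.abs
  calc |∫ t, K t * g (x - t)| ≤ ∫ t, 2 ^ k / ‖x‖ ^ k * |g (x - t)| := by
        rw [← Real.norm_eq_abs]
        refine norm_integral_le_of_norm_le (hgi.const_mul _) (ae_of_all _ fun t => ?_)
        rw [norm_mul, Real.norm_eq_abs, Real.norm_eq_abs]
        by_cases h : b ≤ ‖x - t‖
        · simp [hb0 _ h]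
        · gcongr
          refine (hK t).trans ?_
          have h1 : ‖x‖ / 2 ≤ ‖t‖ := by
            have := norm_sub_norm_le x t
            linarith [not_le.1 h]
          have ht0 : 0 < ‖t‖ := by linarith
          rw [← div_pow, inv_le_comm₀ (by positivity) (by positivity), ← inv_pow, inv_div]
          gcongr
    _ = 2 ^ k * (∫ t, |g t|) / ‖x‖ ^ k := by
        rw [integral_const_mul, integral_sub_left_eq_self (fun t => |g t|)]
        ring

lemma exists_decay_of_bound {u : E3 → ℝ} (hu : Continuous u) {k : ℕ} {C R : ℝ} (hR : 0 < R)
    (h : ∀ x, R ≤ ‖x‖ → |u x| ≤ C / ‖x‖ ^ k) : ∃ M, 0 ≤ M ∧ ∀ x, |u x| ≤ M / (1 + ‖x‖) ^ k := by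
  obtain ⟨A, hA⟩ := (isCompact_closedBall (0 : E3) (max R 1)).exists_bound_of_continuousOn
    hu.continuousOn
  refine ⟨max A 0 * (1 + max R 1) ^ k + max C 0 * 2 ^ k, by positivity, fun x => ?_⟩
  have hx := norm_nonneg x
  rw [add_div]
  by_cases hx1 : ‖x‖ ≤ max R 1
  · have h1 := hA x (mem_closedBall_zero_iff.2 hx1)
    rw [Real.norm_eq_abs] at h1
    have : max A 0 ≤ max A 0 * (1 + max R 1) ^ k / (1 + ‖x‖) ^ k := by
      rw [le_div_iff₀ (by positivity)]
      gcongr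
    have h3 : 0 ≤ max C 0 * 2 ^ k / (1 + ‖x‖) ^ k := by positivity
    linarith [le_max_left A 0]
  · have hx2 := not_le.1 hx1
    have h1 := h x ((le_max_left _ _).trans hx2.le)
    have hx3 : 1 < ‖x‖ := (le_max_right _ _).trans_lt hx2
    have h2 : C / ‖x‖ ^ k ≤ max C 0 * 2 ^ k / (1 + ‖x‖) ^ k := by
      rw [div_le_div_iff₀ (by positivity) (by positivity), mul_assoc, ← mul_pow]
      calc C * (1 + ‖x‖) ^ k ≤ max C 0 * (1 + ‖x‖) ^ k := by gcongr; exact le_max_left _ _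
        _ ≤ max C 0 * (2 * ‖x‖) ^ k := by gcongr; linarith
    have h3 : 0 ≤ max A 0 * (1 + max R 1) ^ k / (1 + ‖x‖) ^ k := by positivity
    linarith

lemma exists_decay_pot {g : E3 → ℝ} (hg : IsTest g) :
    ∃ M, 0 ≤ M ∧ ∀ x, |pot g x| ≤ M / (1 + ‖x‖) := by
  obtain ⟨C, R, hR, h⟩ := exists_kernel_bound (K := fun t => ‖t‖⁻¹) (k := 1)
    (fun t => by simp) hg
  simpa using exists_decay_of_bound (contDiff_pot hg).continuous hR h

lemma norm_le_sum_inner (L : E3 →L[ℝ] ℝ) : ‖L‖ ≤ ∑ i, |L (stdB i)| := by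
  refine L.opNorm_le_bound (Finset.sum_nonneg fun _ _ => abs_nonneg _) fun v => ?_
  conv_lhs => rw [← stdB.sum_repr' v, map_sum]
  refine (norm_sum_le _ _).trans ?_
  rw [Finset.sum_mul]
  refine Finset.sum_le_sum fun i _ => ?_
  rw [map_smul, norm_smul, mul_comm, Real.norm_eq_abs]
  gcongr
  refine (norm_inner_le_norm _ _).trans ?_
  rw [stdB.norm_eq_one, one_mul]

lemma exists_decay_fderiv_pot {g : E3 → ℝ} (hg : IsTest g) :
    ∃ M, 0 ≤ M ∧ ∀ x, ‖fderiv ℝ (pot g) x‖ ≤ M / (1 + ‖x‖) ^ 2 := by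
  have h1 : ∀ i : Fin 3, ∃ M, 0 ≤ M ∧ ∀ x, |fderiv ℝ (pot g) x (stdB i)| ≤ M / (1 + ‖x‖) ^ 2 := by
    intro i
    obtain ⟨C, R, hR, h⟩ := exists_kernel_bound (K := fun t => inner ℝ (dipole t) (stdB i)) (k := 2)
      (fun t => (abs_real_inner_le_norm _ _).trans (by
        rw [stdB.norm_eq_one, mul_one, norm_dipole])) hg
    refine exists_decay_of_bound (contDiff_fderiv_apply (contDiff_pot hg) _).continuous (C := C) hR
      fun x hx => ?_
    rw [fderiv_pot_eq_dipole hg, abs_neg]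
    exact h x hx
  choose M hM0 hM using h1
  refine ⟨∑ i, M i, Finset.sum_nonneg fun i _ => hM0 i, fun x => (norm_le_sum_inner _).trans ?_⟩
  rw [Finset.sum_div]
  exact Finset.sum_le_sum fun i _ => hM i x

/-- Green's identity for the potential. -/
lemma integral_inner_gradient_pot {g η : E3 → ℝ} (hg : IsTest g) (hη : IsTest η) :
    ∫ x, inner ℝ (gradient (pot g) x) (gradient η x) = sphereArea * ∫ x, g x * η x := by
  have e1 : ∀ x, inner ℝ (gradient (pot g) x) (gradient η x) =
      ∑ i, fderiv ℝ (pot g) x (stdB i) * fderiv ℝ η x (stdB i) := fun x => by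
    rw [← stdB.sum_inner_mul_inner]
    refine Finset.sum_congr rfl fun i _ => ?_
    rw [inner_gradient, real_inner_comm, inner_gradient]
  have hp := contDiff_pot hg
  have i1 : ∀ i : Fin 3, IsTest fun x => fderiv ℝ η x (stdB i) * fderiv ℝ (pot g) x (stdB i) :=
    fun i => (hη.fderiv_apply _).mul_right (contDiff_fderiv_apply hp _)
  have i2 : ∀ i : Fin 3, IsTest fun x => η x * fderiv ℝ (fun y => fderiv ℝ (pot g) y (stdB i)) x
      (stdB i) :=
    fun i => hη.mul_right (contDiff_fderiv_apply (contDiff_fderiv_apply hp _) _)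
  have i3 : ∀ i : Fin 3, IsTest fun x => η x * fderiv ℝ (pot g) x (stdB i) :=
    fun i => hη.mul_right (contDiff_fderiv_apply hp _)
  simp only [e1]
  rw [integral_finsetSum _ fun i _ => by
    simpa only [mul_comm] using (i1 i).integrable]
  have e2 : ∀ i : Fin 3, ∫ x, fderiv ℝ (pot g) x (stdB i) * fderiv ℝ η x (stdB i) =
      -∫ x, fderiv ℝ (fun y => fderiv ℝ (pot g) y (stdB i)) x (stdB i) * η x := fun i =>
    integral_mul_fderiv_eq_neg_fderiv_mul_of_integrable
      (by simpa only [mul_comm] using (i2 i).integrable)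
      (by simpa only [mul_comm] using (i1 i).integrable)
      (by simpa only [mul_comm] using (i3 i).integrable)
      (fun x _ => (contDiff_one_of_top (contDiff_fderiv_apply hp _)).differentiable one_ne_zero x)
      (fun x _ => hη.contDiff_one.differentiable one_ne_zero x)
  simp only [e2, Finset.sum_neg_distrib]
  rw [← integral_finsetSum _ fun i _ => by simpa only [mul_comm] using (i2 i).integrable,
    ← integral_neg, ← integral_const_mul]
  congr 1; ext x
  rw [← Finset.sum_mul]
  change -(lap (pot g) x * η x) = _
  rw [lap_pot hg]; ring

/-! ### Cutoff functions -/

lemma fderiv_comp_smul_apply {f : E3 → ℝ} (hf : ContDiff ℝ 1 f) (c : ℝ) (x v : E3) :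
    fderiv ℝ (fun y => f (c • y)) x v = c * fderiv ℝ f (c • x) v := by
  have h : HasFDerivAt (fun y => f (c • y)) _ x := HasFDerivAt.comp (g := f) x
    ((hf.differentiable one_ne_zero (c • x)).hasFDerivAt) ((hasFDerivAt_id x).const_smul c)
  rw [h.fderiv]; simp

lemma IsTest.comp_smul {φ : E3 → ℝ} (h : IsTest φ) {c : ℝ} (hc : c ≠ 0) :
    IsTest fun x => φ (c • x) :=
  ⟨h.1.comp (contDiff_id.const_smul c), h.2.comp_homeomorph (Homeomorph.smulOfNeZero c hc)⟩

/-- A smooth cutoff of the unit ball. -/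
def ballBump : ContDiffBump (0 : E3) := ⟨1, 2, by norm_num, by norm_num⟩

lemma isTest_ballBump : IsTest ballBump := ⟨ballBump.contDiff, ballBump.hasCompactSupport⟩

/-- A cutoff of the ball of radius `n + 1`. -/
def cutoff (n : ℕ) (x : E3) : ℝ := ballBump (((n : ℝ) + 1)⁻¹ • x)

lemma isTest_cutoff (n : ℕ) : IsTest (cutoff n) :=
  isTest_ballBump.comp_smul (by positivity)

lemma abs_cutoff_le (n : ℕ) (x : E3) : |cutoff n x| ≤ 1 := by
  unfold cutoff
  rw [abs_of_nonneg ballBump.nonneg]; exact ballBump.le_one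

lemma cutoff_eq_one {n : ℕ} {x : E3} (hx : ‖x‖ ≤ n + 1) : cutoff n x = 1 := by
  apply ballBump.one_of_mem_closedBall
  rw [mem_closedBall_zero_iff, norm_smul, Real.norm_of_nonneg (by positivity)]
  change _ ≤ (1 : ℝ)
  rwa [inv_mul_le_iff₀ (by positivity), mul_one]

lemma eventually_cutoff_eq_one (x : E3) : ∀ᶠ n : ℕ in atTop, cutoff n =ᶠ[𝓝 x] fun _ => 1 := by
  obtain ⟨N, hN⟩ := exists_nat_gt ‖x‖
  filter_upwards [eventually_ge_atTop N] with n hn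
  have h1 : ‖x‖ < n + 1 := by
    have : (N : ℝ) ≤ n := by exact_mod_cast hn
    linarith
  filter_upwards [continuous_norm.continuousAt.eventually (gt_mem_nhds h1)] with y hy
  exact cutoff_eq_one (le_of_lt hy)

/-- Where the rescaled function does not vanish, `‖x‖ ≤ 2 (n + 1)`, so `1 + ‖x‖ ≤ 3 (n + 1)` and the
scaling factor is at most `(3 / (1 + ‖x‖)) ^ k`. The bound is uniform in `n`, as dominated
convergence requires. -/
lemma scaled_bound {f : E3 → ℝ} {M : ℝ} (hM : ∀ x, |f x| ≤ M) (hf : ∀ x, 2 < ‖x‖ → f x = 0)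
    (k n : ℕ) (x : E3) :
    |(((n : ℝ) + 1)⁻¹) ^ k * f (((n : ℝ) + 1)⁻¹ • x)| ≤ 3 ^ k * M / (1 + ‖x‖) ^ k := by
  have hM0 : 0 ≤ M := (abs_nonneg _).trans (hM 0)
  have hn : (0 : ℝ) ≤ n := n.cast_nonneg
  rw [abs_mul, abs_of_nonneg (by positivity)]
  by_cases h : ‖x‖ ≤ 2 * (n + 1)
  · have h1 : 1 + ‖x‖ ≤ 3 * (n + 1) := by linarith
    calc (((n : ℝ) + 1)⁻¹) ^ k * |f (((n : ℝ) + 1)⁻¹ • x)| ≤ (((n : ℝ) + 1)⁻¹) ^ k * M := by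
          gcongr; exact hM _
      _ ≤ (3 / (1 + ‖x‖)) ^ k * M := by
          gcongr
          rw [inv_le_comm₀ (by positivity) (by positivity), inv_div,
            div_le_iff₀ (by positivity)]
          linarith
      _ = _ := by rw [div_pow]; ring
  · rw [hf]
    · simp; positivity
    · rw [norm_smul, Real.norm_of_nonneg (by positivity), inv_mul_eq_div,
        lt_div_iff₀ (by positivity)]
      exact not_le.1 h

lemma ballBump_eq_zero {x : E3} (hx : 2 < ‖x‖) : ballBump x = 0 := by
  apply ballBump.zero_of_le_dist
  rw [dist_zero_right]; exact hx.le

lemma eventuallyEq_zero_of_norm_gt {f : E3 → ℝ} (hf : ∀ x, 2 < ‖x‖ → f x = 0) {x : E3}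
    (hx : 2 < ‖x‖) : f =ᶠ[𝓝 x] fun _ => 0 := by
  filter_upwards [continuous_norm.continuousAt.eventually (lt_mem_nhds hx)] with y hy
  exact hf y hy

lemma fderiv_apply_eq_zero_of_norm_gt {f : E3 → ℝ} (hf : ∀ x, 2 < ‖x‖ → f x = 0) (v : E3) :
    ∀ x, 2 < ‖x‖ → fderiv ℝ f x v = 0 := fun x hx => by
  rw [(eventuallyEq_zero_of_norm_gt hf hx).fderiv_eq]; simp

lemma exists_bound_fderiv_cutoff :
    ∃ M, 0 ≤ M ∧ ∀ n x, ‖fderiv ℝ (cutoff n) x‖ ≤ M / (1 + ‖x‖) := by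
  have h1 : ∀ i : Fin 3, ∃ M, ∀ x, |fderiv ℝ ballBump x (stdB i)| ≤ M := fun i =>
    (isTest_ballBump.fderiv_apply _).exists_bound
  choose M hM using h1
  refine ⟨∑ i, 3 ^ 1 * M i, Finset.sum_nonneg fun i _ => ?_, fun n x => ?_⟩
  · have := (abs_nonneg _).trans (hM i 0); positivity
  · refine (norm_le_sum_inner _).trans ?_
    rw [Finset.sum_div]
    refine Finset.sum_le_sum fun i _ => ?_
    have := scaled_bound (hM i)
      (fderiv_apply_eq_zero_of_norm_gt (fun x hx => ballBump_eq_zero hx) _) 1 n x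
    rw [pow_one, pow_one (1 + ‖x‖), ← fderiv_comp_smul_apply isTest_ballBump.contDiff_one] at this
    exact this

lemma lap_cutoff (n : ℕ) (x : E3) :
    lap (cutoff n) x = (((n : ℝ) + 1)⁻¹) ^ 2 * lap ballBump (((n : ℝ) + 1)⁻¹ • x) := by
  rw [lap, lap, Finset.mul_sum]
  refine Finset.sum_congr rfl fun i _ => ?_
  have h1 : (fun y => fderiv ℝ (cutoff n) y (stdB i)) = fun y =>
      ((n : ℝ) + 1)⁻¹ * fderiv ℝ ballBump (((n : ℝ) + 1)⁻¹ • y) (stdB i) := by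
    ext y; exact fderiv_comp_smul_apply isTest_ballBump.contDiff_one _ _ _
  have h2 := isTest_ballBump.fderiv_apply (stdB i)
  rw [h1, fderiv_const_mul]
  · rw [smul_apply, fderiv_comp_smul_apply h2.contDiff_one, smul_eq_mul]
    ring
  · have hc : (((n : ℝ) + 1)⁻¹) ≠ 0 := by positivity
    exact (h2.comp_smul hc).contDiff_one.differentiable one_ne_zero x

lemma exists_bound_lap_cutoff :
    ∃ M, 0 ≤ M ∧ ∀ n x, |lap (cutoff n) x| ≤ M / (1 + ‖x‖) ^ 2 := by
  have h1 : ∀ i : Fin 3, ∃ M, ∀ x,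
      |fderiv ℝ (fun y => fderiv ℝ ballBump y (stdB i)) x (stdB i)| ≤ M := fun i =>
    ((isTest_ballBump.fderiv_apply _).fderiv_apply _).exists_bound
  choose M hM using h1
  have hM' : ∀ x, |lap ballBump x| ≤ ∑ i, M i := fun x =>
    (Finset.abs_sum_le_sum_abs _ _).trans (Finset.sum_le_sum fun i _ => hM i x)
  refine ⟨3 ^ 2 * ∑ i, M i, ?_, fun n x => ?_⟩
  · have := (abs_nonneg _).trans (hM' 0); positivity
  · rw [lap_cutoff]
    refine scaled_bound hM' (fun y hy => ?_) 2 n x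
    exact Finset.sum_eq_zero fun i _ => fderiv_apply_eq_zero_of_norm_gt
      (fderiv_apply_eq_zero_of_norm_gt (fun x hx => ballBump_eq_zero hx) _) _ y hy

lemma fderiv_mul_apply {f g : E3 → ℝ} (hf : ContDiff ℝ 1 f) (hg : ContDiff ℝ 1 g) (x v : E3) :
    fderiv ℝ (fun y => f y * g y) x v = f x * fderiv ℝ g x v + fderiv ℝ f x v * g x := by
  rw [fderiv_fun_mul (hf.differentiable one_ne_zero x) (hg.differentiable one_ne_zero x)]
  simp [mul_comm]

lemma lap_mul {f g : E3 → ℝ} (hf : ContDiff ℝ ∞ f) (hg : ContDiff ℝ ∞ g) (x : E3) :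
    lap (fun y => f y * g y) x = f x * lap g x +
      2 * ∑ i, fderiv ℝ f x (stdB i) * fderiv ℝ g x (stdB i) + lap f x * g x := by
  simp only [lap, Finset.mul_sum, Finset.sum_mul, ← Finset.sum_add_distrib]
  refine Finset.sum_congr rfl fun i _ => ?_
  have hf1 := contDiff_one_of_top hf
  have hg1 := contDiff_one_of_top hg
  have hf2 := contDiff_one_of_top (contDiff_fderiv_apply hf (stdB i))
  have hg2 := contDiff_one_of_top (contDiff_fderiv_apply hg (stdB i))
  simp only [fderiv_mul_apply hf1 hg1]
  rw [fderiv_fun_add ((hf1.mul hg2).differentiable one_ne_zero x)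
    ((hf2.mul hg1).differentiable one_ne_zero x), add_apply, fderiv_mul_apply hf1 hg2,
    fderiv_mul_apply hf2 hg1]
  ring

/-! ### The space of gradient fields -/

/-- Square integrable vector fields on `ℝ³`. -/
abbrev L2 : Type := Lp E3 2 (volume : Measure E3)

lemma inner_toLp {f : E3 → E3} (hf : MemLp f 2) (F : L2) :
    inner ℝ F (hf.toLp f) = ∫ x, inner ℝ (F x) (f x) := by
  rw [L2.inner_def]
  refine integral_congr_ae ?_
  filter_upwards [hf.coeFn_toLp] with x hx
  rw [hx]

lemma integrable_inner_of_memLp {f : E3 → E3} (hf : MemLp f 2) (F : L2) :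
    Integrable fun x => inner ℝ (F x) (f x) := by
  refine (L2.integrable_inner (𝕜 := ℝ) F (hf.toLp f)).congr ?_
  filter_upwards [hf.coeFn_toLp] with x hx
  rw [hx]

/-- The square decays like `|x|⁻⁴`, and `4` exceeds the dimension. -/
lemma memLp_decay : MemLp (fun x : E3 => ((1 + ‖x‖) ^ 2)⁻¹) 2 := by
  have hm : AEStronglyMeasurable (fun x : E3 => ((1 + ‖x‖) ^ 2)⁻¹) volume := by fun_prop
  rw [memLp_two_iff_integrable_sq hm]
  have h := integrable_one_add_norm (E := E3) (μ := volume) (r := 4) (by norm_num)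
  refine h.congr (ae_of_all _ fun x => ?_)
  have : 0 ≤ 1 + ‖x‖ := by positivity
  simp only []
  rw [Real.rpow_neg this, inv_pow, ← pow_mul]
  norm_cast

lemma memLp_of_decay {F : Type*} [NormedAddCommGroup F] {f : E3 → F}
    (hf : AEStronglyMeasurable f volume) {M : ℝ} (h : ∀ x, ‖f x‖ ≤ M / (1 + ‖x‖) ^ 2) :
    MemLp f 2 :=
  memLp_decay.of_le_mul (c := M) hf (ae_of_all _ fun x => by
    rw [Real.norm_of_nonneg (by positivity)]; exact h x)

lemma norm_gradient (f : E3 → ℝ) (x : E3) : ‖gradient f x‖ = ‖fderiv ℝ f x‖ :=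
  LinearIsometryEquiv.norm_map _ _

lemma gradient_eq_zero_of_fderiv {f : E3 → ℝ} {x : E3} (h : fderiv ℝ f x = 0) :
    gradient f x = 0 := by
  rw [gradient, h, map_zero]

lemma IsTest.hasCompactSupport_gradient {φ : E3 → ℝ} (h : IsTest φ) :
    HasCompactSupport (gradient φ) :=
  (h.2.fderiv (𝕜 := ℝ)).comp_left (g := (InnerProductSpace.toDual ℝ E3).symm) (map_zero _)

lemma IsTest.memLp_gradient {φ : E3 → ℝ} (h : IsTest φ) {p : ENNReal} : MemLp (gradient φ) p :=
  (continuous_gradient h.contDiff_one).memLp_of_hasCompactSupport h.hasCompactSupport_gradient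

lemma IsTest.memLp {φ : E3 → ℝ} (h : IsTest φ) {p : ENNReal} : MemLp φ p :=
  h.continuous.memLp_of_hasCompactSupport h.2

lemma IsTest.memLp_smul {φ : E3 → ℝ} (h : IsTest φ) (v : E3) {p : ENNReal} :
    MemLp (fun x => φ x • v) p :=
  (h.continuous.smul continuous_const).memLp_of_hasCompactSupport h.2.smul_right

lemma IsTest.add {φ ψ : E3 → ℝ} (h : IsTest φ) (h' : IsTest ψ) : IsTest (φ + ψ) :=
  ⟨h.1.add h'.1, h.2.add h'.2⟩

lemma IsTest.const_smul {φ : E3 → ℝ} (h : IsTest φ) (c : ℝ) : IsTest (c • φ) :=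
  ⟨h.1.const_smul c, h.2.smul_left (f := fun _ => c)⟩

lemma isTest_zero : IsTest 0 := ⟨contDiff_const, HasCompactSupport.zero⟩

lemma gradient_add {φ ψ : E3 → ℝ} (h : ContDiff ℝ 1 φ) (h' : ContDiff ℝ 1 ψ) :
    gradient (φ + ψ) = gradient φ + gradient ψ := by
  ext1 x
  simp [gradient, fderiv_add (h.differentiable one_ne_zero x) (h'.differentiable one_ne_zero x)]

lemma gradient_const_smul {φ : E3 → ℝ} (h : ContDiff ℝ 1 φ) (c : ℝ) :
    gradient (c • φ) = c • gradient φ := by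
  ext1 x
  simp [gradient, fderiv_const_smul (h.differentiable one_ne_zero x)]

/-- The gradients of test functions. -/
def testGradients : Submodule ℝ L2 where
  carrier := {G | ∃ φ, IsTest φ ∧ G =ᵐ[volume] gradient φ}
  add_mem' := by
    rintro G G' ⟨φ, hφ, hG⟩ ⟨φ', hφ', hG'⟩
    refine ⟨φ + φ', hφ.add hφ', ?_⟩
    rw [gradient_add hφ.contDiff_one hφ'.contDiff_one]
    exact (Lp.coeFn_add _ _).trans (hG.add hG')
  zero_mem' := ⟨0, isTest_zero, by
    have : gradient (0 : E3 → ℝ) = 0 := by ext1 x; simp [gradient]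
    rw [this]; exact Lp.coeFn_zero _ _ _⟩
  smul_mem' := by
    rintro c G ⟨φ, hφ, hG⟩
    refine ⟨c • φ, hφ.const_smul c, ?_⟩
    rw [gradient_const_smul hφ.contDiff_one]
    exact (Lp.coeFn_smul _ _).trans (hG.const_smul c)

/-- The closure in `L²` of the gradients of test functions. -/
def gradSpace : Submodule ℝ L2 := testGradients.topologicalClosure

instance : CompleteSpace gradSpace :=
  (Submodule.isClosed_topologicalClosure testGradients).completeSpace_coe

/-- The gradient of a test function as an element of `L²`. -/
def IsTest.grad {φ : E3 → ℝ} (h : IsTest φ) : L2 := h.memLp_gradient.toLp (gradient φ)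

lemma IsTest.grad_mem {φ : E3 → ℝ} (h : IsTest φ) : h.grad ∈ gradSpace :=
  Submodule.le_topologicalClosure _ ⟨φ, h, h.memLp_gradient.coeFn_toLp⟩

/-- The orthogonal complement ignores closures, so it consists of the fields with zero
distributional divergence. -/
lemma mem_gradSpace_orthogonal_iff (H : L2) :
    H ∈ gradSpaceᗮ ↔ ∀ φ : E3 → ℝ, IsTest φ → ∫ x, inner ℝ (H x) (gradient φ x) = 0 := by
  rw [gradSpace, Submodule.orthogonal_closure, Submodule.mem_orthogonal']
  constructor
  · intro h φ hφ
    rw [← inner_toLp hφ.memLp_gradient]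
    exact h _ ⟨φ, hφ, hφ.memLp_gradient.coeFn_toLp⟩
  · rintro h G ⟨φ, hφ, hG⟩
    rw [← h φ hφ, L2.inner_def]
    refine integral_congr_ae ?_
    filter_upwards [hG] with x hx
    rw [hx]

lemma mem_gradSpace_of_orthogonal {G : L2} (h : ∀ H ∈ gradSpaceᗮ, inner ℝ H G = 0) :
    G ∈ gradSpace := by
  rw [← Submodule.orthogonal_orthogonal gradSpace]
  exact fun H hH => h H hH

lemma memLp_gradient_pot {g : E3 → ℝ} (hg : IsTest g) : MemLp (gradient (pot g)) 2 := by
  obtain ⟨M, -, hM⟩ := exists_decay_fderiv_pot hg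
  refine memLp_of_decay
    (continuous_gradient (contDiff_one_of_top (contDiff_pot hg))).aestronglyMeasurable (M := M) ?_
  intro x
  rw [norm_gradient]; exact hM x

/-- The gradient of the Newtonian potential of a test function as an element of `L²`. -/
def IsTest.potGrad {g : E3 → ℝ} (h : IsTest g) : L2 := (memLp_gradient_pot h).toLp _

lemma gradient_mul {f g : E3 → ℝ} (hf : ContDiff ℝ 1 f) (hg : ContDiff ℝ 1 g) (x : E3) :
    gradient (fun y => f y * g y) x = f x • gradient g x + g x • gradient f x := by
  refine ext_inner_right ℝ fun v => ?_
  rw [inner_gradient, fderiv_mul_apply hf hg, inner_add_left, inner_smul_left, inner_smul_left,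
    inner_gradient, inner_gradient]
  simp [mul_comm]

/-- The potential decays like `|x|⁻¹` and the gradients of the cutoffs like `|x|⁻¹` uniformly in
`n`. Thus the truncated gradients are dominated by a multiple of `(1 + |x|)⁻²`, which lies in L². -/
lemma tendsto_integral_inner_cutoff (H : L2) {g : E3 → ℝ} (hg : IsTest g) :
    Tendsto (fun n => ∫ x, inner ℝ (H x) (gradient (fun x => cutoff n x * pot g x) x))
      atTop (𝓝 (∫ x, inner ℝ (H x) (gradient (pot g) x))) := by
  have hp := contDiff_pot hg
  have hp1 := contDiff_one_of_top hp
  have ht : ∀ n, IsTest fun x => cutoff n x * pot g x := fun n => (isTest_cutoff n).mul_right hp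
  obtain ⟨M0, hM00, hM0⟩ := exists_decay_pot hg
  obtain ⟨M1, hM10, hM1⟩ := exists_decay_fderiv_pot hg
  obtain ⟨M2, hM20, hM2⟩ := exists_bound_fderiv_cutoff
  have hb : MemLp (fun x : E3 => (M1 + M0 * M2) / (1 + ‖x‖) ^ 2) 2 := by
    simpa only [div_eq_mul_inv] using memLp_decay.const_mul (M1 + M0 * M2)
  refine tendsto_integral_of_dominated_convergence
    (fun x => ‖H x‖ * ((M1 + M0 * M2) / (1 + ‖x‖) ^ 2)) ?_ ?_ ?_ ?_
  · exact fun n => (integrable_inner_of_memLp (ht n).memLp_gradient H).1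
  · exact (Lp.memLp H).norm.integrable_mul hb
  · refine fun n => ae_of_all _ fun x => (norm_inner_le_norm _ _).trans ?_
    gcongr
    rw [gradient_mul (isTest_cutoff n).contDiff_one hp1]
    refine (norm_add_le _ _).trans ?_
    rw [norm_smul, norm_smul, norm_gradient, norm_gradient, Real.norm_eq_abs, Real.norm_eq_abs,
      add_div]
    have h1 : M0 * M2 / (1 + ‖x‖) ^ 2 = M0 / (1 + ‖x‖) * (M2 / (1 + ‖x‖)) := by
      rw [div_mul_div_comm, sq]
    rw [h1]
    gcongr
    · calc _ ≤ 1 * (M1 / (1 + ‖x‖) ^ 2) := by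
            gcongr
            · exact abs_cutoff_le n x
            · exact hM1 x
        _ = _ := one_mul _
    · exact hM0 x
    · exact hM2 n x
  · refine ae_of_all _ fun x => tendsto_const_nhds.congr' ?_
    filter_upwards [eventually_cutoff_eq_one x] with n hn
    have : (fun x => cutoff n x * pot g x) =ᶠ[𝓝 x] pot g := by
      filter_upwards [hn] with y hy
      rw [hy, one_mul]
    rw [this.gradient_eq]

/-- The potential is not compactly supported, so its gradient is reached only in the closure:
orthogonality to the truncated gradients passes to the limit. -/
lemma IsTest.potGrad_mem {g : E3 → ℝ} (hg : IsTest g) : hg.potGrad ∈ gradSpace := by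
  refine mem_gradSpace_of_orthogonal fun H hH => ?_
  rw [mem_gradSpace_orthogonal_iff] at hH
  rw [IsTest.potGrad, inner_toLp]
  refine tendsto_nhds_unique (tendsto_integral_inner_cutoff H hg) ?_
  simp only [hH _ ((isTest_cutoff _).mul_right (contDiff_pot hg))]
  exact tendsto_const_nhds

/-- The constant field `v`, localized by a test function. -/
def IsTest.vec {φ : E3 → ℝ} (h : IsTest φ) (v : E3) : L2 := (h.memLp_smul v).toLp _

lemma inner_vec {φ : E3 → ℝ} (h : IsTest φ) (v : E3) (F : L2) :
    inner ℝ F (h.vec v) = ∫ x, φ x * inner ℝ (F x) v := by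
  rw [IsTest.vec, inner_toLp]
  simp only [inner_smul_right]

lemma integral_mul_fderiv_eq_neg {φ η : E3 → ℝ} (hφ : IsTest φ) (hη : ContDiff ℝ ∞ η) (v : E3) :
    ∫ x, φ x * fderiv ℝ η x v = -∫ x, η x * fderiv ℝ φ x v := by
  have h := integral_mul_fderiv_eq_neg_fderiv_mul_of_integrable (μ := (volume : Measure E3))
    (f := φ) (g := η) (v := v)
    ((hφ.fderiv_apply v).mul_right hη).integrable
    (hφ.mul_right (contDiff_fderiv_apply hη v)).integrable (hφ.mul_right hη).integrable
    (fun x _ => hφ.contDiff_one.differentiable one_ne_zero x)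
    (fun x _ => (contDiff_one_of_top hη).differentiable one_ne_zero x)
  rw [h]
  simp only [mul_comm]

/-- Explicit Helmholtz decomposition of `φ v`. Since the Laplacian of `pot g` is `-|S²| g`, adding
the gradient of the potential of `∂_v φ` cancels the divergence of `|S²| φ v`. -/
lemma vec_add_potGrad_mem_orthogonal {φ : E3 → ℝ} (h : IsTest φ) (v : E3) :
    sphereArea • h.vec v + (h.fderiv_apply v).potGrad ∈ gradSpaceᗮ := by
  rw [mem_gradSpace_orthogonal_iff]
  intro η hη
  rw [← inner_toLp hη.memLp_gradient]
  change inner ℝ _ hη.grad = 0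
  have hη' : (hη.grad : E3 → E3) =ᵐ[volume] gradient η := hη.memLp_gradient.coeFn_toLp
  rw [inner_add_left, inner_smul_left, real_inner_comm,
    inner_vec, real_inner_comm, IsTest.potGrad, inner_toLp]
  have e1 : ∫ x, φ x * inner ℝ (hη.grad x) v =
      ∫ x, φ x * fderiv ℝ η x v := by
    refine integral_congr_ae ?_
    filter_upwards [hη'] with x hx
    rw [hx, inner_gradient]
  have e2 : ∫ x, inner ℝ (hη.grad x)
      (gradient (pot fun x => fderiv ℝ φ x v) x) =
      ∫ x, inner ℝ (gradient (pot fun x => fderiv ℝ φ x v) x) (gradient η x) := by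
    refine integral_congr_ae ?_
    filter_upwards [hη'] with x hx
    rw [hx, real_inner_comm]
  rw [e1, e2, integral_inner_gradient_pot (h.fderiv_apply v) hη, integral_mul_fderiv_eq_neg h hη.1]
  simp only [mul_comm, RCLike.conj_to_real]
  ring

/-- The orthogonal projection onto the gradient fields. -/
abbrev gradProj (F : L2) : L2 := gradSpace.starProjection F

/-- Moving the self-adjoint projection to the test field `φ v` replaces the unknown field `gradProj
F` by the explicit gradient part of `φ v`. -/
lemma inner_gradProj_vec {φ : E3 → ℝ} (h : IsTest φ) (v : E3) (F : L2) :
    sphereArea * ∫ x, φ x * inner ℝ (gradProj F x) v =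
      -inner ℝ F (h.fderiv_apply v).potGrad := by
  have h1 : gradProj (h.fderiv_apply v).potGrad = (h.fderiv_apply v).potGrad :=
    Submodule.starProjection_eq_self_iff.2 (IsTest.potGrad_mem _)
  have h2 : inner ℝ (gradProj F) (sphereArea • h.vec v + (h.fderiv_apply v).potGrad) = 0 :=
    (vec_add_potGrad_mem_orthogonal h v) _ (Submodule.starProjection_apply_mem _ _)
  rw [inner_add_right, inner_smul_right, inner_vec] at h2
  have h3 : inner ℝ (gradProj F) (h.fderiv_apply v).potGrad =
      inner ℝ F (h.fderiv_apply v).potGrad := by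
    rw [Submodule.inner_starProjection_left_eq_right]
    exact congrArg _ h1
  linarith

/-! ### Square integrable solutions of Poisson's equation -/

lemma IsTest.lap {φ : E3 → ℝ} (h : IsTest φ) : IsTest (lap φ) := by
  have h0 : ∀ i, IsTest fun x => fderiv ℝ (fun y => fderiv ℝ φ y (stdB i)) x (stdB i) :=
    fun i => (h.fderiv_apply _).fderiv_apply _
  have : CoreShell.lap φ = ((fun x => fderiv ℝ (fun y => fderiv ℝ φ y (stdB 0)) x (stdB 0)) +
      fun x => fderiv ℝ (fun y => fderiv ℝ φ y (stdB 1)) x (stdB 1)) +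
      fun x => fderiv ℝ (fun y => fderiv ℝ φ y (stdB 2)) x (stdB 2) := by
    ext x; simp only [CoreShell.lap, Fin.sum_univ_three, Pi.add_apply]
  rw [this]
  exact ((h0 0).add (h0 1)).add (h0 2)

/-- By the product rule the error terms of the Laplacian are dominated by a multiple of `(1 +
|x|)⁻²`, which is in L², while the main term is bounded by `|S²| |g|`. -/
lemma tendsto_integral_mul_lap {w : E3 → ℝ} (hw : MemLp w 2) {g : E3 → ℝ} (hg : IsTest g) :
    Tendsto (fun n => ∫ x, w x * lap (fun y => cutoff n y * pot g y) x) atTop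
      (𝓝 (-(sphereArea * ∫ x, w x * g x))) := by
  have hp := contDiff_pot hg
  have ht : ∀ n, IsTest fun x => cutoff n x * pot g x := fun n => (isTest_cutoff n).mul_right hp
  obtain ⟨M0, hM00, hM0⟩ := exists_decay_pot hg
  obtain ⟨M1, hM10, hM1⟩ := exists_decay_fderiv_pot hg
  obtain ⟨M2, hM20, hM2⟩ := exists_bound_fderiv_cutoff
  obtain ⟨M3, hM30, hM3⟩ := exists_bound_lap_cutoff
  have hlim : -(sphereArea * ∫ x, w x * g x) = ∫ x, w x * lap (pot g) x := by
    rw [← integral_const_mul, ← integral_neg]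
    congr 1; ext x; rw [lap_pot hg]; ring
  rw [hlim]
  set C := 6 * (M2 * M1) + M3 * M0 with hC
  have hb : MemLp (fun x : E3 => sphereArea * |g x| + C / (1 + ‖x‖) ^ 2) 2 := by
    refine MemLp.add (hg.memLp.norm.const_mul _) ?_
    simpa only [div_eq_mul_inv] using memLp_decay.const_mul C
  refine tendsto_integral_of_dominated_convergence
    (fun x => ‖w x‖ * (sphereArea * |g x| + C / (1 + ‖x‖) ^ 2)) ?_ ?_ ?_ ?_
  · exact fun n => hw.1.mul (ht n).lap.continuous.aestronglyMeasurable
  · exact hw.norm.integrable_mul hb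
  · refine fun n => ae_of_all _ fun x => ?_
    rw [norm_mul]
    gcongr
    rw [lap_mul (isTest_cutoff n).1 hp, lap_pot hg, Real.norm_eq_abs]
    have hx : 0 ≤ ‖x‖ := norm_nonneg x
    have h1 : |cutoff n x * -(sphereArea * g x)| ≤ sphereArea * |g x| := by
      rw [abs_mul, abs_neg, abs_mul, abs_of_pos sphereArea_pos]
      exact mul_le_of_le_one_left (by have := sphereArea_pos; positivity) (abs_cutoff_le n x)
    have h2 : ∀ i : Fin 3, |fderiv ℝ (cutoff n) x (stdB i) * fderiv ℝ (pot g) x (stdB i)| ≤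
        M2 * M1 / (1 + ‖x‖) ^ 2 := fun i => by
      rw [abs_mul]
      have a1 := (fderiv ℝ (cutoff n) x).le_opNorm (stdB i)
      have a2 := (fderiv ℝ (pot g) x).le_opNorm (stdB i)
      rw [stdB.norm_eq_one, mul_one, Real.norm_eq_abs] at a1 a2
      calc _ ≤ M2 / (1 + ‖x‖) * (M1 / (1 + ‖x‖) ^ 2) := by
            gcongr
            · exact a1.trans (hM2 n x)
            · exact a2.trans (hM1 x)
        _ ≤ M2 / 1 * (M1 / (1 + ‖x‖) ^ 2) := by gcongr; linarith
        _ = _ := by ring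
    have h3 : |2 * ∑ i, fderiv ℝ (cutoff n) x (stdB i) * fderiv ℝ (pot g) x (stdB i)| ≤
        6 * (M2 * M1) / (1 + ‖x‖) ^ 2 := by
      rw [abs_mul, abs_two]
      have := (Finset.abs_sum_le_sum_abs _ _).trans
        (Finset.sum_le_sum fun (i : Fin 3) (_ : i ∈ Finset.univ) => h2 i)
      rw [Finset.sum_const, Finset.card_univ, Fintype.card_fin, nsmul_eq_mul] at this
      calc _ ≤ 2 * ((3 : ℕ) * (M2 * M1 / (1 + ‖x‖) ^ 2)) := by gcongr
        _ = _ := by push_cast; ring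
    have h4 : |lap (cutoff n) x * pot g x| ≤ M3 * M0 / (1 + ‖x‖) ^ 2 := by
      rw [abs_mul]
      calc _ ≤ M3 / (1 + ‖x‖) ^ 2 * (M0 / (1 + ‖x‖)) := by
            gcongr
            · exact hM3 n x
            · exact hM0 x
        _ ≤ M3 / (1 + ‖x‖) ^ 2 * (M0 / 1) := by gcongr; linarith
        _ = _ := by ring
    refine (abs_add_le _ _).trans ?_
    rw [hC, add_div, ← add_assoc]
    exact add_le_add ((abs_add_le _ _).trans (add_le_add h1 h3)) h4
  · refine ae_of_all _ fun x => tendsto_const_nhds.congr' ?_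
    filter_upwards [eventually_cutoff_eq_one x] with n hn
    have h1 : (fun x => cutoff n x * pot g x) =ᶠ[𝓝 x] pot g := by
      filter_upwards [hn] with y hy
      rw [hy, one_mul]
    congr 1
    refine Finset.sum_congr rfl fun i _ => ?_
    have h2 : (fun y => fderiv ℝ (fun x => cutoff n x * pot g x) y (stdB i)) =ᶠ[𝓝 x]
        fun y => fderiv ℝ (pot g) y (stdB i) := by
      filter_upwards [h1.fderiv (𝕜 := ℝ)] with y hy
      rw [hy]
    rw [h2.fderiv_eq]

/-- Representation of square integrable solutions `w` of `Δ w = div F`. -/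
lemma integral_mul_of_poisson {w : E3 → ℝ} (hw : MemLp w 2) {F : L2}
    (h : ∀ φ, IsTest φ → ∫ x, w x * lap φ x = -∫ x, inner ℝ (F x) (gradient φ x))
    {g : E3 → ℝ} (hg : IsTest g) :
    sphereArea * ∫ x, w x * g x = inner ℝ F hg.potGrad := by
  -- The potential of `g` is the natural test function for Poisson's equation; it has to be
  -- truncated to be admissible.
  have ht : ∀ n, IsTest fun x => cutoff n x * pot g x := fun n =>
    (isTest_cutoff n).mul_right (contDiff_pot hg)
  have h1 := tendsto_integral_mul_lap hw hg
  simp only [h _ (ht _)] at h1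
  have h2 := tendsto_nhds_unique h1 (tendsto_integral_inner_cutoff F hg).neg
  rw [IsTest.potGrad, inner_toLp]
  linarith

/-- The weak gradient of a square integrable solution of `Δ w = div F` is the projection of `F`. -/
lemma integral_mul_fderiv_of_poisson {w : E3 → ℝ} (hw : MemLp w 2) {F : L2}
    (h : ∀ φ, IsTest φ → ∫ x, w x * lap φ x = -∫ x, inner ℝ (F x) (gradient φ x))
    {φ : E3 → ℝ} (hφ : IsTest φ) (v : E3) :
    ∫ x, w x * fderiv ℝ φ x v = -∫ x, φ x * inner ℝ (gradProj F x) v := by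
  have h1 := integral_mul_of_poisson hw h (hφ.fderiv_apply v)
  have h2 := inner_gradProj_vec hφ v F
  apply mul_left_cancel₀ sphereArea_pos.ne'
  linarith

/-! ### The corrector problem in a Hilbert space -/

section Abstract

variable {H : Type*} [NormedAddCommGroup H] [InnerProductSpace ℝ H]

/-- `T` is the total field with background `e`: it differs from `e` by an element of `X`, and
solves the variational equation with coefficient `s + Q`. -/
structure IsField (X : Submodule ℝ H) (s : ℝ) (Q : H →L[ℝ] H) (e T : H) : Prop where
  sub_mem : T - e ∈ X
  eqn : ∀ v ∈ X, s * inner ℝ (T - e) v + inner ℝ (Q T) v = 0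

/-- The quadratic form of `s + Q` is bounded below by `l`. -/
def IsElliptic (s l : ℝ) (Q : H →L[ℝ] H) : Prop :=
  0 < l ∧ ∀ v, l * ‖v‖ ^ 2 ≤ s * ‖v‖ ^ 2 + inner ℝ (Q v) v

variable {X : Submodule ℝ H} {s l : ℝ} {Q Q' : H →L[ℝ] H} {e e' T T' : H}

/-- The difference of the two equations is tested with `T - T'`. Only the action of `Q - Q'` on the
single field `T'` enters, and this field may be chosen as a fixed reference; no smallness in
operator norm is needed. -/
lemma IsField.norm_sub_le (hl : IsElliptic s l Q) (h : IsField X s Q e T)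
    (h' : IsField X s Q' e T') : l * ‖T - T'‖ ≤ ‖(Q - Q') T'‖ := by
  have hm : T - T' ∈ X := by
    have := X.sub_mem h.1 h'.1
    rwa [sub_sub_sub_cancel_right] at this
  have h1 := h.2 _ hm
  have h2 := h'.2 _ hm
  have h3 := hl.2 (T - T')
  have h4 : s * inner ℝ (T - e) (T - T') - s * inner ℝ (T' - e) (T - T') = s * ‖T - T'‖ ^ 2 := by
    rw [← mul_sub, ← inner_sub_left, sub_sub_sub_cancel_right, real_inner_self_eq_norm_sq]
  have h5 : inner ℝ (Q (T - T')) (T - T') =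
      inner ℝ (Q T) (T - T') - inner ℝ (Q T') (T - T') := by
    rw [map_sub, inner_sub_left]
  have h6 : inner ℝ ((Q - Q') T') (T - T') =
      inner ℝ (Q T') (T - T') - inner ℝ (Q' T') (T - T') := by
    rw [sub_apply, inner_sub_left]
  have h7 : -inner ℝ ((Q - Q') T') (T - T') ≤ ‖(Q - Q') T'‖ * ‖T - T'‖ :=
    (neg_le_abs _).trans (abs_real_inner_le_norm _ _)
  rcases (norm_nonneg (T - T')).eq_or_lt with h0 | h0
  · rw [← h0]; simp
  · refine le_of_mul_le_mul_right ?_ h0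
    nlinarith

lemma IsField.unique (hl : IsElliptic s l Q) (h : IsField X s Q e T)
    (h' : IsField X s Q e T') : T = T' := by
  have := h.norm_sub_le hl h'
  simp only [sub_self, zero_apply, norm_zero] at this
  exact sub_eq_zero.1 (norm_le_zero_iff.1 (nonpos_of_mul_nonpos_right this hl.1))

/-- Reciprocity: each equation is tested with the corrector of the other one, and the background
terms cancel. For `Q = Q'` it gives symmetry of the polarization form, otherwise an exact formula
for its variation. -/
lemma IsField.inner_sub_inner (hQ : ∀ v w, inner ℝ (Q' v) w = inner ℝ v (Q' w))
    (h : IsField X s Q e T) (h' : IsField X s Q' e' T') :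
    inner ℝ (Q T) e' - inner ℝ e (Q' T') = inner ℝ ((Q - Q') T) T' := by
  have h1 := h.2 _ h'.1
  have h2 := h'.2 _ h.1
  rw [inner_sub_right (Q T)] at h1
  rw [inner_sub_right (Q' T'), real_inner_comm, real_inner_comm T, real_inner_comm e] at h2
  rw [sub_apply, inner_sub_left, hQ]
  linarith

variable [CompleteSpace H]

/-- The solution operator of the corrector problem. -/
def fieldOp (X : Submodule ℝ H) [CompleteSpace X] (s : ℝ) (Q : H →L[ℝ] H) : H →L[ℝ] H :=
  ContinuousLinearMap.id ℝ H - X.subtypeL.comp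
    ((ContinuousLinearMap.inverse (s • ContinuousLinearMap.id ℝ X +
      (ContinuousLinearMap.adjoint X.subtypeL).comp (Q.comp X.subtypeL))).comp
      ((ContinuousLinearMap.adjoint X.subtypeL).comp Q))

/-- Lax-Milgram: the compression of `s + Q` to `X` is coercive. It is therefore invertible, and
`ContinuousLinearMap.inverse` in `fieldOp` is the true inverse and not its default value. -/
lemma isField_fieldOp [CompleteSpace X] (hl : IsElliptic s l Q) (e : H) :
    IsField X s Q e (fieldOp X s Q e) := by
  set A : X →L[ℝ] X := s • ContinuousLinearMap.id ℝ X +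
      (ContinuousLinearMap.adjoint X.subtypeL).comp (Q.comp X.subtypeL) with hA
  have hAi : ∀ v w : X, inner ℝ (A v) w = s * inner ℝ (v : H) (w : H) + inner ℝ (Q v) (w : H) := by
    intro v w
    simp only [hA, add_apply, smul_apply, ContinuousLinearMap.id_apply,
      ContinuousLinearMap.comp_apply, inner_add_left, inner_smul_left,
      ContinuousLinearMap.adjoint_inner_left]
    simp
  let Bf : X →L[ℝ] X →L[ℝ] ℝ := (innerSL ℝ).comp A
  have hB : IsCoercive Bf := by
    refine ⟨l, hl.1, fun u => ?_⟩
    have h1 := hl.2 (u : H)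
    have : Bf u u = inner ℝ (A u) u := rfl
    rw [this, hAi, real_inner_self_eq_norm_sq]
    simp only [Submodule.coe_norm] at *
    linarith [sq ‖(u : H)‖]
  have hE : A = (hB.continuousLinearEquivOfBilin : X →L[ℝ] X) := by
    ext1 v
    exact hB.unique_continuousLinearEquivOfBilin fun w => rfl
  have hinv : ∀ v, A (A.inverse v) = v := by
    intro v
    rw [hE, ContinuousLinearMap.inverse_equiv]
    simp
  have hS : fieldOp X s Q e - e =
      -((A.inverse (ContinuousLinearMap.adjoint X.subtypeL (Q e)) : X) : H) := by
    simp [fieldOp, hA]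
  have hS' : fieldOp X s Q e =
      e - ((A.inverse (ContinuousLinearMap.adjoint X.subtypeL (Q e)) : X) : H) := by
    rw [sub_eq_add_neg, ← hS]; abel
  refine ⟨by rw [hS]; exact X.neg_mem (Subtype.mem _), fun v hv => ?_⟩
  have h1 := hAi (A.inverse (ContinuousLinearMap.adjoint X.subtypeL (Q e))) ⟨v, hv⟩
  rw [hinv, ContinuousLinearMap.adjoint_inner_left] at h1
  rw [hS, hS', map_sub, inner_sub_left, inner_neg_left]
  simp only [Submodule.subtypeL_apply] at h1
  linarith

end Abstract

/-! ### Multiplication operators -/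

/-- Multiplication by a bounded matrix field. -/
def mulOp (A : E3 → E3 →L[ℝ] E3) : L2 →L[ℝ] L2 :=
  open Classical in
  if h : MemLp A ⊤ (volume : Measure E3) then
    (ContinuousLinearMap.id ℝ (E3 →L[ℝ] E3)).holderL volume ⊤ 2 2 (h.toLp A)
  else 0

variable {A A' : E3 → E3 →L[ℝ] E3}

lemma coeFn_mulOp (h : MemLp A ⊤ (volume : Measure E3)) (F : L2) :
    mulOp A F =ᵐ[volume] fun x => A x (F x) := by
  rw [mulOp, dif_pos h]
  have := (ContinuousLinearMap.id ℝ (E3 →L[ℝ] E3)).coeFn_holder (r := 2) (h.toLp A) F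
  refine this.trans ?_
  filter_upwards [h.coeFn_toLp] with x hx
  rw [hx]; rfl

lemma inner_mulOp (h : MemLp A ⊤ (volume : Measure E3)) (F G : L2) :
    inner ℝ (mulOp A F) G = ∫ x, inner ℝ (A x (F x)) (G x) := by
  rw [L2.inner_def]
  refine integral_congr_ae ?_
  filter_upwards [coeFn_mulOp h F] with x hx
  rw [hx]

lemma mulOp_symm (h : MemLp A ⊤ (volume : Measure E3))
    (hA : ∀ x v w, inner ℝ (A x v) w = inner ℝ v (A x w)) (F G : L2) :
    inner ℝ (mulOp A F) G = inner ℝ F (mulOp A G) := by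
  rw [inner_mulOp h, real_inner_comm, inner_mulOp h]
  refine integral_congr_ae (ae_of_all _ fun x => ?_)
  change inner ℝ (A x (F x)) (G x) = inner ℝ (A x (G x)) (F x)
  rw [hA, real_inner_comm]

lemma mulOp_sub (h : MemLp A ⊤ (volume : Measure E3)) (h' : MemLp A' ⊤ (volume : Measure E3)) :
    mulOp A - mulOp A' = mulOp (A - A') := by
  ext1 F
  rw [Lp.ext_iff]
  rw [sub_apply]
  filter_upwards [Lp.coeFn_sub (mulOp A F) (mulOp A' F), coeFn_mulOp h F, coeFn_mulOp h' F,
    coeFn_mulOp (h.sub h') F] with x h1 h2 h3 h4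
  rw [h1, h4, Pi.sub_apply, h2, h3]; rfl

lemma memLp_top_of_norm_le (hm : AEStronglyMeasurable A volume) {C : ℝ} (hC : ∀ x, ‖A x‖ ≤ C) :
    MemLp A ⊤ (volume : Measure E3) :=
  memLp_top_of_bound hm C (ae_of_all _ hC)

lemma norm_mulOp_le (hm : AEStronglyMeasurable A volume) {C : ℝ}
    (hC : ∀ x, ‖A x‖ ≤ C) : ‖mulOp A‖ ≤ C := by
  have h0 : 0 ≤ C := (norm_nonneg _).trans (hC 0)
  refine ContinuousLinearMap.opNorm_le_bound _ h0 fun F => ?_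
  refine Lp.norm_le_mul_norm_of_ae_le_mul ?_
  filter_upwards [coeFn_mulOp (memLp_top_of_norm_le hm hC) F] with x hx
  rw [hx]
  exact ((A x).le_opNorm _).trans (by gcongr; exact hC x)

lemma integrable_inner_mul (h : MemLp A ⊤ (volume : Measure E3)) (F G : L2) :
    Integrable fun x => inner ℝ (A x (F x)) (G x) := by
  refine (L2.integrable_inner (𝕜 := ℝ) (mulOp A F) G).congr ?_
  filter_upwards [coeFn_mulOp h F] with x hx
  rw [hx]

lemma isElliptic_mulOp (h : MemLp A ⊤ (volume : Measure E3)) {s l : ℝ} (hl : 0 < l)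
    (hA : ∀ x v, l * ‖v‖ ^ 2 ≤ s * ‖v‖ ^ 2 + inner ℝ (A x v) v) :
    IsElliptic s l (mulOp A) := by
  refine ⟨hl, fun F => ?_⟩
  rw [inner_mulOp h, ← real_inner_self_eq_norm_sq, L2.inner_def, ← integral_const_mul,
    ← integral_const_mul, ← integral_add]
  · refine integral_mono ((L2.integrable_inner (𝕜 := ℝ) F F).const_mul _) ?_ fun x => ?_
    · exact ((L2.integrable_inner (𝕜 := ℝ) F F).const_mul _).add (integrable_inner_mul h F F)
    · simp only [real_inner_self_eq_norm_sq]
      exact hA x _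
  · exact (L2.integrable_inner (𝕜 := ℝ) F F).const_mul _
  · exact integrable_inner_mul h F F

/-! ### Newtonian potentials of divergences -/

/-- Cauchy-Schwarz after splitting the kernel as `k = √k √k`; this is the Schur test. -/
lemma sq_lintegral_mul_le {α : Type*} [MeasurableSpace α] (μ : Measure α) {k f : α → ENNReal}
    (hk : AEMeasurable k μ) (hf : AEMeasurable f μ) :
    (∫⁻ x, k x * f x ∂μ) ^ 2 ≤ (∫⁻ x, k x ∂μ) * ∫⁻ x, k x * f x ^ 2 ∂μ := by
  have h := ENNReal.lintegral_mul_le_Lp_mul_Lq μ Real.HolderConjugate.two_two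
    (f := fun x => k x ^ (1 / 2 : ℝ)) (g := fun x => k x ^ (1 / 2 : ℝ) * f x)
    (hk.pow_const _) ((hk.pow_const _).mul hf)
  have h2 : ∀ a : ENNReal, (a ^ (1 / 2 : ℝ)) ^ (2 : ℕ) = a := fun a => by
    rw [← ENNReal.rpow_natCast, ← ENNReal.rpow_mul]; simp
  have h3 : ∀ a : ENNReal, a ^ (2 : ℝ) = a ^ (2 : ℕ) := fun a => by
    rw [← ENNReal.rpow_natCast]; simp
  simp only [Pi.mul_apply, ← mul_assoc, h3, mul_pow, ← sq, h2] at h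
  calc _ ≤ _ := pow_le_pow_left' h 2
    _ = _ := by rw [mul_pow, h2, h2]

lemma dipole_neg (x : E3) : dipole (-x) = -dipole x := by simp [dipole]

lemma lintegral_ball_dipole_lt_top (R : ℝ) : ∫⁻ z in Metric.ball 0 R, ‖dipole z‖ₑ < ⊤ := by
  have h : IntegrableOn (fun z : E3 => ‖dipole z‖) (Metric.ball 0 R) := by
    simp only [norm_dipole]
    exact integrableOn_ball_inv_norm_pow le_rfl R
  have := h.2
  rw [hasFiniteIntegral_iff_enorm] at this
  simpa using this

/-- After the substitution `z = x - y` the domain lies in the ball of radius `R + R'`, which makes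
the bound independent of `x`. -/
lemma lintegral_ball_dipole_sub_le {R R' : ℝ} {x : E3} (hx : x ∈ Metric.ball (0 : E3) R') :
    ∫⁻ y in Metric.ball 0 R, ‖dipole (x - y)‖ₑ ≤ ∫⁻ z in Metric.ball 0 (R + R'), ‖dipole z‖ₑ := by
  rw [← lintegral_indicator Metric.isOpen_ball.measurableSet,
    ← lintegral_indicator Metric.isOpen_ball.measurableSet,
    ← lintegral_sub_left_eq_self (fun z => (Metric.ball (0 : E3) (R + R')).indicator
      (fun z => ‖dipole z‖ₑ) z) x]
  refine lintegral_mono fun y => ?_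
  by_cases hy : y ∈ Metric.ball (0 : E3) R
  · rw [indicator_of_mem hy, indicator_of_mem]
    simp only [Metric.mem_ball, dist_zero_right] at *
    exact (norm_sub_le _ _).trans_lt (by linarith)
  · rw [indicator_of_notMem hy]; exact zero_le

lemma lintegral_ball_dipole_sub_le' {R R' : ℝ} {y : E3} (hy : y ∈ Metric.ball (0 : E3) R) :
    ∫⁻ x in Metric.ball 0 R', ‖dipole (x - y)‖ₑ ≤
      ∫⁻ z in Metric.ball 0 (R + R'), ‖dipole z‖ₑ := by
  have h := lintegral_ball_dipole_sub_le (R := R') hy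
  rw [add_comm R R']
  refine le_trans (le_of_eq ?_) h
  refine lintegral_congr fun x => ?_
  rw [← neg_sub, dipole_neg, enorm_neg]

/-- `F` vanishes outside the ball of radius `R`. -/
def SupportedIn (R : ℝ) (F : L2) : Prop := ∀ᵐ y, y ∉ Metric.ball (0 : E3) R → F y = 0

/-- The solution `div (|x|⁻¹ ∗ F)`, up to sign, of Poisson's equation. -/
def newton (F : L2) (x : E3) : ℝ := ∫ y, inner ℝ (dipole (x - y)) (F y)

lemma stronglyMeasurable_inner_dipole (F : L2) :
    StronglyMeasurable fun q : E3 × E3 => (inner ℝ (dipole (q.1 - q.2)) (F q.2) : ℝ) := by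
  have h1 : StronglyMeasurable fun q : E3 × E3 => F q.2 :=
    (Lp.stronglyMeasurable F).comp_measurable measurable_snd
  have h2 : StronglyMeasurable fun q : E3 × E3 => dipole (q.1 - q.2) :=
    (measurable_dipole.comp (measurable_fst.sub measurable_snd)).stronglyMeasurable
  exact h2.inner h1

lemma SupportedIn.lintegral_eq {R : ℝ} {F : L2} (hF : SupportedIn R F) (k : E3 → ENNReal) :
    ∫⁻ y, k y * ‖F y‖ₑ = ∫⁻ y in Metric.ball 0 R, k y * ‖F y‖ₑ := by
  rw [← lintegral_indicator Metric.isOpen_ball.measurableSet]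
  refine lintegral_congr_ae ?_
  filter_upwards [hF] with y hy
  by_cases h : y ∈ Metric.ball (0 : E3) R
  · rw [indicator_of_mem h]
  · rw [indicator_of_notMem h, hy h]; simp

lemma measurable_enorm_dipole_sub : Measurable fun q : E3 × E3 => ‖dipole (q.1 - q.2)‖ₑ :=
  (measurable_dipole.comp (measurable_fst.sub measurable_snd)).enorm

lemma measurable_enorm_Lp (F : L2) : Measurable fun y => ‖F y‖ₑ :=
  (Lp.stronglyMeasurable F).measurable.enorm

lemma lintegral_lintegral_dipole_le {f : E3 → ENNReal} (hf : Measurable f) (R R' : ℝ) :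
    ∫⁻ x in Metric.ball 0 R', ∫⁻ y in Metric.ball 0 R, ‖dipole (x - y)‖ₑ * f y ≤
      (∫⁻ z in Metric.ball 0 (R + R'), ‖dipole z‖ₑ) * ∫⁻ y, f y := by
  have hm : Measurable (Function.uncurry fun x y : E3 => ‖dipole (x - y)‖ₑ * f y) :=
    measurable_enorm_dipole_sub.mul (hf.comp measurable_snd)
  have hb : MeasurableSet (Metric.ball (0 : E3) R) := Metric.isOpen_ball.measurableSet
  have h1 : ∀ y ∈ Metric.ball (0 : E3) R,
      ∫⁻ x in Metric.ball 0 R', ‖dipole (x - y)‖ₑ * f y ≤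
        (∫⁻ z in Metric.ball 0 (R + R'), ‖dipole z‖ₑ) * f y := by
    intro y hy
    have hk : Measurable fun x : E3 => ‖dipole (x - y)‖ₑ :=
      (measurable_dipole.comp (measurable_id.sub_const y)).enorm
    rw [lintegral_mul_const _ hk]
    exact mul_le_mul_left (lintegral_ball_dipole_sub_le' hy) _
  have h2 := setLIntegral_mono' (μ := volume) hb h1
  rw [lintegral_const_mul _ hf] at h2
  rw [lintegral_lintegral_swap hm.aemeasurable]
  exact h2.trans (mul_le_mul_right (setLIntegral_le_lintegral _ _) _)

/-- Schur test for the kernel `|x - y|⁻²`, whose integrals over bounded sets in either variable are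
uniformly bounded. -/
lemma SupportedIn.lintegral_sq_lt_top {R : ℝ} {F : L2} (hF : SupportedIn R F) (R' : ℝ) :
    ∫⁻ x in Metric.ball 0 R', (∫⁻ y, ‖dipole (x - y)‖ₑ * ‖F y‖ₑ) ^ 2 < ⊤ := by
  have hFm := measurable_enorm_Lp F
  have hF2 : ∫⁻ y, ‖F y‖ₑ ^ 2 < ⊤ := by
    have := (eLpNorm_lt_top_iff_lintegral_rpow_enorm_lt_top (p := 2) two_ne_zero
      ENNReal.ofNat_ne_top).1 (Lp.memLp F).2
    simpa using this
  have hCt := lintegral_ball_dipole_lt_top (R + R')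
  have hx : ∀ x ∈ Metric.ball (0 : E3) R', (∫⁻ y, ‖dipole (x - y)‖ₑ * ‖F y‖ₑ) ^ 2 ≤
      (∫⁻ z in Metric.ball 0 (R + R'), ‖dipole z‖ₑ) *
        ∫⁻ y in Metric.ball 0 R, ‖dipole (x - y)‖ₑ * ‖F y‖ₑ ^ 2 := by
    intro x hx
    rw [hF.lintegral_eq]
    refine (sq_lintegral_mul_le _ ?_ hFm.aemeasurable).trans ?_
    · exact (measurable_dipole.comp (measurable_id.const_sub x)).enorm.aemeasurable
    · exact mul_le_mul_left (lintegral_ball_dipole_sub_le hx) _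
  refine (setLIntegral_mono' Metric.isOpen_ball.measurableSet hx).trans_lt ?_
  rw [lintegral_const_mul' _ _ hCt.ne]
  exact ENNReal.mul_lt_top hCt ((lintegral_lintegral_dipole_le (hFm.pow_const 2) R R').trans_lt
    (ENNReal.mul_lt_top hCt hF2))

lemma enorm_newton_le (F : L2) (x : E3) :
    ‖newton F x‖ₑ ≤ ∫⁻ y, ‖dipole (x - y)‖ₑ * ‖F y‖ₑ := by
  refine (enorm_integral_le_lintegral_enorm _).trans (lintegral_mono fun y => ?_)
  rw [← ofReal_norm, ← ofReal_norm, ← ofReal_norm, ← ENNReal.ofReal_mul (norm_nonneg _)]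
  exact ENNReal.ofReal_le_ofReal (norm_inner_le_norm _ _)

lemma stronglyMeasurable_newton (F : L2) : StronglyMeasurable (newton F) :=
  (stronglyMeasurable_inner_dipole F).integral_prod_right

lemma SupportedIn.memLp_newton {R : ℝ} {F : L2} (hF : SupportedIn R F) {K : Set E3}
    (hK : IsCompact K) : MemLp (newton F) 2 (volume.restrict K) := by
  obtain ⟨R', hR'⟩ := hK.isBounded.subset_ball (0 : E3)
  refine ⟨(stronglyMeasurable_newton F).aestronglyMeasurable, ?_⟩
  rw [eLpNorm_lt_top_iff_lintegral_rpow_enorm_lt_top two_ne_zero ENNReal.ofNat_ne_top]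
  refine lt_of_le_of_lt ?_ (hF.lintegral_sq_lt_top R')
  refine (lintegral_mono_set hR').trans (lintegral_mono fun x => ?_)
  simp only [ENNReal.toReal_ofNat, ENNReal.rpow_ofNat]
  gcongr
  exact enorm_newton_le F x

lemma SupportedIn.integrable {R : ℝ} {F : L2} (hF : SupportedIn R F) : Integrable F := by
  refine ⟨(Lp.stronglyMeasurable F).aestronglyMeasurable, ?_⟩
  rw [hasFiniteIntegral_iff_enorm]
  have h := hF.lintegral_eq 1
  simp only [Pi.one_apply, one_mul] at h
  rw [h]
  have : IsFiniteMeasure ((volume : Measure E3).restrict (Metric.ball 0 R)) :=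
    ⟨by simpa using measure_ball_lt_top (μ := (volume : Measure E3)) (x := 0) (r := R)⟩
  have := ((Lp.memLp F).restrict (Metric.ball 0 R)).integrable (by norm_num)
  exact this.2

/-- This licenses Fubini's theorem in the weak form of the equation for `newton F`. -/
lemma SupportedIn.integrable_dipole_mul {R : ℝ} {F : L2} (hF : SupportedIn R F) {g : E3 → ℝ}
    (hg : IsTest g) :
    Integrable (fun q : E3 × E3 => inner ℝ (dipole (q.1 - q.2)) (F q.2) * g q.1)
      (volume.prod volume) := by
  obtain ⟨R', hR'⟩ := (hg.2 : IsCompact _).isBounded.subset_ball (0 : E3)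
  obtain ⟨M, hM⟩ := hg.exists_bound
  have hCt := lintegral_ball_dipole_lt_top (R + R')
  have hm : StronglyMeasurable fun q : E3 × E3 =>
      inner ℝ (dipole (q.1 - q.2)) (F q.2) * g q.1 :=
    (stronglyMeasurable_inner_dipole F).mul (hg.continuous.comp continuous_fst).stronglyMeasurable
  refine ⟨hm.aestronglyMeasurable, ?_⟩
  rw [hasFiniteIntegral_iff_enorm, lintegral_prod _ hm.enorm.aemeasurable]
  have hx : ∀ x, ∫⁻ y, ‖inner ℝ (dipole (x - y)) (F y) * g x‖ₑ ≤
      (Metric.ball (0 : E3) R').indicator (fun x => ENNReal.ofReal M *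
        ∫⁻ y in Metric.ball 0 R, ‖dipole (x - y)‖ₑ * ‖F y‖ₑ) x := by
    intro x
    by_cases hx : x ∈ Metric.ball (0 : E3) R'
    · rw [indicator_of_mem hx, ← hF.lintegral_eq fun y => ‖dipole (x - y)‖ₑ,
        ← lintegral_const_mul' _ _ ENNReal.ofReal_ne_top]
      refine lintegral_mono fun y => ?_
      rw [enorm_mul, mul_comm]
      refine mul_le_mul' ?_ ?_
      · rw [← ofReal_norm]
        exact ENNReal.ofReal_le_ofReal (hM x)
      · rw [← ofReal_norm, ← ofReal_norm, ← ofReal_norm, ← ENNReal.ofReal_mul (norm_nonneg _)]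
        exact ENNReal.ofReal_le_ofReal (norm_inner_le_norm _ _)
    · rw [image_eq_zero_of_notMem_tsupport (fun h => hx (hR' h))]
      simp
  refine (lintegral_mono hx).trans_lt ?_
  rw [lintegral_indicator Metric.isOpen_ball.measurableSet,
    lintegral_const_mul' _ _ ENNReal.ofReal_ne_top]
  exact ENNReal.mul_lt_top ENNReal.ofReal_lt_top
    ((lintegral_lintegral_dipole_le (measurable_enorm_Lp F) R R').trans_lt
      (ENNReal.mul_lt_top hCt hF.integrable.2))

/-- The weak form of the equation for `newton F`. -/
lemma SupportedIn.integral_newton_mul {R : ℝ} {F : L2} (hF : SupportedIn R F) {g : E3 → ℝ}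
    (hg : IsTest g) : ∫ x, newton F x * g x = inner ℝ F hg.potGrad := by
  simp only [newton, ← integral_mul_const]
  rw [integral_integral_swap (hF.integrable_dipole_mul hg), IsTest.potGrad, inner_toLp]
  refine integral_congr_ae (ae_of_all _ fun y => ?_)
  simp only []
  rw [real_inner_comm, inner_gradient, fderiv_pot_eq_dipole hg, ← integral_neg,
    ← integral_sub_left_eq_self (fun t => -(inner ℝ (dipole t) (F y) * g (y - t))) volume y]
  refine integral_congr_ae (ae_of_all _ fun x => ?_)
  simp only [sub_sub_cancel]
  rw [← neg_sub x y, dipole_neg, inner_neg_left]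
  ring

/-- The weak gradient of `newton F`. -/
lemma SupportedIn.integral_newton_mul_fderiv {R : ℝ} {F : L2} (hF : SupportedIn R F) {φ : E3 → ℝ}
    (hφ : IsTest φ) (v : E3) : ∫ x, newton F x * fderiv ℝ φ x v =
      -(sphereArea * ∫ x, φ x * inner ℝ (gradProj F x) v) := by
  rw [inner_gradProj_vec hφ v F, neg_neg, hF.integral_newton_mul (hφ.fderiv_apply v)]

/-- For `‖y‖ ≤ ‖x‖ / 2` the lengths satisfy `‖x‖ ≤ 2 ‖x - y‖`. The change of the scalar factor
`‖·‖⁻³` costs `14 = 8 + 4 + 2`, and the change of the vector costs `8`. -/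
lemma norm_dipole_sub_sub_le {x y : E3} (h : 2 * ‖y‖ ≤ ‖x‖) :
    ‖dipole (x - y) - dipole x‖ ≤ 22 * ‖y‖ / ‖x‖ ^ 3 := by
  rcases (norm_nonneg x).eq_or_lt with h0 | h0
  · have hy : y = 0 := by
      have := norm_nonneg y
      exact norm_eq_zero.1 (by linarith)
    simp [hy]
  set a := ‖x‖ with ha
  set b := ‖x - y‖ with hb
  have h1 : a - ‖y‖ ≤ b := norm_sub_norm_le x y
  have h1' : b ≤ a + ‖y‖ := norm_sub_le x y
  have hy := norm_nonneg y
  have hb0 : a / 2 ≤ b := by linarith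
  have hb1 : 0 < b := by linarith
  have h2 : dipole (x - y) - dipole x = ((b ^ 3)⁻¹ - (a ^ 3)⁻¹) • x - (b ^ 3)⁻¹ • y := by
    simp only [dipole, ← ha, ← hb, smul_sub, sub_smul]; abel
  rw [h2]
  have h3 : |(b ^ 3)⁻¹ - (a ^ 3)⁻¹| ≤ 14 * ‖y‖ / a ^ 4 := by
    have e : (b ^ 3)⁻¹ - (a ^ 3)⁻¹ = (a - b) * (a ^ 2 + a * b + b ^ 2) / (a ^ 3 * b ^ 3) := by
      field_simp; ring
    rw [e, abs_div, abs_mul, abs_of_pos (by positivity : 0 < a ^ 3 * b ^ 3),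
      abs_of_pos (by positivity : 0 < a ^ 2 + a * b + b ^ 2)]
    have h4 : |a - b| ≤ ‖y‖ := abs_le.2 ⟨by linarith, by linarith⟩
    have h5 : (a ^ 2 + a * b + b ^ 2) / (a ^ 3 * b ^ 3) ≤ 14 / a ^ 4 := by
      rw [div_le_div_iff₀ (by positivity) (by positivity)]
      have : a * (a ^ 2 + a * b + b ^ 2) ≤ 14 * b ^ 3 := by
        have e1 : a * a ^ 2 ≤ (2 * b) * (2 * b) ^ 2 := by gcongr <;> linarith
        have e2 : a * (a * b) ≤ (2 * b) * ((2 * b) * b) := by gcongr <;> linarith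
        have e3 : a * b ^ 2 ≤ (2 * b) * b ^ 2 := by gcongr; linarith
        nlinarith
      calc _ = a ^ 3 * (a * (a ^ 2 + a * b + b ^ 2)) := by ring
        _ ≤ a ^ 3 * (14 * b ^ 3) := by gcongr
        _ = _ := by ring
    calc _ = |a - b| * ((a ^ 2 + a * b + b ^ 2) / (a ^ 3 * b ^ 3)) := by ring
      _ ≤ ‖y‖ * (14 / a ^ 4) := by gcongr
      _ = _ := by ring
  refine (norm_sub_le _ _).trans ?_
  rw [norm_smul, norm_smul, Real.norm_eq_abs, ← ha, Real.norm_of_nonneg (by positivity)]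
  have h6 : (b ^ 3)⁻¹ ≤ 8 / a ^ 3 := by
    rw [inv_eq_one_div, div_le_div_iff₀ (by positivity) (by positivity)]
    have : a ^ 3 ≤ (2 * b) ^ 3 := by gcongr; linarith
    linarith
  calc _ ≤ 14 * ‖y‖ / a ^ 4 * a + 8 / a ^ 3 * ‖y‖ := by gcongr
    _ = _ := by field_simp; ring

/-- Leading term of the multipole expansion: the kernel is frozen at `y = 0`, with an error one
order smaller. -/
lemma newton_sub_eq {R : ℝ} {F : L2} (hF : SupportedIn R F) {x : E3} (hx : 2 * R ≤ ‖x‖) :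
    |newton F x - ∫ y, inner ℝ (dipole x) (F y)| ≤ 22 * R / ‖x‖ ^ 3 * ∫ y, ‖F y‖ := by
  have hae : ∀ᵐ y, ‖inner ℝ (dipole (x - y) - dipole x) (F y)‖ ≤
      22 * R / ‖x‖ ^ 3 * ‖F y‖ := by
    filter_upwards [hF] with y hy
    by_cases h : y ∈ Metric.ball (0 : E3) R
    · rw [mem_ball_zero_iff] at h
      refine (norm_inner_le_norm _ _).trans ?_
      gcongr
      refine (norm_dipole_sub_sub_le (by linarith)).trans ?_
      gcongr
    · simp [hy h]
  have hi : Integrable fun y => inner ℝ (dipole x) (F y) := hF.integrable.const_inner _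
  have hi2 : Integrable fun y => inner ℝ (dipole (x - y) - dipole x) (F y) := by
    refine (hF.integrable.norm.const_mul _).mono' ?_ hae
    have h2 : StronglyMeasurable fun y : E3 => dipole (x - y) - dipole x :=
      ((measurable_dipole.comp (measurable_const.sub measurable_id)).sub
        measurable_const).stronglyMeasurable
    exact (h2.inner (Lp.stronglyMeasurable F)).aestronglyMeasurable
  have : newton F x - ∫ y, inner ℝ (dipole x) (F y) =
      ∫ y, inner ℝ (dipole (x - y) - dipole x) (F y) := by
    have e : ∀ y, inner ℝ (dipole (x - y)) (F y) = inner ℝ (dipole (x - y) - dipole x) (F y) +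
        inner ℝ (dipole x) (F y) := fun y => by rw [← inner_add_left, sub_add_cancel]
    rw [newton]
    simp only [e]
    rw [integral_add hi2 hi, add_sub_cancel_right]
  rw [this, ← Real.norm_eq_abs, ← integral_const_mul]
  exact norm_integral_le_of_norm_le (hF.integrable.norm.const_mul _) hae

/-! ### The polarization tensor in terms of the total field -/

/-- The constant field `a` on the ball of radius `R`, extended by zero. -/
def ballVec (R : ℝ) : E3 →L[ℝ] L2 :=
  LinearMap.toContinuousLinearMap
    { toFun := fun a => indicatorConstLp 2 (s := Metric.ball (0 : E3) R)
        Metric.isOpen_ball.measurableSet measure_ball_lt_top.ne a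
      map_add' := fun a b => by rw [indicatorConstLp_add]
      map_smul' := fun r a => by
        rw [RingHom.id_apply, indicatorConstLp, indicatorConstLp, ← MemLp.toLp_const_smul]
        congr 1; ext1 x; simp [indicator] }

lemma coeFn_ballVec (R : ℝ) (a : E3) :
    ballVec R a =ᵐ[volume] (Metric.ball (0 : E3) R).indicator fun _ => a :=
  indicatorConstLp_coeFn (hs := Metric.isOpen_ball.measurableSet)
    (hμs := measure_ball_lt_top.ne)

lemma SupportedIn.inner_ballVec {R : ℝ} {F : L2} (hF : SupportedIn R F) (a : E3) :
    inner ℝ F (ballVec R a) = ∫ x, inner ℝ (F x) a := by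
  rw [L2.inner_def]
  refine integral_congr_ae ?_
  filter_upwards [hF, coeFn_ballVec R a] with x h1 h2
  rw [h2]
  by_cases hx : x ∈ Metric.ball (0 : E3) R
  · rw [indicator_of_mem hx]
  · rw [indicator_of_notMem hx, h1 hx]; simp

lemma integrable_smul_of_memLp {V : Type*} [NormedAddCommGroup V] [NormedSpace ℝ V]
    {u : E3 → ℝ} {f : E3 → V} {K : Set E3} (hu : MemLp u 2 (volume.restrict K))
    (hf : MemLp f 2 (volume.restrict K)) (hs : ∀ x ∉ K, u x • f x = 0) :
    Integrable fun x => u x • f x := by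
  have h : IntegrableOn (fun x => u x • f x) K := memLp_one_iff_integrable.1 (hf.smul hu)
  refine (integrableOn_iff_integrable_of_support_subset fun x hx => ?_).1 h
  by_contra hK
  exact hx (hs x hK)

lemma integrable_smul_gradient {u : E3 → ℝ} (hu : ∀ K : Set E3, IsCompact K →
    MemLp u 2 (volume.restrict K)) {φ : E3 → ℝ} (hφ : IsTest φ) :
    Integrable fun x => u x • gradient φ x := by
  refine integrable_smul_of_memLp (hu _ hφ.hasCompactSupport_gradient)
    (hφ.memLp_gradient.restrict _) fun x hx => ?_
  rw [image_eq_zero_of_notMem_tsupport hx, smul_zero]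

lemma integrable_test_smul {G : E3 → E3} (hG : ∀ K : Set E3, IsCompact K →
    MemLp G 2 (volume.restrict K)) {φ : E3 → ℝ} (hφ : IsTest φ) :
    Integrable fun x => φ x • G x := by
  refine integrable_smul_of_memLp (hφ.memLp.restrict _) (hG _ hφ.2) fun x hx => ?_
  rw [image_eq_zero_of_notMem_tsupport hx, zero_smul]

lemma hasWeakGrad_iff {u : E3 → ℝ} {G : E3 → E3}
    (hu : ∀ K : Set E3, IsCompact K → MemLp u 2 (volume.restrict K))
    (hG : ∀ K : Set E3, IsCompact K → MemLp G 2 (volume.restrict K)) :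
    HasWeakGrad u G ↔ ∀ φ, IsTest φ → ∀ v : E3,
      ∫ x, u x * fderiv ℝ φ x v = -∫ x, φ x * inner ℝ (G x) v := by
  have e1 : ∀ φ, IsTest φ → ∀ v : E3, ∫ x, u x * fderiv ℝ φ x v =
      inner ℝ v (∫ x, u x • gradient φ x) := by
    intro φ hφ v
    rw [← integral_inner (integrable_smul_gradient hu hφ)]
    refine integral_congr_ae (ae_of_all _ fun x => ?_)
    simp only [inner_smul_right]
    rw [real_inner_comm, inner_gradient]
  have e2 : ∀ φ, IsTest φ → ∀ v : E3, ∫ x, φ x * inner ℝ (G x) v =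
      inner ℝ v (∫ x, φ x • G x) := by
    intro φ hφ v
    rw [← integral_inner (integrable_test_smul hG hφ)]
    simp only [inner_smul_right, real_inner_comm]
  constructor
  · intro h φ hφ v
    rw [e1 φ hφ, e2 φ hφ, h.3 φ hφ.1 hφ.2, inner_neg_right]
  · intro h
    refine ⟨hu, hG, fun φ h1 h2 => ext_inner_left ℝ fun v => ?_⟩
    rw [inner_neg_right, ← e1 φ ⟨h1, h2⟩, ← e2 φ ⟨h1, h2⟩, h φ ⟨h1, h2⟩]

lemma memLp_restrict_of_continuous {V : Type*} [NormedAddCommGroup V]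
    {f : E3 → V} (hf : Continuous f) {K : Set E3} (hK : IsCompact K) {p : ENNReal} :
    MemLp f p (volume.restrict K) := by
  obtain ⟨C, hC⟩ := hK.exists_bound_of_continuousOn hf.continuousOn
  have : IsFiniteMeasure (volume.restrict K) := ⟨by simpa using hK.measure_lt_top⟩
  refine MemLp.of_bound (hf.aestronglyMeasurable.restrict) C ?_
  exact ae_restrict_of_forall_mem hK.measurableSet hC

lemma hasWeakGrad_inner (a : E3) : HasWeakGrad (fun x => inner ℝ a x) fun _ => a := by
  rw [hasWeakGrad_iff (fun K hK => memLp_restrict_of_continuous (by fun_prop) hK)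
    (fun K hK => memLp_restrict_of_continuous (by fun_prop) hK)]
  intro φ hφ v
  have h := integral_mul_fderiv_eq_neg hφ (contDiff_inner_left (n := ∞) a) v
  have h1 : ∀ x, fderiv ℝ (fun x : E3 => inner ℝ a x) x v = inner ℝ a v := fun x => by
    have : HasFDerivAt (fun x : E3 => (inner ℝ a x : ℝ)) (innerSL ℝ a) x :=
      (innerSL ℝ a).hasFDerivAt
    rw [this.fderiv]; rfl
  simp only [h1] at h
  linarith

lemma HasWeakGrad.add {u w : E3 → ℝ} {G H : E3 → E3} (h : HasWeakGrad u G) (h' : HasWeakGrad w H) :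
    HasWeakGrad (fun x => u x + w x) fun x => G x + H x := by
  refine ⟨fun K hK => (h.1 K hK).add (h'.1 K hK), fun K hK => (h.2 K hK).add (h'.2 K hK),
    fun φ h1 h2 => ?_⟩
  have hφ : IsTest φ := ⟨h1, h2⟩
  simp only [add_smul, smul_add]
  rw [integral_add (integrable_smul_gradient h.1 hφ) (integrable_smul_gradient h'.1 hφ),
    integral_add (integrable_test_smul h.2 hφ) (integrable_test_smul h'.2 hφ), h.3 φ h1 h2,
    h'.3 φ h1 h2, neg_add]

lemma HasWeakGrad.const_mul {u : E3 → ℝ} {G : E3 → E3} (h : HasWeakGrad u G) (c : ℝ) :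
    HasWeakGrad (fun x => c * u x) fun x => c • G x := by
  refine ⟨fun K hK => (h.1 K hK).const_mul c, fun K hK => (h.2 K hK).const_smul c,
    fun φ h1 h2 => ?_⟩
  simp only [mul_smul, smul_comm _ c, integral_smul]
  rw [h.3 φ h1 h2, smul_neg]

lemma locallyIntegrable_of_memLp {V : Type*} [NormedAddCommGroup V] {G : E3 → V}
    (hG : ∀ K : Set E3, IsCompact K → MemLp G 2 (volume.restrict K)) : LocallyIntegrable G := by
  rw [locallyIntegrable_iff]
  intro K hK
  have : IsFiniteMeasure (volume.restrict K) := ⟨by simpa using hK.measure_lt_top⟩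
  exact (hG K hK).integrable one_le_two

/-- Both fields have the same integrals against test functions. -/
lemma HasWeakGrad.ae_eq {u : E3 → ℝ} {G H : E3 → E3} (h : HasWeakGrad u G)
    (h' : HasWeakGrad u H) : G =ᵐ[volume] H := by
  refine ae_eq_of_integral_contDiff_smul_eq (locallyIntegrable_of_memLp h.2)
    (locallyIntegrable_of_memLp h'.2) fun φ h1 h2 => ?_
  exact neg_injective ((h.3 φ h1 h2).symm.trans (h'.3 φ h1 h2))

lemma SupportedIn.hasWeakGrad_newton {R : ℝ} {F : L2} (hF : SupportedIn R F) :
    HasWeakGrad (newton F) fun x => sphereArea • gradProj F x := by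
  refine (hasWeakGrad_iff (fun K hK => hF.memLp_newton hK)
    (fun K _ => ((Lp.memLp (gradProj F)).restrict K).const_smul sphereArea)).2 fun φ hφ v => ?_
  rw [hF.integral_newton_mul_fderiv hφ v, ← integral_const_mul]
  congr 1
  refine integral_congr_ae (ae_of_all _ fun x => ?_)
  change sphereArea * (φ x * inner ℝ (gradProj F x) v) =
    φ x * inner ℝ (sphereArea • gradProj F x) v
  rw [inner_smul_left, RCLike.conj_to_real]
  ring

/-- `σ` is a measurable conductivity bounded between positive constants, equal to `s` outside the
ball of radius `R`. -/
structure IsAdmissible (σ : E3 → ℝ) (s l R : ℝ) : Prop where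
  measurable : Measurable σ
  pos : 0 < l
  lower : ∀ x, l ≤ σ x
  upper : ∃ C, ∀ x, σ x ≤ C
  eq_of_notMem : ∀ x ∉ Metric.ball (0 : E3) R, σ x = s

/-- Multiplication by `σ - s`. -/
abbrev contrast (σ : E3 → ℝ) (s : ℝ) : L2 →L[ℝ] L2 :=
  mulOp fun x => (σ x - s) • ContinuousLinearMap.id ℝ E3

variable {σ : E3 → ℝ} {s l R : ℝ}

lemma IsAdmissible.memLp (h : IsAdmissible σ s l R) :
    MemLp (fun x => (σ x - s) • ContinuousLinearMap.id ℝ E3) ⊤ (volume : Measure E3) := by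
  obtain ⟨C, hC⟩ := h.upper
  refine memLp_top_of_norm_le (C := C + |s|) ?_ fun x => ?_
  · exact ((h.measurable.sub_const s).stronglyMeasurable.smul_const _).aestronglyMeasurable
  · rw [norm_smul, Real.norm_eq_abs]
    have h1 : |σ x - s| ≤ C + |s| := by
      refine (abs_sub _ _).trans ?_
      rw [abs_of_pos (h.pos.trans_le (h.lower x))]
      gcongr
      exact hC x
    calc _ ≤ |σ x - s| * 1 := by gcongr; exact ContinuousLinearMap.norm_id_le
      _ ≤ _ := by linarith

lemma IsAdmissible.coeFn_contrast (h : IsAdmissible σ s l R) (F : L2) :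
    contrast σ s F =ᵐ[volume] fun x => (σ x - s) • F x :=
  coeFn_mulOp h.memLp F

lemma IsAdmissible.isElliptic (h : IsAdmissible σ s l R) : IsElliptic s l (contrast σ s) := by
  refine isElliptic_mulOp h.memLp h.pos fun x v => ?_
  rw [smul_apply, ContinuousLinearMap.id_apply, inner_smul_left, real_inner_self_eq_norm_sq,
    RCLike.conj_to_real, ← add_mul]
  have := h.lower x
  gcongr
  linarith

lemma IsAdmissible.supportedIn (h : IsAdmissible σ s l R) (F : L2) :
    SupportedIn R (contrast σ s F) := by
  filter_upwards [h.coeFn_contrast F] with x hx hx'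
  rw [hx, h.eq_of_notMem x hx', sub_self, zero_smul]

/-- The equation says that `s (T - e) + Q T` is orthogonal to the gradient fields, and `T - e` is
itself a gradient field. -/
lemma IsField.gradProj_eq {Q : L2 →L[ℝ] L2} {e T : L2} (h : IsField gradSpace s Q e T) :
    gradProj (Q T) = -(s • (T - e)) := by
  refine Submodule.eq_starProjection_of_mem_of_inner_eq_zero
    (neg_mem (gradSpace.smul_mem s h.1)) fun v hv => ?_
  have := h.2 v hv
  rw [sub_neg_eq_add, inner_add_left, inner_smul_left, RCLike.conj_to_real]
  linarith

/-- Outside the ball the contrast vanishes, so cutting off the background `a` there does not change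
the flux. -/
lemma IsAdmissible.flux_eq (h : IsAdmissible σ s l R) {a : E3} {T g : L2}
    (hT : T = ballVec R a + g) :
    ∀ᵐ x, σ x • (a + g x) = s • (a + g x) + contrast σ s T x := by
  subst hT
  filter_upwards [h.coeFn_contrast (ballVec R a + g), Lp.coeFn_add (ballVec R a) g,
    coeFn_ballVec R a] with x h1 h2 h3
  rw [h1, h2, Pi.add_apply, h3]
  by_cases hx : x ∈ Metric.ball (0 : E3) R
  · rw [indicator_of_mem hx, sub_smul]; abel
  · rw [h.eq_of_notMem x hx]; simp

lemma integral_inner_gradient_eq_zero (a : E3) {φ : E3 → ℝ} (hφ : IsTest φ) :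
    ∫ x, inner ℝ a (gradient φ x) = 0 := by
  have h := integral_mul_fderiv_eq_neg hφ (contDiff_const (c := (1 : ℝ)) (n := ∞)) a
  simp only [fderiv_fun_const, Pi.zero_apply, zero_apply, mul_zero, integral_zero, one_mul] at h
  rw [← neg_eq_zero, h, neg_inj]
  refine integral_congr_ae (ae_of_all _ fun x => ?_)
  change inner ℝ a (gradient φ x) = fderiv ℝ φ x a
  rw [real_inner_comm, inner_gradient]

lemma integrable_inner_gradient (a : E3) {φ : E3 → ℝ} (hφ : IsTest φ) :
    Integrable fun x => inner ℝ a (gradient φ x) :=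
  (memLp_one_iff_integrable.1 hφ.memLp_gradient).const_inner a

/-- The weak form of the conductivity equation for the field `a + g`. -/
lemma IsAdmissible.integral_flux (h : IsAdmissible σ s l R) {a : E3} {g : L2} {φ : E3 → ℝ}
    (hφ : IsTest φ) : ∫ x, σ x * inner ℝ (a + g x) (gradient φ x) =
      s * inner ℝ g hφ.grad + inner ℝ (contrast σ s (ballVec R a + g)) hφ.grad := by
  have e : ∀ᵐ x, σ x * inner ℝ (a + g x) (gradient φ x) =
      s * inner ℝ a (gradient φ x) + (s * inner ℝ (g x) (gradient φ x) +
        inner ℝ (contrast σ s (ballVec R a + g) x) (gradient φ x)) := by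
    filter_upwards [h.flux_eq (g := g) (a := a) rfl] with x hx
    have := congrArg (fun w => inner ℝ w (gradient φ x)) hx
    simp only [inner_add_left, inner_smul_left, RCLike.conj_to_real] at this ⊢
    linarith
  have i1 := integrable_inner_of_memLp hφ.memLp_gradient g
  have i2 := integrable_inner_of_memLp hφ.memLp_gradient (contrast σ s (ballVec R a + g))
  have i3 : Integrable fun x => s * inner ℝ (g x) (gradient φ x) +
        inner ℝ (contrast σ s (ballVec R a + g) x) (gradient φ x) := (i1.const_mul s).add i2
  rw [integral_congr_ae e, integral_add ((integrable_inner_gradient a hφ).const_mul s) i3, integral_add (i1.const_mul s) i2, integral_const_mul,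
    integral_inner_gradient_eq_zero a hφ, mul_zero, zero_add, integral_const_mul, IsTest.grad,
    inner_toLp, inner_toLp]

lemma eventually_atInfinity (r : ℝ) : ∀ᶠ x in atInfinity, r ≤ ‖x‖ :=
  ((tendsto_norm_cobounded_atTop (E := E3)).eventually_ge_atTop r).filter_mono inf_le_left

lemma SupportedIn.newton_isBigO {F : L2} (hF : SupportedIn R F) :
    newton F =O[atInfinity] fun x => (‖x‖ ^ 2)⁻¹ := by
  have hI : 0 ≤ ∫ y, ‖F y‖ := integral_nonneg fun y => norm_nonneg _
  have h4 : ∀ x, |∫ y, inner ℝ (dipole x) (F y)| ≤ (‖x‖ ^ 2)⁻¹ * ∫ y, ‖F y‖ := fun x => by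
    rw [← norm_dipole, ← integral_const_mul, ← Real.norm_eq_abs]
    exact norm_integral_le_of_norm_le (hF.integrable.norm.const_mul _)
      (ae_of_all _ fun y => norm_inner_le_norm _ _)
  have h3 : ∀ x : E3, 2 * R ≤ ‖x‖ → _ := fun x hx => newton_sub_eq hF hx
  generalize ∫ y, ‖F y‖ = I at hI h3 h4
  refine IsBigO.of_bound (22 * |R| * I + I) ?_
  filter_upwards [eventually_atInfinity (2 * R), eventually_atInfinity 1] with x h1 h2
  have h5 : 22 * R / ‖x‖ ^ 3 ≤ 22 * |R| * (‖x‖ ^ 2)⁻¹ := by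
    rw [div_eq_mul_inv]
    gcongr
    · exact le_abs_self R
    · norm_num
  rw [Real.norm_eq_abs, norm_inv, norm_pow, norm_norm]
  have h6 := abs_sub_abs_le_abs_sub (newton F x) (∫ y, inner ℝ (dipole x) (F y))
  have h7 := mul_le_mul_of_nonneg_right h5 hI
  linarith [h3 x h1, h4 x]

/-- The hypothesis says that the integral of `F` is zero; hence the leading multipole term
disappears and only the remainder of order `|x|⁻³` is left. -/
lemma SupportedIn.newton_isBigO_of_integral_eq_zero {F : L2} (hF : SupportedIn R F)
    (h0 : ∀ v, inner ℝ F (ballVec R v) = 0) :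
    newton F =O[atInfinity] fun x => (‖x‖ ^ 3)⁻¹ := by
  refine IsBigO.of_bound (22 * R * ∫ y, ‖F y‖) ?_
  filter_upwards [eventually_atInfinity (2 * R)] with x h1
  have h3 := newton_sub_eq hF h1
  have h4 : ∫ y, inner ℝ (dipole x) (F y) = 0 := by
    rw [← h0 (dipole x), hF.inner_ballVec]
    exact integral_congr_ae (ae_of_all _ fun y => real_inner_comm _ _)
  rw [h4, sub_zero] at h3
  rw [Real.norm_eq_abs, norm_inv, norm_pow, norm_norm]
  refine h3.trans (le_of_eq ?_)
  rw [div_eq_mul_inv]; ring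

/-- The solution of the conductivity problem given by the total field. -/
lemma IsAdmissible.isSolution (h : IsAdmissible σ s l R) (hs : s ≠ 0) {a : E3} {T : L2}
    (hT : IsField gradSpace s (contrast σ s) (ballVec R a) T) :
    IsSolution σ a fun x => inner ℝ a x + -(sphereArea * s)⁻¹ * newton (contrast σ s T) x := by
  have hF := h.supportedIn T
  set g := T - ballVec R a with hg
  have hT' : ballVec R a + g = T := by rw [hg]; abel
  have hP : gradProj (contrast σ s T) = (-s) • g := by rw [hT.gradProj_eq, neg_smul]
  refine ⟨⟨fun x => a + g x, ?_, fun φ h1 h2 => ?_⟩, ?_⟩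
  · have h1 := (hasWeakGrad_inner a).add (hF.hasWeakGrad_newton.const_mul (-(sphereArea * s)⁻¹))
    have h2 : ∀ᵐ x, (-(sphereArea * s)⁻¹) • sphereArea • gradProj (contrast σ s T) x = g x := by
      rw [hP]
      filter_upwards [Lp.coeFn_smul (-s) g] with x hx
      rw [hx, Pi.smul_apply, smul_smul, smul_smul]
      -- The weak gradient of `newton F` is `|S²|` times the projection of `F`, and the projection
      -- of the polarization is `-s g`; the prefactor of the solution normalizes their product.
      have : -(sphereArea * s)⁻¹ * sphereArea * -s = 1 := by
        have := sphereArea_pos.ne'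
        field_simp
      rw [this, one_smul]
    refine ⟨h1.1, fun K hK => (memLp_congr_ae ?_).1 (h1.2 K hK), fun φ h3 h4 => ?_⟩
    · filter_upwards [ae_restrict_of_ae h2] with x hx
      rw [hx]
    · rw [h1.3 φ h3 h4]
      congr 1
      refine integral_congr_ae ?_
      filter_upwards [h2] with x hx
      rw [hx]
  · rw [h.integral_flux ⟨h1, h2⟩, hT']
    exact hT.2 _ (IsTest.grad_mem ⟨h1, h2⟩)
  · simp only [add_sub_cancel_left]
    exact hF.newton_isBigO.const_mul_left _

/-! ### Uniqueness for the conductivity problem -/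

/-- In three dimensions `|x|⁻²` is square integrable near infinity. Thus the decay condition places
the perturbation in L², where Poisson's equation has only one solution. -/
lemma memLp_two_of_isBigO {w : E3 → ℝ} (hw : ∀ K : Set E3, IsCompact K →
    MemLp w 2 (volume.restrict K)) (h : w =O[atInfinity] fun x => (‖x‖ ^ 2)⁻¹) : MemLp w 2 := by
  obtain ⟨C, hC0, hC⟩ := h.exists_pos
  rw [isBigOWith_iff, atInfinity, eventually_inf] at hC
  obtain ⟨t, ht, t', ht', hC⟩ := hC
  obtain ⟨r, hr⟩ := (Bornology.isBounded_def.2 (by rwa [compl_compl]) :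
    Bornology.IsBounded tᶜ).subset_closedBall (0 : E3)
  set K := Metric.closedBall (0 : E3) (max r 1) with hK
  have hKc : IsCompact K := isCompact_closedBall _ _
  have hb : MemLp (fun x => ‖K.indicator w x‖ + 4 * C * ((1 + ‖x‖) ^ 2)⁻¹) 2 :=
    ((memLp_indicator_iff_restrict hKc.measurableSet).2 (hw K hKc)).norm.add
      (memLp_decay.const_mul _)
  refine hb.mono' (locallyIntegrable_of_memLp hw).aestronglyMeasurable ?_
  filter_upwards [ht'] with x hx
  by_cases hxK : x ∈ K
  · rw [indicator_of_mem hxK]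
    have : 0 ≤ 4 * C * ((1 + ‖x‖) ^ 2)⁻¹ := by positivity
    linarith
  · rw [hK, mem_closedBall_zero_iff, not_le, max_lt_iff] at hxK
    have hxt : x ∈ t := by
      by_contra hxt
      have := hr hxt
      rw [mem_closedBall_zero_iff] at this
      linarith
    have h1 := hC x ⟨hxt, hx⟩
    rw [norm_inv, norm_pow, norm_norm] at h1
    have h2 : (‖x‖ ^ 2)⁻¹ ≤ 4 * ((1 + ‖x‖) ^ 2)⁻¹ := by
      rw [← div_eq_mul_inv, inv_eq_one_div, div_le_div_iff₀ (by nlinarith) (by positivity)]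
      nlinarith
    have h3 := norm_nonneg (K.indicator w x)
    have h4 := mul_le_mul_of_nonneg_left h2 hC0.le
    linarith

lemma integrable_inner_gradient_of_memLp {G : E3 → E3} (hG : ∀ K : Set E3, IsCompact K →
    MemLp G 2 (volume.restrict K)) {φ : E3 → ℝ} (hφ : IsTest φ) :
    Integrable fun x => inner ℝ (G x) (gradient φ x) := by
  have h1 : ∀ x, inner ℝ (G x) (gradient φ x) =
      ∑ i, fderiv ℝ φ x (stdB i) * inner ℝ (G x) (stdB i) := fun x => by
    rw [← stdB.sum_inner_mul_inner]
    refine Finset.sum_congr rfl fun i _ => ?_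
    rw [real_inner_comm (gradient φ x), inner_gradient, mul_comm]
  simp only [h1]
  refine integrable_finsetSum _ fun i _ => ?_
  have := (integrable_test_smul hG (hφ.fderiv_apply (stdB i))).inner_const (𝕜 := ℝ) (stdB i)
  simpa only [inner_smul_left, RCLike.conj_to_real] using this

lemma HasWeakGrad.integral_mul_lap {w : E3 → ℝ} {H : E3 → E3} (h : HasWeakGrad w H) {φ : E3 → ℝ}
    (hφ : IsTest φ) : ∫ x, w x * lap φ x = -∫ x, inner ℝ (H x) (gradient φ x) := by
  have h1 : ∀ x, inner ℝ (H x) (gradient φ x) =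
      ∑ i, fderiv ℝ φ x (stdB i) * inner ℝ (H x) (stdB i) := fun x => by
    rw [← stdB.sum_inner_mul_inner]
    refine Finset.sum_congr rfl fun i _ => ?_
    rw [real_inner_comm (gradient φ x), inner_gradient, mul_comm]
  simp only [h1, lap, Finset.mul_sum]
  rw [integral_finsetSum, integral_finsetSum, ← Finset.sum_neg_distrib]
  · exact Finset.sum_congr rfl fun i _ =>
      (hasWeakGrad_iff h.1 h.2).1 h _ (hφ.fderiv_apply (stdB i)) (stdB i)
  · intro i _
    have := (integrable_test_smul h.2 (hφ.fderiv_apply (stdB i))).inner_const (𝕜 := ℝ) (stdB i)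
    simpa only [inner_smul_left, RCLike.conj_to_real] using this
  · intro i _
    have ht := (hφ.fderiv_apply (stdB i)).fderiv_apply (stdB i)
    exact integrable_smul_of_memLp (h.1 _ ht.2) (ht.memLp.restrict _) fun x hx => by
      rw [image_eq_zero_of_notMem_tsupport hx, smul_zero]

variable {σ : E3 → ℝ} {s l R : ℝ}

lemma IsAdmissible.memLp_smul (h : IsAdmissible σ s l R) {G : E3 → E3}
    (hG : ∀ K : Set E3, IsCompact K → MemLp G 2 (volume.restrict K)) :
    MemLp (fun x => (σ x - s) • G x) 2 := by
  obtain ⟨C, hC⟩ := h.upper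
  set K := Metric.closedBall (0 : E3) R with hK
  have hKc : IsCompact K := isCompact_closedBall _ _
  have h1 : MemLp (K.indicator G) 2 :=
    (memLp_indicator_iff_restrict hKc.measurableSet).2 (hG K hKc)
  have h2 : (fun x => (σ x - s) • G x) = fun x => (σ x - s) • K.indicator G x := by
    ext1 x
    by_cases hx : x ∈ K
    · rw [indicator_of_mem hx]
    · rw [h.eq_of_notMem x fun hx' => hx (Metric.ball_subset_closedBall hx'), sub_self, zero_smul,
        zero_smul]
  rw [h2]
  refine h1.of_le_mul (c := C + |s|) ?_ (ae_of_all _ fun x => ?_)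
  · exact (h.measurable.sub_const s).stronglyMeasurable.aestronglyMeasurable.smul h1.1
  · rw [norm_smul]
    gcongr
    refine (abs_sub _ _).trans ?_
    rw [abs_of_pos (h.pos.trans_le (h.lower x))]
    gcongr
    exact hC x

lemma SupportedIn.const_smul {F : L2} (hF : SupportedIn R F) (c : ℝ) : SupportedIn R (c • F) := by
  filter_upwards [hF, Lp.coeFn_smul c F] with x h1 h2 hx
  rw [h2, Pi.smul_apply, h1 hx, smul_zero]

/-- Every solution of the conductivity problem is given by the total field. -/
lemma IsAdmissible.solution_eq (h : IsAdmissible σ s l R) (hs : s ≠ 0) {a : E3} {u : E3 → ℝ}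
    (hu : IsSolution σ a u) : ∃ T, IsField gradSpace s (contrast σ s) (ballVec R a) T ∧
      ∀ᵐ x, u x - inner ℝ a x = sphereArea⁻¹ * newton ((-s⁻¹) • contrast σ s T) x := by
  obtain ⟨⟨G, hG, hflux⟩, hO⟩ := hu
  set w : E3 → ℝ := fun x => u x - inner ℝ a x with hw
  have hwH : HasWeakGrad w fun x => G x - a := by
    have := hG.add ((hasWeakGrad_inner a).const_mul (-1))
    simpa only [neg_one_mul, neg_one_smul, ← sub_eq_add_neg] using this
  have hw2 := memLp_two_of_isBigO hwH.1 hO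
  have hf := h.memLp_smul hG.2
  set F : L2 := hf.toLp _ with hF
  have hFx : F =ᵐ[volume] fun x => (σ x - s) • G x := hf.coeFn_toLp
  have hFs : SupportedIn R F := by
    filter_upwards [hFx] with x hx hx'
    rw [hx, h.eq_of_notMem x hx', sub_self, zero_smul]
  -- The conductivity equation, rewritten as `Δ w = div(-s⁻¹ (σ - s) ∇u)`, has a compactly supported
  -- source field on the right.
  have hpoisson : ∀ φ, IsTest φ →
      ∫ x, w x * lap φ x = -∫ x, inner ℝ (((-s⁻¹) • F : L2) x) (gradient φ x) := by
    intro φ hφ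
    rw [hwH.integral_mul_lap hφ]
    have hi := integrable_inner_gradient_of_memLp hG.2 hφ
    have e1 : ∫ x, inner ℝ (G x - a) (gradient φ x) = ∫ x, inner ℝ (G x) (gradient φ x) := by
      simp only [inner_sub_left]
      rw [integral_sub hi (integrable_inner_gradient a hφ), integral_inner_gradient_eq_zero a hφ,
        sub_zero]
    have e2 : ∫ x, σ x * inner ℝ (G x) (gradient φ x) =
        ∫ x, (s * inner ℝ (G x) (gradient φ x) + inner ℝ (F x) (gradient φ x)) := by
      refine integral_congr_ae ?_
      filter_upwards [hFx] with x hx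
      rw [hx, inner_smul_left, RCLike.conj_to_real]; ring
    have e3 : ∫ x, inner ℝ (((-s⁻¹) • F : L2) x) (gradient φ x) =
        ∫ x, -s⁻¹ * inner ℝ (F x) (gradient φ x) := by
      refine integral_congr_ae ?_
      filter_upwards [Lp.coeFn_smul (-s⁻¹) F] with x hx
      rw [hx, Pi.smul_apply, inner_smul_left, RCLike.conj_to_real]
    rw [hflux φ hφ.1 hφ.2, integral_add (hi.const_mul s)
      (integrable_inner_of_memLp hφ.memLp_gradient F), integral_const_mul] at e2
    rw [e1, e3, integral_const_mul]
    field_simp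
    linarith
  -- The gradient of `w` is only known to be locally square integrable. The representation of L²
  -- solutions identifies it with a projection, so it is globally in L² and belongs to `gradSpace`.
  have hgrad : HasWeakGrad w (gradProj ((-s⁻¹) • F)) :=
    (hasWeakGrad_iff hwH.1 fun K _ => (Lp.memLp _).restrict K).2 fun φ hφ v =>
      integral_mul_fderiv_of_poisson hw2 hpoisson hφ v
  have hGa := hwH.ae_eq hgrad
  set T : L2 := ballVec R a + gradProj ((-s⁻¹) • F) with hT
  have hQT : contrast σ s T = F := by
    rw [Lp.ext_iff]
    filter_upwards [h.coeFn_contrast T, hFx, hGa, coeFn_ballVec R a,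
      Lp.coeFn_add (ballVec R a) (gradProj ((-s⁻¹) • F))] with x h1 h2 h3 h4 h5
    rw [h1, h2, h5, Pi.add_apply, h4, ← h3]
    by_cases hx : x ∈ Metric.ball (0 : E3) R
    · rw [indicator_of_mem hx, add_sub_cancel]
    · rw [h.eq_of_notMem x hx, sub_self, zero_smul, zero_smul]
  refine ⟨T, ⟨?_, fun v hv => ?_⟩, ?_⟩
  · rw [hT, add_sub_cancel_left]
    exact Submodule.starProjection_apply_mem _ _
  · rw [hQT, hT, add_sub_cancel_left, Submodule.inner_starProjection_left_eq_right,
      Submodule.starProjection_eq_self_iff.2 hv, inner_smul_left, RCLike.conj_to_real]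
    field_simp
    ring
  · rw [hQT]
    have hFs' := hFs.const_smul (-s⁻¹)
    -- Both sides have the same integrals against test functions, because both are determined by
    -- pairing the source with gradients of potentials.
    refine ae_eq_of_integral_contDiff_smul_eq (locallyIntegrable_of_memLp hwH.1)
      ((locallyIntegrable_of_memLp fun K hK => hFs'.memLp_newton hK).smul sphereArea⁻¹)
      fun φ h1 h2 => ?_
    have hφ : IsTest φ := ⟨h1, h2⟩
    have e1 := integral_mul_of_poisson hw2 hpoisson hφ
    have e2 := hFs'.integral_newton_mul hφ
    have e3 : ∫ x, φ x • (sphereArea⁻¹ • newton ((-s⁻¹) • F)) x =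
        sphereArea⁻¹ * ∫ x, newton ((-s⁻¹) • F) x * φ x := by
      rw [← integral_const_mul]
      refine integral_congr_ae (ae_of_all _ fun x => ?_)
      simp only [Pi.smul_apply, smul_eq_mul]; ring
    refine Eq.trans ?_ e3.symm
    rw [e2, ← e1, inv_mul_cancel_left₀ sphereArea_pos.ne']
    exact integral_congr_ae (ae_of_all _ fun x => mul_comm _ _)

/-- The polarization tensor vanishes if the polarization form of the total fields does. -/
lemma IsAdmissible.isPolarizationTensor_zero (h : IsAdmissible σ s l R) (hs : s ≠ 0)
    (hM : ∀ a v, inner ℝ (contrast σ s (fieldOp gradSpace s (contrast σ s) (ballVec R a)))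
      (ballVec R v) = 0) : IsPolarizationTensor σ 0 := by
  intro a _
  refine ⟨⟨_, h.isSolution hs (isField_fieldOp h.isElliptic _)⟩, fun u hu => ?_⟩
  obtain ⟨T, hT, hu'⟩ := h.solution_eq hs hu
  have hT' := hT.unique h.isElliptic (isField_fieldOp h.isElliptic _)
  have hO := ((h.supportedIn T).const_smul (-s⁻¹)).newton_isBigO_of_integral_eq_zero fun v => by
    rw [inner_smul_left, hT', hM, mul_zero]
  refine (hO.const_mul_left sphereArea⁻¹).congr' ?_ EventuallyEq.rfl
  filter_upwards [(inf_le_right : atInfinity ≤ ae volume) hu'] with x hx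
  rw [← hx]; simp

/-! ### The variational principle for the polarization form -/

section Abstract

variable {H : Type*} [NormedAddCommGroup H] [InnerProductSpace ℝ H]
  {X : Submodule ℝ H} {s l : ℝ} {Q : H →L[ℝ] H} {e T : H}

/-- The energy of the field `e + g`. -/
def energy (s : ℝ) (Q : H →L[ℝ] H) (e g : H) : ℝ := s * ‖g‖ ^ 2 + inner ℝ (Q (e + g)) (e + g)

lemma continuous_energy (s : ℝ) (Q : H →L[ℝ] H) (e : H) : Continuous (energy s Q e) := by
  unfold energy
  fun_prop

lemma IsField.energy_eq (h : IsField X s Q e T) : energy s Q e (T - e) = inner ℝ (Q T) e := by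
  have h1 := h.2 _ h.1
  rw [inner_sub_right (Q T), real_inner_self_eq_norm_sq] at h1
  rw [energy, add_sub_cancel]
  linarith

/-- For `g = (T - e) + w` the terms linear in `w` vanish by the equation, and the quadratic
remainder is nonnegative by ellipticity. The polarization form is therefore a minimum of energies.
-/
lemma IsField.le_energy (hl : IsElliptic s l Q) (hQ : ∀ v w, inner ℝ (Q v) w = inner ℝ v (Q w))
    (h : IsField X s Q e T) {g : H} (hg : g ∈ X) : inner ℝ (Q T) e ≤ energy s Q e g := by
  obtain ⟨w, hw⟩ : ∃ w, w = g - (T - e) := ⟨_, rfl⟩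
  have hwX : w ∈ X := hw ▸ X.sub_mem hg h.1
  have hg' : g = (T - e) + w := by rw [hw]; abel
  have h1 := h.2 _ hwX
  have h2 := hl.2 w
  have h3 : 0 ≤ l * ‖w‖ ^ 2 := by have := hl.1; positivity
  rw [← h.energy_eq, energy, energy, hg', add_sub_cancel, ← add_assoc, add_sub_cancel,
    ← real_inner_self_eq_norm_sq, ← real_inner_self_eq_norm_sq, map_add]
  rw [← real_inner_self_eq_norm_sq] at h2 h3
  simp only [inner_add_left, inner_add_right]
  rw [real_inner_comm w (T - e), hQ w T, real_inner_comm w (Q T)] at *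
  nlinarith [real_inner_comm w (T - e), real_inner_comm w (Q T)]

end Abstract

/-- Gradients of test functions are dense and the energy is continuous. It is therefore enough to
match each smooth trial field for `Q'` by one for `Q` with no larger energy, without mapping
`gradSpace` itself. -/
lemma inner_le_inner_of_energy_le {s l : ℝ} {Q Q' : L2 →L[ℝ] L2} {e e' T T' : L2}
    (hl : IsElliptic s l Q) (hQ : ∀ v w, inner ℝ (Q v) w = inner ℝ v (Q w))
    (hT : IsField gradSpace s Q e T) (hT' : IsField gradSpace s Q' e' T')
    (h : ∀ (φ : E3 → ℝ) (hφ : IsTest φ), ∃ (ψ : E3 → ℝ) (hψ : IsTest ψ),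
      energy s Q e hψ.grad ≤ energy s Q' e' hφ.grad) :
    inner ℝ (Q T) e ≤ inner ℝ (Q' T') e' := by
  rw [← hT'.energy_eq]
  have hc : IsClosed {g | inner ℝ (Q T) e ≤ energy s Q' e' g} :=
    isClosed_le continuous_const (continuous_energy s Q' e')
  refine closure_minimal ?_ hc hT'.1
  rintro G ⟨φ, hφ, hG⟩
  obtain ⟨ψ, hψ, hle⟩ := h φ hφ
  have hG' : G = hφ.grad := by
    rw [Lp.ext_iff]
    exact hG.trans hφ.memLp_gradient.coeFn_toLp.symm
  rw [hG']
  exact (hT.le_energy hl hQ hψ.grad_mem).trans hle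

/-! ### Transport of conductivities by diffeomorphisms -/

/-- Multiplication by `A - s`. -/
abbrev matContrast (A : E3 → E3 →L[ℝ] E3) (s : ℝ) : L2 →L[ℝ] L2 :=
  mulOp fun x => A x - s • ContinuousLinearMap.id ℝ E3

/-- The energy is the physical energy of `a + ∇φ` minus that of the background. The two densities
differ by the cross term `2 s ⟪a, ∇φ⟫`, whose integral is zero. A ball also containing the support
of the gradient makes the formula suitable for a change of variables. -/
lemma energy_matContrast {A : E3 → E3 →L[ℝ] E3} {s R R' : ℝ}
    (hA : MemLp (fun x => A x - s • ContinuousLinearMap.id ℝ E3) ⊤ (volume : Measure E3))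
    (hAs : ∀ x ∉ Metric.ball (0 : E3) R, A x = s • ContinuousLinearMap.id ℝ E3) (hR : R ≤ R')
    (a : E3) {φ : E3 → ℝ} (hφ : IsTest φ) (hφR : ∀ x ∉ Metric.ball (0 : E3) R', gradient φ x = 0) :
    IntegrableOn (fun x => inner ℝ (A x (a + gradient φ x)) (a + gradient φ x) - s * ‖a‖ ^ 2)
      (Metric.ball 0 R') ∧
    energy s (matContrast A s) (ballVec R a) hφ.grad =
      ∫ x in Metric.ball 0 R',
        (inner ℝ (A x (a + gradient φ x)) (a + gradient φ x) - s * ‖a‖ ^ 2) := by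
  have hg : (hφ.grad : E3 → E3) =ᵐ[volume] gradient φ := hφ.memLp_gradient.coeFn_toLp
  have e1 : energy s (matContrast A s) (ballVec R a) hφ.grad =
      ∫ x, (s * inner ℝ (hφ.grad x) (hφ.grad x) +
        inner ℝ ((A x - s • ContinuousLinearMap.id ℝ E3) ((ballVec R a + hφ.grad) x))
          ((ballVec R a + hφ.grad) x)) := by
    rw [energy, inner_mulOp hA, ← real_inner_self_eq_norm_sq, L2.inner_def, integral_add,
      integral_const_mul]
    · exact (L2.integrable_inner (𝕜 := ℝ) _ _).const_mul s
    · exact integrable_inner_mul hA _ _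
  have e2 : ∀ᵐ x, s * inner ℝ (hφ.grad x) (hφ.grad x) +
        inner ℝ ((A x - s • ContinuousLinearMap.id ℝ E3) ((ballVec R a + hφ.grad) x))
          ((ballVec R a + hφ.grad) x) + 2 * s * inner ℝ a (gradient φ x) =
      (Metric.ball (0 : E3) R').indicator (fun x =>
        (inner ℝ (A x (a + gradient φ x)) (a + gradient φ x) - s * ‖a‖ ^ 2)) x := by
    filter_upwards [hg, coeFn_ballVec R a, Lp.coeFn_add (ballVec R a) hφ.grad] with x h1 h2 h3
    rw [h3, Pi.add_apply, h2, h1]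
    by_cases hx' : x ∈ Metric.ball (0 : E3) R'
    · rw [indicator_of_mem hx']
      by_cases hx : x ∈ Metric.ball (0 : E3) R
      · rw [indicator_of_mem hx]
        simp only [sub_apply, smul_apply, ContinuousLinearMap.id_apply, inner_sub_left,
          inner_smul_left, inner_add_left, inner_add_right, RCLike.conj_to_real,
          ← real_inner_self_eq_norm_sq]
        rw [real_inner_comm a (gradient φ x)]
        ring
      · rw [indicator_of_notMem hx, hAs x hx]
        simp only [sub_self, zero_apply, inner_zero_left, smul_apply, ContinuousLinearMap.id_apply,
          inner_smul_left, inner_add_left, inner_add_right, RCLike.conj_to_real,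
          ← real_inner_self_eq_norm_sq]
        rw [real_inner_comm a (gradient φ x)]
        ring
    · have hx : x ∉ Metric.ball (0 : E3) R := fun h => hx' (Metric.ball_subset_ball hR h)
      rw [indicator_of_notMem hx', hφR x hx', hAs x hx]
      simp
  have i1 : Integrable fun x => s * inner ℝ (hφ.grad x) (hφ.grad x) +
      inner ℝ ((A x - s • ContinuousLinearMap.id ℝ E3) ((ballVec R a + hφ.grad) x))
        ((ballVec R a + hφ.grad) x) :=
    ((L2.integrable_inner (𝕜 := ℝ) _ _).const_mul s).add (integrable_inner_mul hA _ _)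
  have i2 := (integrable_inner_gradient a hφ).const_mul (2 * s)
  refine ⟨(integrable_indicator_iff Metric.isOpen_ball.measurableSet).1 ((i1.add i2).congr e2), ?_⟩
  rw [e1, ← integral_indicator Metric.isOpen_ball.measurableSet, ← integral_congr_ae e2,
    integral_add i1 i2, integral_const_mul, integral_inner_gradient_eq_zero a hφ, mul_zero,
    add_zero]

/-- The pull-back of a test function under a diffeomorphism, with the correction of the linear
function `⟪a, ·⟫`. -/
def pullTest (Φ : E3 → E3) (a : E3) (φ : E3 → ℝ) (y : E3) : ℝ := φ (Φ y) + inner ℝ a (Φ y - y)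

section Transport

variable {Φ : E3 ≃ₜ E3} {R : ℝ}

lemma image_ball_of_eq_id (hid : ∀ y ∉ Metric.ball (0 : E3) R, Φ y = y) {R' : ℝ} (hR : R ≤ R') :
    Φ '' Metric.ball 0 R' = Metric.ball 0 R' := by
  have hs : ∀ y ∉ Metric.ball (0 : E3) R', Φ y = y := fun y hy =>
    hid y fun h => hy (Metric.ball_subset_ball hR h)
  ext y
  constructor
  · rintro ⟨x, hx, rfl⟩
    by_contra hy
    rw [Φ.injective (hs _ hy)] at hy
    exact hy hx
  · intro hy
    obtain ⟨x, rfl⟩ := Φ.surjective y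
    by_contra hx
    have : x ∉ Metric.ball (0 : E3) R' := fun h => hx ⟨x, h, rfl⟩
    exact this (hs x this ▸ hy)

lemma IsTest.exists_ball {φ : E3 → ℝ} (hφ : IsTest φ) (R : ℝ) : ∃ R', R ≤ R' ∧
    ∀ x ∉ Metric.ball (0 : E3) R', x ∉ tsupport φ := by
  obtain ⟨r, hr⟩ := (hφ.2 : IsCompact _).isBounded.subset_ball (0 : E3)
  refine ⟨max R r, le_max_left _ _, fun x hx h => hx ?_⟩
  exact Metric.ball_subset_ball (le_max_right _ _) (hr h)

lemma isTest_pullTest (hΦ : ContDiff ℝ ∞ Φ) (hid : ∀ y ∉ Metric.ball (0 : E3) R, Φ y = y)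
    (a : E3) {φ : E3 → ℝ} (hφ : IsTest φ) : IsTest (pullTest Φ a φ) := by
  refine ⟨(hφ.1.comp hΦ).add ((contDiff_inner_left a).comp (hΦ.sub contDiff_id)), ?_⟩
  obtain ⟨R', hR', h0⟩ := hφ.exists_ball R
  refine HasCompactSupport.intro (isCompact_closedBall (0 : E3) R') fun y hy => ?_
  have hy' : y ∉ Metric.ball (0 : E3) R' := fun h => hy (Metric.ball_subset_closedBall h)
  have : Φ y = y := hid y fun h => hy' (Metric.ball_subset_ball hR' h)
  simp [pullTest, this, image_eq_zero_of_notMem_tsupport (h0 y hy')]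

/-- Chain rule for `(⟪a, ·⟫ + φ) ∘ Φ`, of which the left side is the gradient. The correction in
`pullTest` ensures that the background stays `a`. -/
lemma add_gradient_pullTest (hΦ : ContDiff ℝ ∞ Φ) (a : E3) {φ : E3 → ℝ} (hφ : IsTest φ) (y : E3) :
    a + gradient (pullTest Φ a φ) y =
      ContinuousLinearMap.adjoint (fderiv ℝ Φ y) (a + gradient φ (Φ y)) := by
  refine ext_inner_right ℝ fun v => ?_
  have h1 : HasFDerivAt Φ (fderiv ℝ Φ y) y :=
    (hΦ.differentiable (by simp) y).hasFDerivAt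
  have h2 : HasFDerivAt (fun y => φ (Φ y)) ((fderiv ℝ φ (Φ y)).comp (fderiv ℝ Φ y)) y :=
    (hφ.contDiff_one.differentiable one_ne_zero (Φ y)).hasFDerivAt.comp (f := Φ) y h1
  have h3 : HasFDerivAt (fun y => (inner ℝ a (Φ y - y) : ℝ))
      ((innerSL ℝ a).comp (fderiv ℝ Φ y - ContinuousLinearMap.id ℝ E3)) y :=
    (innerSL ℝ a).hasFDerivAt.comp (f := fun y => Φ y - y) y (h1.sub (hasFDerivAt_id y))
  have h4 : fderiv ℝ (pullTest Φ a φ) y = _ := (h2.add h3).fderiv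
  rw [inner_add_left, inner_gradient, h4, ContinuousLinearMap.adjoint_inner_left, inner_add_left,
    inner_gradient]
  simp only [add_apply, ContinuousLinearMap.comp_apply, sub_apply, ContinuousLinearMap.id_apply,
    innerSL_apply_apply, inner_sub_right]
  ring

/-- Pulling back by the inverse diffeomorphism undoes the operation, so the trial functions on both
sides are in bijection. -/
lemma exists_pullTest_eq (hΦs : ContDiff ℝ ∞ Φ.symm)
    (hid : ∀ y ∉ Metric.ball (0 : E3) R, Φ y = y)
    (a : E3) {ψ : E3 → ℝ} (hψ : IsTest ψ) : ∃ φ, IsTest φ ∧ pullTest Φ a φ = ψ := by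
  have hid' : ∀ y ∉ Metric.ball (0 : E3) R, Φ.symm y = y := fun y hy => by
    rw [Homeomorph.symm_apply_eq, hid y hy]
  refine ⟨pullTest Φ.symm a ψ, isTest_pullTest hΦs hid' a hψ, ?_⟩
  ext y
  simp [pullTest, inner_sub_right]
  ring

variable {σ : E3 → ℝ} {s l : ℝ}

/-- Change of variables. The subtracted background energy is not transported pointwise; its defect
is a multiple of `∫ (|det DΦ| - 1)`, which vanishes because `Φ` maps the large ball onto itself. -/
lemma energy_pullTest (hΦ : ContDiff ℝ ∞ Φ)
    (hid : ∀ y ∉ Metric.ball (0 : E3) R, Φ y = y) (hσ : IsAdmissible σ s l R)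
    {A : E3 → E3 →L[ℝ] E3}
    (hA : MemLp (fun x => A x - s • ContinuousLinearMap.id ℝ E3) ⊤ (volume : Measure E3))
    (hAs : ∀ x ∉ Metric.ball (0 : E3) R, A x = s • ContinuousLinearMap.id ℝ E3)
    (hAσ : ∀ y w, inner ℝ (A y (ContinuousLinearMap.adjoint (fderiv ℝ Φ y) w))
      (ContinuousLinearMap.adjoint (fderiv ℝ Φ y) w) =
        |(fderiv ℝ Φ y).det| * (σ (Φ y) * ‖w‖ ^ 2))
    (a : E3) {φ : E3 → ℝ} (hφ : IsTest φ) :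
    energy s (matContrast A s) (ballVec R a) (isTest_pullTest hΦ hid a hφ).grad =
      energy s (contrast σ s) (ballVec R a) hφ.grad := by
  have hψ := isTest_pullTest hΦ hid a hφ
  obtain ⟨R₁, hR₁, h₁⟩ := hφ.exists_ball R
  obtain ⟨R₂, hR₂, h₂⟩ := hψ.exists_ball R₁
  have hg : ∀ {f : E3 → ℝ} {x : E3}, x ∉ tsupport f → gradient f x = 0 := fun h =>
    gradient_eq_zero_of_fderiv (fderiv_of_notMem_tsupport (𝕜 := ℝ) h)
  have hsub : (fun x => (σ x - s) • ContinuousLinearMap.id ℝ E3) = fun x =>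
      σ x • ContinuousLinearMap.id ℝ E3 - s • ContinuousLinearMap.id ℝ E3 :=
    funext fun x => ContinuousLinearMap.ext fun v => by
      simp only [smul_apply, sub_apply, ContinuousLinearMap.id_apply, sub_smul]
  have hc : contrast σ s = matContrast (fun x => σ x • ContinuousLinearMap.id ℝ E3) s :=
    congrArg mulOp hsub
  have hm := hσ.memLp
  rw [hsub] at hm
  obtain ⟨i1, e1⟩ := energy_matContrast hm (fun x hx => by rw [hσ.eq_of_notMem x hx])
    (hR₁.trans hR₂) a hφ fun x hx => hg (h₁ x fun h => hx (Metric.ball_subset_ball hR₂ h))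
  obtain ⟨i2, e2⟩ := energy_matContrast hA hAs (hR₁.trans hR₂) a hψ fun x hx => hg (h₂ x hx)
  have hb : MeasurableSet (Metric.ball (0 : E3) R₂) := Metric.isOpen_ball.measurableSet
  have himg := image_ball_of_eq_id hid (hR₁.trans hR₂)
  have hd : ∀ x ∈ Metric.ball (0 : E3) R₂,
      HasFDerivWithinAt Φ (fderiv ℝ Φ x) (Metric.ball (0 : E3) R₂) x := fun x _ =>
    (hΦ.differentiable (by simp) x).hasFDerivAt.hasFDerivWithinAt
  have hinj : InjOn Φ (Metric.ball (0 : E3) R₂) := Φ.injective.injOn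
  have d0 : IntegrableOn (fun _ => (1 : ℝ)) (Metric.ball (0 : E3) R₂) :=
    integrableOn_const measure_ball_lt_top.ne
  have d1 : ∫ x in Metric.ball (0 : E3) R₂, |(fderiv ℝ Φ x).det| =
      ∫ x in Metric.ball (0 : E3) R₂, (1 : ℝ) := by
    have := integral_image_eq_integral_abs_det_fderiv_smul volume hb hd hinj fun _ => (1 : ℝ)
    rw [himg] at this
    simpa using this.symm
  have d2 : IntegrableOn (fun x => |(fderiv ℝ Φ x).det|) (Metric.ball (0 : E3) R₂) := by
    have := (integrableOn_image_iff_integrableOn_abs_det_fderiv_smul volume hb hd hinj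
      fun _ => (1 : ℝ)).1 (by rwa [himg])
    simpa using this
  have d3 := integral_image_eq_integral_abs_det_fderiv_smul volume hb hd hinj fun x =>
    inner ℝ ((σ x • ContinuousLinearMap.id ℝ E3) (a + gradient φ x)) (a + gradient φ x) -
      s * ‖a‖ ^ 2
  rw [himg] at d3
  rw [hc, e1, e2, d3]
  have e3 : ∀ y, inner ℝ (A y (a + gradient (pullTest Φ a φ) y))
      (a + gradient (pullTest Φ a φ) y) - s * ‖a‖ ^ 2 =
      |(fderiv ℝ Φ y).det| • (inner ℝ ((σ (Φ y) • ContinuousLinearMap.id ℝ E3)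
        (a + gradient φ (Φ y))) (a + gradient φ (Φ y)) - s * ‖a‖ ^ 2) +
      s * ‖a‖ ^ 2 * (|(fderiv ℝ Φ y).det| - 1) := by
    intro y
    rw [add_gradient_pullTest hΦ a hφ, hAσ, smul_apply, ContinuousLinearMap.id_apply,
      inner_smul_left, real_inner_self_eq_norm_sq, RCLike.conj_to_real, smul_eq_mul]
    ring
  simp only [e3]
  rw [integral_add, integral_const_mul, integral_sub d2 d0, d1, sub_self, mul_zero, add_zero]
  · rw [← himg] at i1
    exact (integrableOn_image_iff_integrableOn_abs_det_fderiv_smul volume hb hd hinj _).1 i1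
  · exact (d2.sub d0).const_mul _

/-- The polarization form is invariant under the transport by a diffeomorphism. -/
lemma polarization_transport (hΦ : ContDiff ℝ ∞ Φ) (hΦs : ContDiff ℝ ∞ Φ.symm)
    (hid : ∀ y ∉ Metric.ball (0 : E3) R, Φ y = y) (hσ : IsAdmissible σ s l R)
    {A : E3 → E3 →L[ℝ] E3}
    (hA : MemLp (fun x => A x - s • ContinuousLinearMap.id ℝ E3) ⊤ (volume : Measure E3))
    (hAs : ∀ x ∉ Metric.ball (0 : E3) R, A x = s • ContinuousLinearMap.id ℝ E3)
    (hsym : ∀ x v w, inner ℝ (A x v) w = inner ℝ v (A x w)) {l' : ℝ}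
    (hell : IsElliptic s l' (matContrast A s))
    (hAσ : ∀ y w, inner ℝ (A y (ContinuousLinearMap.adjoint (fderiv ℝ Φ y) w))
      (ContinuousLinearMap.adjoint (fderiv ℝ Φ y) w) =
        |(fderiv ℝ Φ y).det| * (σ (Φ y) * ‖w‖ ^ 2)) (a : E3) :
    inner ℝ (contrast σ s (fieldOp gradSpace s (contrast σ s) (ballVec R a))) (ballVec R a) =
    inner ℝ (matContrast A s (fieldOp gradSpace s (matContrast A s) (ballVec R a)))
      (ballVec R a) := by
  have s1 : ∀ v w, inner ℝ (contrast σ s v) w = inner ℝ v (contrast σ s w) :=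
    mulOp_symm hσ.memLp fun x v w => by simp [inner_smul_left, inner_smul_right]
  have s2 : ∀ v w, inner ℝ (matContrast A s v) w = inner ℝ v (matContrast A s w) :=
    mulOp_symm hA fun x v w => by
      simp [inner_smul_left, inner_smul_right, inner_sub_left, inner_sub_right, hsym]
  have f1 := isField_fieldOp (X := gradSpace) hσ.isElliptic (ballVec R a)
  have f2 := isField_fieldOp (X := gradSpace) hell (ballVec R a)
  refine le_antisymm ?_ ?_
  · refine inner_le_inner_of_energy_le hσ.isElliptic s1 f1 f2 fun ψ hψ => ?_
    obtain ⟨φ, hφ, rfl⟩ := exists_pullTest_eq hΦs hid a hψ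
    exact ⟨φ, hφ, (energy_pullTest hΦ hid hσ hA hAs hAσ a hφ).ge⟩
  · refine inner_le_inner_of_energy_le hell s2 f2 f1 fun φ hφ => ?_
    exact ⟨_, isTest_pullTest hΦ hid a hφ, (energy_pullTest hΦ hid hσ hA hAs hAσ a hφ).le⟩

end Transport

/-! ### The neutral coated ball -/

/-- The function `w` solves `Δ w = div G` in L², so its gradient `G` equals its own projection. -/
lemma mem_gradSpace_of_hasWeakGrad {w : E3 → ℝ} {G : L2} (h : HasWeakGrad w G)
    (hw : MemLp w 2) : G ∈ gradSpace := by
  have h1 : HasWeakGrad w (gradProj G) :=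
    (hasWeakGrad_iff h.1 fun K _ => (Lp.memLp _).restrict K).2 fun φ hφ v =>
      integral_mul_fderiv_of_poisson hw (fun φ hφ => h.integral_mul_lap hφ) hφ v
  have h2 : G = gradProj G := Lp.ext_iff.2 (h.ae_eq h1)
  rw [h2]
  exact Submodule.starProjection_apply_mem _ _

/-- The data of a coated ball satisfying the neutrality condition. -/
structure CoatedBall where
  (σc σs σm ri re : ℝ)
  σc_pos : 0 < σc
  σs_pos : 0 < σs
  σm_pos : 0 < σm
  ri_pos : 0 < ri
  ri_lt_re : ri < re
  neutral : (2 * σs + σc) * (σm - σs) + (ri / re) ^ 3 * (σs - σc) * (2 * σs + σm) = 0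

namespace CoatedBall

variable (P : CoatedBall)

lemma re_pos : 0 < P.re := P.ri_pos.trans P.ri_lt_re

/-- The coefficient of the linear part of the field in the shell. -/
def α : ℝ := (2 * P.σs + P.σm) / (3 * P.σs)

/-- The coefficient of the dipole part of the field in the shell. -/
def β : ℝ := P.re ^ 3 * (P.σs - P.σm) / (3 * P.σs)

lemma α_add_β : P.α + P.β / P.re ^ 3 = 1 := by
  have := P.σs_pos; have := P.re_pos
  unfold α β
  field_simp; ring

lemma flux_outer : P.σs * (P.α - 2 * P.β / P.re ^ 3) = P.σm := by
  have := P.σs_pos; have := P.re_pos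
  unfold α β
  field_simp; ring

/-- Continuity of the potential and of the flux at the outer sphere already determine `α` and `β`
for an exterior field equal to `a`. The flux condition at the inner sphere is then exactly the
neutrality condition. -/
lemma flux_inner : P.σs * (P.α - 2 * P.β / P.ri ^ 3) = P.σc * (P.α + P.β / P.ri ^ 3) := by
  have h1 := P.σs_pos; have h2 := P.re_pos; have h3 := P.ri_pos
  have h := P.neutral
  unfold α β
  field_simp at h ⊢
  linarith

/-- The reciprocal cube of the radius, clamped to the shell. -/
def g (r : ℝ) : ℝ := (max P.ri (min r P.re) ^ 3)⁻¹

/-- The indicator function of the shell. -/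
def χ (r : ℝ) : ℝ := if P.ri ≤ r ∧ r < P.re then 1 else 0

/-- The radial conductivity. -/
def sg (r : ℝ) : ℝ := if r < P.ri then P.σc else if r < P.re then P.σs else P.σm

/-- The tangential part of the field. -/
def f (r : ℝ) : ℝ := P.α + P.β * P.g r

/-- The radial part of the field. -/
def c (r : ℝ) : ℝ := P.f r - 3 * P.β * (P.χ r * P.g r)

/-- The radial part of the flux. -/
def k (r : ℝ) : ℝ := P.σs * (P.α - 2 * P.β * P.g r)

lemma continuous_g : Continuous P.g := by
  unfold g
  refine Continuous.inv₀ (by fun_prop) fun r => ?_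
  have := P.ri_pos
  have : 0 < max P.ri (min r P.re) := lt_max_of_lt_left this
  positivity

lemma continuous_f : Continuous P.f := by
  have := P.continuous_g
  unfold f; fun_prop

lemma continuous_k : Continuous P.k := by
  have := P.continuous_g
  unfold k; fun_prop

lemma measurable_χ : Measurable P.χ :=
  Measurable.ite (measurableSet_Ici.inter measurableSet_Iio) measurable_const measurable_const

lemma measurable_sg : Measurable P.sg :=
  Measurable.ite measurableSet_Iio measurable_const
    (Measurable.ite measurableSet_Iio measurable_const measurable_const)

lemma measurable_c : Measurable P.c :=
  P.continuous_f.measurable.sub ((P.measurable_χ.mul P.continuous_g.measurable).const_mul _)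

lemma abs_χ_le (r : ℝ) : |P.χ r| ≤ 1 := by
  unfold χ; split_ifs <;> simp

lemma abs_sg_le (r : ℝ) : |P.sg r| ≤ P.σc + P.σs + P.σm := by
  have h1 := P.σc_pos; have h2 := P.σs_pos; have h3 := P.σm_pos
  unfold sg; split_ifs <;> rw [abs_of_pos (by assumption)] <;> linarith

lemma g_of_le {r : ℝ} (h : r ≤ P.ri) : P.g r = (P.ri ^ 3)⁻¹ := by
  rw [g, max_eq_left ((min_le_left _ _).trans h)]

lemma g_of_mem {r : ℝ} (h : P.ri ≤ r) (h' : r ≤ P.re) : P.g r = (r ^ 3)⁻¹ := by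
  rw [g, min_eq_left h', max_eq_right h]

lemma g_of_ge {r : ℝ} (h : P.re ≤ r) : P.g r = (P.re ^ 3)⁻¹ := by
  rw [g, min_eq_right h, max_eq_right P.ri_lt_re.le]

/-- Although the conductivity and the radial field both jump, their product is the continuous `k`:
this encodes the two flux conditions. -/
lemma sg_mul_c (r : ℝ) : P.sg r * P.c r = P.k r := by
  unfold sg c k χ f
  have h1 := P.flux_inner
  have h2 := P.flux_outer
  have h3 := P.α_add_β
  simp only [div_eq_mul_inv] at h1 h2 h3
  split_ifs with h h' h' h'' h''
  · linarith [h'.1]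
  · rw [P.g_of_le h.le]; linarith
  · ring
  · exact absurd ⟨not_lt.1 h, h'⟩ h''
  · exact absurd h''.2 h'
  · rw [P.g_of_ge (not_lt.1 h')]
    rw [h3]; linarith

lemma f_of_ge {r : ℝ} (h : P.re ≤ r) : P.f r = 1 := by
  rw [f, P.g_of_ge h, ← div_eq_mul_inv, P.α_add_β]

lemma c_of_ge {r : ℝ} (h : P.re ≤ r) : P.c r = 1 := by
  rw [c, P.f_of_ge h, χ, if_neg fun h' => absurd h (not_le.2 h'.2)]; ring

lemma hasDerivAt_g {r : ℝ} (h1 : r ≠ P.ri) (h2 : r ≠ P.re) (hr : 0 < r) :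
    HasDerivAt P.g (-3 * P.χ r * P.g r / r) r := by
  unfold χ
  rcases lt_or_gt_of_ne h1 with h | h
  · have : P.g =ᶠ[𝓝 r] fun _ => (P.ri ^ 3)⁻¹ := by
      filter_upwards [Iio_mem_nhds h] with x hx using P.g_of_le (le_of_lt hx)
    rw [if_neg fun h' => absurd h (not_lt.2 h'.1)]
    simpa using (hasDerivAt_const r _).congr_of_eventuallyEq this
  · rcases lt_or_gt_of_ne h2 with h' | h'
    · have : P.g =ᶠ[𝓝 r] fun x => (x ^ 3)⁻¹ := by
        filter_upwards [Ioo_mem_nhds h h'] with x hx using P.g_of_mem hx.1.le hx.2.le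
      rw [if_pos ⟨h.le, h'⟩]
      refine (((hasDerivAt_pow 3 r).inv (by positivity)).congr_of_eventuallyEq this).congr_deriv ?_
      rw [P.g_of_mem h.le h'.le]
      field_simp
      norm_num
      ring
    · have : P.g =ᶠ[𝓝 r] fun _ => (P.re ^ 3)⁻¹ := by
        filter_upwards [Ioi_mem_nhds h'] with x hx using P.g_of_ge (le_of_lt hx)
      rw [if_neg fun h'' => absurd h' (not_lt.2 h''.2.le)]
      simpa using (hasDerivAt_const r _).congr_of_eventuallyEq this

/-- Equivalently `(r f)' = c`: the field with radial part `c` and tangential part `f` is the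
gradient of `f(|x|) ⟪a, x⟫`. -/
lemma hasDerivAt_f {r : ℝ} (h1 : r ≠ P.ri) (h2 : r ≠ P.re) (hr : 0 < r) :
    HasDerivAt P.f ((P.c r - P.f r) / r) r := by
  refine (((P.hasDerivAt_g h1 h2 hr).const_mul P.β).const_add P.α).congr_deriv ?_
  rw [c]; ring

/-- This is the radial form of the vanishing of the divergence of the flux. -/
lemma hasDerivAt_sq_mul_k {r : ℝ} (h1 : r ≠ P.ri) (h2 : r ≠ P.re) (hr : 0 < r) :
    HasDerivAt (fun r => r ^ 2 * P.k r) (2 * (r * (P.sg r * P.f r))) r := by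
  have h := (hasDerivAt_pow 2 r).fun_mul
    ((((P.hasDerivAt_g h1 h2 hr).const_mul (2 * P.β)).const_sub P.α).const_mul P.σs)
  refine h.congr_deriv ?_
  have e : P.sg r * P.f r = P.k r + P.sg r * (3 * P.β * (P.χ r * P.g r)) := by
    rw [← P.sg_mul_c, c]; ring
  have e2 : P.sg r * P.χ r = P.σs * P.χ r := by
    unfold sg χ
    split_ifs with a b b c c
    · linarith [b.1]
    · ring
    · rfl
    · ring
    · linarith [c.2]
    · ring
  have e3 : P.sg r * P.f r = P.k r + 3 * P.β * (P.σs * P.χ r * P.g r) := by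
    rw [e, ← e2]; ring
  rw [e3, k]
  field_simp
  norm_num
  ring

/-- The field in and around the coated ball, for the exterior field `a`. -/
def U (a x : E3) : E3 := P.f ‖x‖ • a + ((P.c ‖x‖ - P.f ‖x‖) * (inner ℝ a x / ‖x‖ ^ 2)) • x

lemma U_smul (a : E3) (p : S2) {r : ℝ} (hr : 0 < r) :
    P.U a (r • (p : E3)) = (P.c r * inner ℝ a (p : E3)) • (p : E3) + P.f r • tangentProj p a := by
  rw [U, norm_smul_S2 p hr.le, tangentProj_apply, inner_smul_right, real_inner_comm a (p : E3),
    smul_smul, smul_sub, smul_smul]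
  have : (P.c r - P.f r) * (r * inner ℝ (p : E3) a / r ^ 2) * r =
      (P.c r - P.f r) * inner ℝ (p : E3) a := by field_simp
  rw [real_inner_comm (p : E3) a, this, sub_mul, sub_smul]
  abel

lemma measurable_U (a : E3) : Measurable (P.U a) := by
  have h1 : Measurable fun x : E3 => P.f ‖x‖ := P.continuous_f.measurable.comp measurable_norm
  have h2 : Measurable fun x : E3 => P.c ‖x‖ := P.measurable_c.comp measurable_norm
  unfold U
  fun_prop

lemma U_of_ge (a : E3) {x : E3} (h : P.re ≤ ‖x‖) : P.U a x = a := by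
  rw [U, P.f_of_ge h, P.c_of_ge h]; simp

lemma exists_bound_U : ∃ C, 0 ≤ C ∧ ∀ a x, ‖P.U a x‖ ≤ C * ‖a‖ := by
  obtain ⟨M, hM⟩ := (isCompact_Icc (a := (0 : ℝ)) (b := P.re)).exists_bound_of_continuousOn
    P.continuous_f.continuousOn
  obtain ⟨M', hM'⟩ := (isCompact_Icc (a := (0 : ℝ)) (b := P.re)).exists_bound_of_continuousOn
    P.continuous_g.continuousOn
  have h0 : (0 : ℝ) ∈ Icc 0 P.re := ⟨le_rfl, P.re_pos.le⟩
  have hM0 : 0 ≤ M := (norm_nonneg _).trans (hM 0 h0)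
  have hM0' : 0 ≤ M' := (norm_nonneg _).trans (hM' 0 h0)
  refine ⟨1 + M + 3 * |P.β| * M', by positivity, fun a x => ?_⟩
  rcases le_or_gt P.re ‖x‖ with h | h
  · rw [P.U_of_ge a h]
    have : 0 ≤ (M + 3 * |P.β| * M') * ‖a‖ := by positivity
    linarith
  · have hx : ‖x‖ ∈ Icc 0 P.re := ⟨norm_nonneg _, h.le⟩
    have h1 := hM _ hx
    have h2 := hM' _ hx
    rw [Real.norm_eq_abs] at h1 h2
    have h3 : |P.c ‖x‖ - P.f ‖x‖| ≤ 3 * |P.β| * M' := by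
      have e : P.c ‖x‖ - P.f ‖x‖ = -(3 * P.β * (P.χ ‖x‖ * P.g ‖x‖)) := by rw [c]; ring
      rw [e, abs_neg, abs_mul, abs_mul, abs_mul, abs_of_pos (by norm_num : (0 : ℝ) < 3)]
      gcongr
      calc _ ≤ 1 * M' := by gcongr; exact P.abs_χ_le _
        _ = M' := one_mul _
    have h4 : |inner ℝ a x / ‖x‖ ^ 2| * ‖x‖ ≤ ‖a‖ := by
      rw [abs_div, abs_of_nonneg (by positivity : 0 ≤ ‖x‖ ^ 2)]
      rcases (norm_nonneg x).eq_or_lt with h0 | h0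
      · rw [← h0]; simp
      · have := abs_real_inner_le_norm a x
        rw [div_mul_eq_mul_div, div_le_iff₀ (by positivity)]
        nlinarith
    rw [U]
    refine (norm_add_le _ _).trans ?_
    rw [norm_smul, norm_smul, Real.norm_eq_abs, Real.norm_eq_abs, abs_mul, mul_assoc]
    calc _ ≤ M * ‖a‖ + 3 * |P.β| * M' * ‖a‖ := by gcongr
      _ ≤ _ := by linarith [norm_nonneg a]

end CoatedBall

/-! ### The weak equation for the neutral coated ball -/

namespace CoatedBall

variable (P : CoatedBall)

lemma integrableOn_mul_Ioc {u v : ℝ → ℝ} (hu : Continuous u) (hv : Measurable v) {C : ℝ}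
    (hC : ∀ r, |v r| ≤ C) (b : ℝ) : IntegrableOn (fun r => v r * u r) (Ioc 0 b) := by
  have h1 : IntegrableOn u (Ioc 0 b) := (hu.integrableOn_Icc).mono_set Ioc_subset_Icc_self
  exact Integrable.bdd_mul (c := C) h1 hv.aestronglyMeasurable (ae_of_all _ hC)

/-- The conductivity of the coated ball. -/
def σ0 (x : E3) : ℝ := P.sg ‖x‖

lemma measurable_σ0 : Measurable P.σ0 := P.measurable_sg.comp measurable_norm

lemma integral_σ0_inner_U (a : E3) {φ : E3 → ℝ} (hφ : IsTest φ) :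
    ∫ x, P.σ0 x * inner ℝ (P.U a x) (gradient φ x) = 0 := by
  have h := integral_fderiv_radialField (F := fun r => r ^ 2 * P.k r)
    (F' := fun r => 2 * (r * (P.sg r * P.f r))) (G := fun r => P.sg r * (r * P.f r))
    (s := {P.ri, P.re}) (Set.toFinite _).countable
    (by have := P.continuous_k; fun_prop)
    (fun r hr => P.hasDerivAt_sq_mul_k (fun h => hr.2 (by simp [h])) (fun h => hr.2 (by simp [h]))
      hr.1)
    (fun b => by
      have := integrableOn_mul_Ioc (u := fun r => 2 * (r * P.f r))
        (by have := P.continuous_f; fun_prop) P.measurable_sg P.abs_sg_le b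
      refine this.congr_fun (fun r _ => ?_) measurableSet_Ioc
      simp only []; ring)
    (fun b => integrableOn_mul_Ioc (by have := P.continuous_f; fun_prop) P.measurable_sg
      P.abs_sg_le b)
    (n := fun p => inner ℝ a (p : E3)) (by fun_prop) (q := fun _ => 1) contDiff_const a
    (Z := fun x => P.σ0 x • P.U a x)
    (P.measurable_σ0.smul (P.measurable_U a)).aestronglyMeasurable
    (fun p r hr => by
      rw [P.U_smul a p hr, σ0, norm_smul_S2 p hr.le, smul_add, smul_smul, smul_smul, ← mul_assoc,
        P.sg_mul_c]
      congr 2 <;> field_simp)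
    (ζ := fun _ => 0) aestronglyMeasurable_const
    (fun p r hr _ => by
      simp only [fderiv_fun_const, real_inner_comm]
      simp; ring) hφ.contDiff_one hφ.2
  simp only [zero_mul, integral_zero, sub_zero, ne_eq, OfNat.ofNat_ne_zero, not_false_eq_true,
    zero_pow, neg_zero] at h
  rw [← h]
  refine integral_congr_ae (ae_of_all _ fun x => ?_)
  simp only [map_smul, smul_eq_mul]
  rw [real_inner_comm, inner_gradient]

/-- The perturbation potential. -/
def w (a x : E3) : ℝ := (P.f ‖x‖ - 1) * inner ℝ a x

lemma continuous_w (a : E3) : Continuous (P.w a) := by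
  have := P.continuous_f
  unfold w; fun_prop

lemma w_of_ge (a : E3) {x : E3} (h : P.re ≤ ‖x‖) : P.w a x = 0 := by
  rw [w, P.f_of_ge h, sub_self, zero_mul]

lemma hasCompactSupport_w (a : E3) : HasCompactSupport (P.w a) := by
  refine HasCompactSupport.intro (isCompact_closedBall (0 : E3) P.re) fun x hx => ?_
  rw [mem_closedBall_zero_iff, not_le] at hx
  exact P.w_of_ge a hx.le

lemma memLp_U_sub (a : E3) : MemLp (fun x => P.U a x - a) 2 := by
  obtain ⟨C, -, hC⟩ := P.exists_bound_U
  have hm : MeasurableSet (Metric.ball (0 : E3) P.re) := Metric.isOpen_ball.measurableSet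
  have h : MemLp ((Metric.ball (0 : E3) P.re).indicator fun _ => C * ‖a‖ + ‖a‖) 2 :=
    memLp_indicator_const 2 hm _ (Or.inr measure_ball_lt_top.ne)
  refine h.mono' ((P.measurable_U a).sub_const a).aestronglyMeasurable (ae_of_all _ fun x => ?_)
  by_cases hx : x ∈ Metric.ball (0 : E3) P.re
  · rw [indicator_of_mem hx]
    exact (norm_sub_le _ _).trans (by gcongr; exact hC a x)
  · rw [indicator_of_notMem hx]
    rw [mem_ball_zero_iff, not_lt] at hx
    rw [P.U_of_ge a hx, sub_self, norm_zero]

/-- The potential is continuous across both spheres, so its distributional gradient has no surface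
part; the formula for weak divergences applies to `w v` with continuous radial profile `r³ (f - 1)`.
-/
lemma hasWeakGrad_w (a : E3) : HasWeakGrad (P.w a) fun x => P.U a x - a := by
  refine (hasWeakGrad_iff (fun K hK => memLp_restrict_of_continuous (P.continuous_w a) hK)
    fun K _ => (P.memLp_U_sub a).restrict K).2 fun φ hφ v => ?_
  have h := integral_fderiv_radialField (F := fun r => r ^ 3 * (P.f r - 1))
    (F' := fun r => r ^ 2 * (2 * (P.f r - 1) + (P.c r - 1))) (G := fun r => r ^ 2 * (P.f r - 1))
    (s := {P.ri, P.re}) (Set.toFinite _).countable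
    (by have := P.continuous_f; fun_prop)
    (fun r hr => by
      have h1 := (hasDerivAt_pow 3 r).fun_mul ((P.hasDerivAt_f (fun h => hr.2 (by simp [h]))
        (fun h => hr.2 (by simp [h])) hr.1).sub_const 1)
      refine h1.congr_deriv ?_
      have : 0 < r := hr.1
      field_simp
      norm_num
      ring)
    (fun b => by
      have h1 : IntegrableOn (fun r => r ^ 2 * (3 * (P.f r - 1))) (Ioc 0 b) := by
        have := P.continuous_f
        exact (Continuous.integrableOn_Icc (by fun_prop)).mono_set Ioc_subset_Icc_self
      have h2 := integrableOn_mul_Ioc (u := fun r => r ^ 2 * (3 * P.β * P.g r))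
        (by have := P.continuous_g; fun_prop) P.measurable_χ P.abs_χ_le b
      refine (h1.sub h2).congr_fun (fun r _ => ?_) measurableSet_Ioc
      simp only [c, Pi.sub_apply]; ring)
    (fun b => by
      have := P.continuous_f
      exact (Continuous.integrableOn_Icc (by fun_prop)).mono_set Ioc_subset_Icc_self)
    (n := fun p => inner ℝ a (p : E3) * inner ℝ (p : E3) v) (by fun_prop)
    (q := fun x => inner ℝ a x) (contDiff_inner_left a) v
    (Z := fun x => P.w a x • v)
    (by have := P.continuous_w a; fun_prop)
    (fun p r hr => by
      rw [w, norm_smul_S2 p hr.le, inner_smul_right]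
      conv_lhs => rw [inner_decomp_tangentProj p v]
      rw [smul_add, smul_smul]
      congr 2 <;> field_simp)
    (ζ := fun x => inner ℝ (P.U a x - a) v)
    (by have := P.measurable_U a; fun_prop)
    (fun p r hr _ => by
      have : HasFDerivAt (fun x : E3 => (inner ℝ a x : ℝ)) (innerSL ℝ a) (p : E3) :=
        (innerSL ℝ a).hasFDerivAt
      rw [this.fderiv, innerSL_apply_apply, P.U_smul a p hr, tangentProj_apply, tangentProj_apply]
      simp only [inner_sub_left, inner_add_left, inner_smul_left, inner_sub_right,
        inner_smul_right, RCLike.conj_to_real]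
      rw [real_inner_comm (p : E3) a]
      ring) hφ.contDiff_one hφ.2
  simp only [map_smul, smul_eq_mul, ne_eq, OfNat.ofNat_ne_zero, not_false_eq_true, zero_pow,
    zero_mul, neg_zero, zero_sub] at h
  rw [h]
  simp only [mul_comm]

/-- The difference of the field and the exterior field as an element of `L²`. -/
def corr (a : E3) : L2 := (P.memLp_U_sub a).toLp _

lemma coeFn_corr (a : E3) : P.corr a =ᵐ[volume] fun x => P.U a x - a :=
  (P.memLp_U_sub a).coeFn_toLp

lemma hasWeakGrad_corr (a : E3) : HasWeakGrad (P.w a) (P.corr a) := by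
  have h := P.hasWeakGrad_w a
  refine ⟨h.1, fun K _ => (Lp.memLp _).restrict K, fun φ h1 h2 => ?_⟩
  rw [h.3 φ h1 h2, neg_inj]
  refine integral_congr_ae ?_
  filter_upwards [P.coeFn_corr a] with x hx
  rw [hx]

lemma corr_mem (a : E3) : P.corr a ∈ gradSpace :=
  mem_gradSpace_of_hasWeakGrad (P.hasWeakGrad_corr a)
    ((P.continuous_w a).memLp_of_hasCompactSupport (P.hasCompactSupport_w a))

/-- The ellipticity constant. -/
def lam : ℝ := min P.σc (min P.σs P.σm)

lemma lam_pos : 0 < P.lam := lt_min P.σc_pos (lt_min P.σs_pos P.σm_pos)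

lemma lam_le_sg (r : ℝ) : P.lam ≤ P.sg r := by
  unfold lam sg
  split_ifs
  · exact min_le_left _ _
  · exact (min_le_right _ _).trans (min_le_left _ _)
  · exact (min_le_right _ _).trans (min_le_right _ _)

variable {R : ℝ}

lemma isAdmissible_σ0 (hR : P.re ≤ R) : IsAdmissible P.σ0 P.σm P.lam R where
  measurable := P.measurable_σ0
  pos := P.lam_pos
  lower x := P.lam_le_sg _
  upper := ⟨_, fun x => (le_abs_self _).trans (P.abs_sg_le _)⟩
  eq_of_notMem x hx := by
    rw [mem_ball_zero_iff, not_lt] at hx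
    have h1 := hR.trans hx
    rw [σ0, sg, if_neg (not_lt.2 (P.ri_lt_re.le.trans h1)), if_neg (not_lt.2 h1)]

/-- The total field of the coated ball. -/
def total (R : ℝ) (a : E3) : L2 := ballVec R a + P.corr a

lemma coeFn_total (a : E3) :
    ∀ᵐ x, x ∈ Metric.ball (0 : E3) R → P.total R a x = P.U a x := by
  filter_upwards [Lp.coeFn_add (ballVec R a) (P.corr a), P.coeFn_corr a, coeFn_ballVec R a]
    with x h1 h2 h3 hx
  rw [total, h1, Pi.add_apply, h2, h3, indicator_of_mem hx, add_sub_cancel]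

/-- The correction belongs to `gradSpace`, being the gradient of a compactly supported potential,
and the flux of `U` has zero weak divergence. Orthogonality to test gradients extends to their
closure. -/
lemma isField_total (hR : P.re ≤ R) (a : E3) :
    IsField gradSpace P.σm (contrast P.σ0 P.σm) (ballVec R a) (P.total R a) := by
  have ht : P.total R a - ballVec R a = P.corr a := by rw [total]; abel
  have hmem : P.σm • P.corr a + contrast P.σ0 P.σm (P.total R a) ∈ gradSpaceᗮ := by
    rw [mem_gradSpace_orthogonal_iff]
    intro φ hφ
    rw [← inner_toLp hφ.memLp_gradient]
    change inner ℝ _ hφ.grad = 0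
    rw [inner_add_left, inner_smul_left, RCLike.conj_to_real, total,
      ← (P.isAdmissible_σ0 hR).integral_flux hφ, ← P.integral_σ0_inner_U a hφ]
    refine integral_congr_ae ?_
    filter_upwards [P.coeFn_corr a] with x hx
    rw [hx, add_sub_cancel]
  refine ⟨by rw [ht]; exact P.corr_mem a, fun v hv => ?_⟩
  have := (Submodule.mem_orthogonal' _ _).1 hmem v hv
  rwa [inner_add_left, inner_smul_left, RCLike.conj_to_real, ← ht] at this

/-- The correction is the gradient of a potential with compact support, so its mean is zero; a
cutoff equal to `1` near that support serves as test function. -/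
lemma integral_inner_corr (a v : E3) : ∫ x, inner ℝ (P.corr a x) v = 0 := by
  obtain ⟨n, hn⟩ := exists_nat_gt P.re
  have h := (hasWeakGrad_iff (P.hasWeakGrad_corr a).1 (P.hasWeakGrad_corr a).2).1
    (P.hasWeakGrad_corr a) _ (isTest_cutoff n) v
  have h1 : ∀ x, P.w a x * fderiv ℝ (cutoff n) x v = 0 := by
    intro x
    rcases lt_or_ge ‖x‖ P.re with hx | hx
    · have : cutoff n =ᶠ[𝓝 x] fun _ => 1 := by
        have ho : IsOpen {y : E3 | ‖y‖ < P.re} := isOpen_lt continuous_norm continuous_const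
        filter_upwards [ho.mem_nhds hx] with y (hy : ‖y‖ < P.re)
        exact cutoff_eq_one (by linarith)
      rw [this.fderiv_eq]; simp
    · rw [P.w_of_ge a hx, zero_mul]
  simp only [h1, integral_zero] at h
  rw [← neg_eq_zero, h, neg_inj]
  refine integral_congr_ae ?_
  filter_upwards [P.coeFn_corr a] with x hx
  rw [hx]
  rcases lt_or_ge ‖x‖ P.re with hx | hx
  · rw [cutoff_eq_one (by linarith), one_mul]
  · rw [P.U_of_ge a hx]; simp

/-- The neutral coated ball has vanishing polarization form. -/
lemma inner_contrast_total (hR : P.re ≤ R) (a v : E3) :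
    inner ℝ (contrast P.σ0 P.σm (P.total R a)) (ballVec R v) = 0 := by
  obtain ⟨n, hn⟩ := exists_nat_gt R
  -- On the ball the constant field `v` is the gradient of a truncated linear function, which is an
  -- admissible test field. The equation then turns the polarization into a multiple of the mean of
  -- the correction, which is zero.
  have hφ : IsTest fun x => cutoff n x * inner ℝ v x :=
    (isTest_cutoff n).mul_right (contDiff_inner_left v)
  have hgrad : ∀ x ∈ Metric.ball (0 : E3) R, gradient (fun x => cutoff n x * inner ℝ v x) x = v := by
    intro x hx
    have : (fun x => cutoff n x * inner ℝ v x) =ᶠ[𝓝 x] fun x => inner ℝ v x := by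
      filter_upwards [Metric.isOpen_ball.mem_nhds hx] with y hy
      rw [mem_ball_zero_iff] at hy
      rw [cutoff_eq_one (by linarith), one_mul]
    rw [this.gradient_eq]
    refine ext_inner_right ℝ fun u => ?_
    have h1 : HasFDerivAt (fun x : E3 => (inner ℝ v x : ℝ)) (innerSL ℝ v) x :=
      (innerSL ℝ v).hasFDerivAt
    rw [inner_gradient, h1.fderiv]; rfl
  have hv : (hφ.grad : E3 → E3) =ᵐ[volume] _ := hφ.memLp_gradient.coeFn_toLp
  have ht : P.total R a - ballVec R a = P.corr a := by rw [total]; abel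
  have h1 : inner ℝ (contrast P.σ0 P.σm (P.total R a)) (ballVec R v) =
      inner ℝ (contrast P.σ0 P.σm (P.total R a)) hφ.grad := by
    rw [L2.inner_def, L2.inner_def]
    refine integral_congr_ae ?_
    filter_upwards [hv, coeFn_ballVec R v, (P.isAdmissible_σ0 hR).supportedIn (P.total R a)]
      with x h2 h3 h4
    by_cases hx : x ∈ Metric.ball (0 : E3) R
    · rw [h2, h3, indicator_of_mem hx, hgrad x hx]
    · rw [h4 hx]; simp
  have h2 : inner ℝ (P.corr a) hφ.grad = 0 := by
    rw [← P.integral_inner_corr a v, L2.inner_def]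
    refine integral_congr_ae ?_
    filter_upwards [hv, P.coeFn_corr a] with x h2 h3
    by_cases hx : x ∈ Metric.ball (0 : E3) R
    · rw [h2, hgrad x hx]
    · rw [mem_ball_zero_iff, not_lt] at hx
      rw [h3, P.U_of_ge a (hR.trans hx)]; simp
  have h3 := (P.isField_total hR a).2 _ hφ.grad_mem
  rw [ht, h2] at h3
  rw [h1]
  linarith

end CoatedBall

/-! ### The transported coefficient as a function of the derivative of the displacement -/

/-- The linear endomorphisms of `ℝ³`. -/
abbrev End3 : Type := E3 →L[ℝ] E3

section Algebra

variable {A : Type*} [NormedRing A] [NormedAlgebra ℝ A]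

lemma hasStrictFDerivAt_inverse_one_add [CompleteSpace A] : HasStrictFDerivAt
    (fun P : A => Ring.inverse (1 + P)) (-ContinuousLinearMap.id ℝ A) 0 := by
  have h := hasStrictFDerivAt_ringInverse (𝕜 := ℝ) (1 : Aˣ)
  have h2 : HasStrictFDerivAt (fun P : A => 1 + P) (ContinuousLinearMap.id ℝ _) 0 :=
    (hasStrictFDerivAt_id 0).const_add 1
  rw [Units.val_one, ← add_zero (1 : A)] at h
  refine (HasStrictFDerivAt.comp (0 : A) h h2).congr_fderiv ?_
  ext P
  simp

variable [StarRing A] [ContinuousStar A] [StarModule ℝ A]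

/-- The linear map `P ↦ -P - P†`. -/
def negSymm (A : Type*) [NormedRing A] [NormedAlgebra ℝ A] [StarRing A]
    [ContinuousStar A] [StarModule ℝ A] : A →L[ℝ] A :=
  -ContinuousLinearMap.id ℝ A - ((starL' ℝ : A ≃L[ℝ] A) : A →L[ℝ] A)

lemma negSymm_apply (P : A) : negSymm A P = -P - star P := rfl

lemma hasStrictFDerivAt_inverse_mul_star [CompleteSpace A] : HasStrictFDerivAt
    (fun P : A => Ring.inverse (1 + P) * star (Ring.inverse (1 + P))) (negSymm A) 0 := by
  have h1 := hasStrictFDerivAt_inverse_one_add (A := A)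
  refine (h1.mul' h1.star).congr_fderiv ?_
  ext1 P
  rw [negSymm_apply]
  simp
  abel

/-- The linear map `P ↦ τ P - P - P†`. -/
def wjac' (τ : A →L[ℝ] ℝ) : A →L[ℝ] A := τ.smulRight 1 + negSymm A

lemma wjac'_apply (τ : A →L[ℝ] ℝ) (P : A) : wjac' τ P = τ P • 1 + (-P - star P) := rfl

lemma hasStrictFDerivAt_wjac [CompleteSpace A] {d : A → ℝ} {τ : A →L[ℝ] ℝ} (hd : HasStrictFDerivAt d τ 0)
    (h0 : d 0 = 1) : HasStrictFDerivAt
    (fun P : A => |d P| • (Ring.inverse (1 + P) * star (Ring.inverse (1 + P)))) (wjac' τ) 0 := by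
  have h1 : HasStrictFDerivAt
      (fun P : A => d P • (Ring.inverse (1 + P) * star (Ring.inverse (1 + P)))) (wjac' τ) 0 := by
    refine (hd.fun_smul hasStrictFDerivAt_inverse_mul_star).congr_fderiv ?_
    ext1 P
    rw [wjac'_apply]
    simp [h0, negSymm_apply]
    abel
  refine h1.congr_of_eventuallyEq ?_
  have : (0 : ℝ) < d 0 := by rw [h0]; exact one_pos
  filter_upwards [hd.continuousAt.eventually_const_lt this] with P hP
  rw [abs_of_pos hP]
end Algebra

/-- The entries of a linear endomorphism in the standard basis. -/
def entry (i j : Fin 3) : End3 →L[ℝ] ℝ :=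
  (innerSL ℝ (stdB i)).comp (ContinuousLinearMap.apply ℝ E3 (stdB j))

lemma entry_apply (i j : Fin 3) (A : End3) : entry i j A = inner ℝ (stdB i) (A (stdB j)) := rfl

lemma det_eq (A : End3) : A.det =
    entry 0 0 A * entry 1 1 A * entry 2 2 A - entry 0 0 A * entry 1 2 A * entry 2 1 A -
    entry 0 1 A * entry 1 0 A * entry 2 2 A + entry 0 1 A * entry 1 2 A * entry 2 0 A +
    entry 0 2 A * entry 1 0 A * entry 2 1 A - entry 0 2 A * entry 1 1 A * entry 2 0 A := by
  have h : ∀ i j, LinearMap.toMatrix stdB.toBasis stdB.toBasis (A : E3 →ₗ[ℝ] E3) i j =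
      entry i j A := fun i j => by
    rw [LinearMap.toMatrix_apply, entry_apply, OrthonormalBasis.coe_toBasis,
      OrthonormalBasis.coe_toBasis_repr_apply, OrthonormalBasis.repr_apply_apply]; rfl
  rw [ContinuousLinearMap.det, ← LinearMap.det_toMatrix stdB.toBasis, Matrix.det_fin_three]
  simp only [h]

lemma contDiff_det : ContDiff ℝ ∞ fun A : End3 => A.det := by
  have h : ∀ i j, ContDiff ℝ ∞ fun A : End3 => entry i j A := fun i j => (entry i j).contDiff
  simp only [det_eq]
  exact ((((((h 0 0).mul (h 1 1)).mul (h 2 2)).sub (((h 0 0).mul (h 1 2)).mul (h 2 1))).sub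
    (((h 0 1).mul (h 1 0)).mul (h 2 2))).add (((h 0 1).mul (h 1 2)).mul (h 2 0))).add
    (((h 0 2).mul (h 1 0)).mul (h 2 1)) |>.sub (((h 0 2).mul (h 1 1)).mul (h 2 0))

lemma trace3_eq (A : End3) : trace3 A = entry 0 0 A + entry 1 1 A + entry 2 2 A := by
  rw [trace3_apply, Fin.sum_univ_three]; rfl

lemma entry_one (i j : Fin 3) : entry i j 1 = if i = j then 1 else 0 := by
  rw [entry_apply]; exact stdB.inner_eq_ite i j

/-- Strict differentiability follows from smoothness, and the derivative is identified along lines,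
where the determinant is a cubic polynomial with linear coefficient the trace. -/
lemma hasStrictFDerivAt_det : HasStrictFDerivAt (fun P : End3 => (1 + P).det) trace3 0 := by
  have hc : ContDiff ℝ ∞ fun P : End3 => (1 + P).det :=
    contDiff_det.comp (contDiff_const.add contDiff_id)
  have h := hc.contDiffAt.hasStrictFDerivAt (x := (0 : End3)) (by simp)
  refine h.congr_fderiv (ContinuousLinearMap.ext fun P => ?_)
  have h1 : HasDerivAt (fun t : ℝ => (1 + t • P).det)
      (fderiv ℝ (fun P : End3 => (1 + P).det) 0 P) 0 := by
    have h2 : HasDerivAt (fun t : ℝ => t • P) P 0 := by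
      simpa using (hasDerivAt_id (0 : ℝ)).smul_const P
    exact h.hasFDerivAt.comp_hasDerivAt_of_eq 0 h2 (zero_smul ℝ P).symm
  obtain ⟨c2, c3, hq⟩ : ∃ c2 c3 : ℝ, ∀ t : ℝ,
      (1 + t • P).det = 1 + t * trace3 P + t ^ 2 * c2 + t ^ 3 * c3 := by
    refine ⟨entry 0 0 P * entry 1 1 P + entry 0 0 P * entry 2 2 P + entry 1 1 P * entry 2 2 P -
      entry 1 2 P * entry 2 1 P - entry 0 1 P * entry 1 0 P - entry 0 2 P * entry 2 0 P,
      P.det, fun t => ?_⟩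
    rw [det_eq, det_eq, trace3_eq]
    simp only [map_add, map_smul, entry_one, smul_eq_mul, Fin.isValue, Fin.reduceEq, if_true,
      if_false]
    ring
  have h3 : HasDerivAt (fun t : ℝ => (1 + t • P).det) (trace3 P) 0 := by
    simp only [hq]
    have := (((hasDerivAt_id' (0 : ℝ)).mul_const (trace3 P)).const_add 1).fun_add
      ((hasDerivAt_pow 2 (0 : ℝ)).mul_const c2) |>.fun_add
        ((hasDerivAt_pow 3 (0 : ℝ)).mul_const c3)
    exact this.congr_deriv (by simp)
  exact h1.unique h3

/-- The factor by which a conductivity is multiplied when it is pulled back by a diffeomorphism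
with derivative `1 + P`. -/
def jac (P : End3) : End3 :=
  |(1 + P).det| • (Ring.inverse (1 + P) * star (Ring.inverse (1 + P)))

/-- The derivative of `jac` at `0`. -/
def jac' : End3 →L[ℝ] End3 := wjac' trace3

lemma jac'_apply (P : End3) : jac' P = trace3 P • 1 + (-P - star P) := rfl

lemma hasStrictFDerivAt_jac : HasStrictFDerivAt jac jac' 0 :=
  hasStrictFDerivAt_wjac hasStrictFDerivAt_det (by simp [ContinuousLinearMap.det])

lemma jac_zero : jac 0 = 1 := by simp [jac, ContinuousLinearMap.det]

/-- A two-point estimate, which is what strict differentiability provides and what a contraction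
argument requires. -/
lemma exists_jac_sub_le {ε : ℝ} (hε : 0 < ε) : ∃ δ, 0 < δ ∧ ∀ P P' : End3, ‖P‖ ≤ δ → ‖P'‖ ≤ δ →
    ‖jac P - jac P' - jac' (P - P')‖ ≤ ε * ‖P - P'‖ := by
  obtain ⟨s, hs, h⟩ := hasStrictFDerivAt_jac.approximates_deriv_on_nhds (c := ⟨ε, hε.le⟩)
    (Or.inr hε)
  obtain ⟨δ, hδ, hδs⟩ := Metric.nhds_basis_closedBall.mem_iff.1 hs
  refine ⟨δ, hδ, fun P P' hP hP' => h P (hδs ?_) P' (hδs ?_)⟩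
  · exact mem_closedBall_zero_iff.2 hP
  · exact mem_closedBall_zero_iff.2 hP'

lemma jac_apply (P : End3) (v : E3) : jac P v =
    |(1 + P).det| • Ring.inverse (1 + P) (ContinuousLinearMap.adjoint (Ring.inverse (1 + P)) v) :=
  rfl

lemma inner_jac_comm (P : End3) (v w : E3) : inner ℝ (jac P v) w = inner ℝ v (jac P w) := by
  rw [jac_apply, jac_apply, inner_smul_left, inner_smul_right, RCLike.conj_to_real,
    ← ContinuousLinearMap.adjoint_inner_right, ContinuousLinearMap.adjoint_inner_left]

/-- The inverses in `jac` cancel the derivative of the diffeomorphism. This is the hypothesis on the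
coefficient under which energies are transported. -/
lemma inner_jac_adjoint {P : End3} (hP : IsUnit (1 + P)) (w : E3) :
    inner ℝ (jac P (ContinuousLinearMap.adjoint (1 + P) w)) (ContinuousLinearMap.adjoint (1 + P) w)
      = |(1 + P).det| * ‖w‖ ^ 2 := by
  have h : ∀ v, (1 + P) (Ring.inverse (1 + P) v) = v := fun v => by
    have := congrArg (fun A : End3 => A v) (Ring.mul_inverse_cancel (1 + P) hP)
    exact this
  have h' : ContinuousLinearMap.adjoint (Ring.inverse (1 + P))
      (ContinuousLinearMap.adjoint (1 + P) w) = w := by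
    refine ext_inner_right ℝ fun v => ?_
    rw [ContinuousLinearMap.adjoint_inner_left, ContinuousLinearMap.adjoint_inner_left, h]
  rw [jac_apply, h', inner_smul_left, RCLike.conj_to_real, ContinuousLinearMap.adjoint_inner_right,
    h, real_inner_self_eq_norm_sq]

namespace CoatedBall

variable (P : CoatedBall)

/-! ### Radial diffeomorphisms -/

/-- The middle radius of the shell. -/
def m : ℝ := (P.ri + P.re) / 2

lemma ri_lt_m : P.ri < P.m := by have := P.ri_lt_re; unfold m; linarith

lemma m_lt_re : P.m < P.re := by have := P.ri_lt_re; unfold m; linarith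

lemma m_pos : 0 < P.m := P.ri_pos.trans P.ri_lt_m

/-- The radial profile of the displacement, as a function of the square of the radius. -/
def cut (t : ℝ) : ℝ :=
  (P.ri ^ 3)⁻¹ * Real.smoothTransition ((P.m ^ 2 - t) / (P.m ^ 2 - P.ri ^ 2))

lemma sq_sub_pos : 0 < P.m ^ 2 - P.ri ^ 2 := by
  have := P.ri_lt_m; have := P.ri_pos
  nlinarith

lemma contDiff_cut : ContDiff ℝ ∞ P.cut := by
  unfold cut
  exact contDiff_const.mul (Real.smoothTransition.contDiff.comp
    ((contDiff_const.sub contDiff_id).div_const _))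

lemma cut_of_ge {t : ℝ} (h : P.m ^ 2 ≤ t) : P.cut t = 0 := by
  rw [cut, Real.smoothTransition.zero_of_nonpos, mul_zero]
  exact div_nonpos_of_nonpos_of_nonneg (by linarith) P.sq_sub_pos.le

lemma cut_of_le {t : ℝ} (h : t ≤ P.ri ^ 2) : P.cut t = (P.ri ^ 3)⁻¹ := by
  rw [cut, Real.smoothTransition.one_of_one_le, mul_one]
  rw [one_le_div P.sq_sub_pos]
  linarith

/-- The displacement field that moves the inner sphere by the quadratic form of `B`. -/
def V (B : End3) (y : E3) : E3 := (P.cut (‖y‖ ^ 2) * inner ℝ y (B y)) • y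

lemma contDiff_V (B : End3) : ContDiff ℝ ∞ (P.V B) := by
  have h1 : ContDiff ℝ ∞ fun y : E3 => P.cut (‖y‖ ^ 2) := P.contDiff_cut.comp (contDiff_norm_sq ℝ)
  exact (h1.mul (contDiff_quadratic B)).smul contDiff_id

lemma V_of_ge (B : End3) {y : E3} (h : P.m ≤ ‖y‖) : P.V B y = 0 := by
  have := P.m_pos
  rw [V, P.cut_of_ge (by gcongr), zero_mul, zero_smul]

lemma V_sub (B B' : End3) : P.V (B - B') = P.V B - P.V B' := by
  ext1 y
  simp only [V, Pi.sub_apply, sub_apply, inner_sub_right, mul_sub, sub_smul]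

lemma hasFDerivAt_V (B : End3) (y : E3) : HasFDerivAt (P.V B)
    ((P.cut (‖y‖ ^ 2) * inner ℝ y (B y)) • ContinuousLinearMap.id ℝ E3 +
      ((P.cut (‖y‖ ^ 2) • ((innerSL ℝ y).comp B + innerSL ℝ (B y)) +
        inner ℝ y (B y) • (deriv P.cut (‖y‖ ^ 2) • (2 : ℝ) • innerSL ℝ y))).smulRight y) y := by
  have h1 : HasDerivAt P.cut (deriv P.cut (‖y‖ ^ 2)) (‖y‖ ^ 2) :=
    (P.contDiff_cut.differentiable (by simp) _).hasDerivAt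
  have h2 : HasFDerivAt (fun y : E3 => ‖y‖ ^ 2) ((2 : ℝ) • innerSL ℝ y) y := by
    refine (hasStrictFDerivAt_norm_sq y).hasFDerivAt.congr_fderiv ?_
    ext1 v
    simp [two_mul, two_nsmul]
  have h3 := h1.comp_hasFDerivAt y h2
  exact (h3.fun_mul (hasFDerivAt_quadratic B y)).fun_smul (hasFDerivAt_id y)

/-- The derivative of the displacement field. -/
def DV (B : End3) (y : E3) : End3 := fderiv ℝ (P.V B) y

lemma DV_apply (B : End3) (y v : E3) : P.DV B y v = (P.cut (‖y‖ ^ 2) * inner ℝ y (B y)) • v +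
    (P.cut (‖y‖ ^ 2) * (inner ℝ y (B v) + inner ℝ (B y) v) +
      inner ℝ y (B y) * (deriv P.cut (‖y‖ ^ 2) * (2 * inner ℝ y v))) • y := by
  rw [DV, (P.hasFDerivAt_V B y).fderiv]
  simp only [add_apply, smul_apply, ContinuousLinearMap.smulRight_apply,
    ContinuousLinearMap.id_apply, ContinuousLinearMap.comp_apply, innerSL_apply_apply, smul_eq_mul]

lemma DV_sub (B B' : End3) (y : E3) : P.DV (B - B') y = P.DV B y - P.DV B' y := by
  rw [DV, DV, DV, V_sub, fderiv_sub ((P.contDiff_V B).differentiable (by simp) y)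
    ((P.contDiff_V B').differentiable (by simp) y)]

lemma DV_of_ge (B : End3) {y : E3} (h : P.m ≤ ‖y‖) : P.DV B y = 0 := by
  have hm := P.m_pos
  have h1 : P.m ^ 2 ≤ ‖y‖ ^ 2 := by gcongr
  have h2 : deriv P.cut (‖y‖ ^ 2) = 0 := by
    have hd : HasDerivAt P.cut (deriv P.cut (‖y‖ ^ 2)) (‖y‖ ^ 2) :=
      (P.contDiff_cut.differentiable (by simp) _).hasDerivAt
    have h3 : HasDerivWithinAt P.cut 0 (Ici (P.m ^ 2)) (‖y‖ ^ 2) :=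
      (hasDerivWithinAt_const _ _ 0).congr (fun t ht => P.cut_of_ge ht) (P.cut_of_ge h1)
    exact ((uniqueDiffOn_Ici _ _ h1).eq_deriv _ hd.hasDerivWithinAt h3)
  ext1 v
  rw [DV_apply, P.cut_of_ge h1, h2]
  simp

lemma continuous_DV (B : End3) : Continuous (P.DV B) :=
  (P.contDiff_V B).continuous_fderiv (by simp)

lemma exists_DV_le : ∃ K, 0 < K ∧ ∀ B y, ‖P.DV B y‖ ≤ K * ‖B‖ := by
  have hm := P.m_pos
  have hc : Continuous fun t => |P.cut t| := P.contDiff_cut.continuous.abs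
  have hc' : Continuous fun t => |deriv P.cut t| :=
    (P.contDiff_cut.continuous_deriv (by simp)).abs
  obtain ⟨C, hC⟩ := (isCompact_Icc (a := 0) (b := P.m ^ 2)).exists_bound_of_continuousOn
    hc.continuousOn
  obtain ⟨C', hC'⟩ := (isCompact_Icc (a := 0) (b := P.m ^ 2)).exists_bound_of_continuousOn
    hc'.continuousOn
  simp only [Real.norm_eq_abs, abs_abs] at hC hC'
  have h0 : (0 : ℝ) ∈ Icc 0 (P.m ^ 2) := ⟨le_rfl, by positivity⟩
  have hC0 : 0 ≤ C := (abs_nonneg _).trans (hC 0 h0)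
  have hC0' : 0 ≤ C' := (abs_nonneg _).trans (hC' 0 h0)
  refine ⟨3 * (C * P.m ^ 2) + 2 * (C' * P.m ^ 4) + 1, by positivity, fun B y => ?_⟩
  rcases le_or_gt P.m ‖y‖ with h | h
  · rw [P.DV_of_ge B h, norm_zero]; positivity
  have hy : ‖y‖ ^ 2 ∈ Icc 0 (P.m ^ 2) := ⟨by positivity, by gcongr⟩
  have h1 := hC _ hy
  have h2 := hC' _ hy
  refine ContinuousLinearMap.opNorm_le_bound _ (by positivity) fun v => ?_
  have b1 : ‖B y‖ ≤ ‖B‖ * P.m := (B.le_opNorm y).trans (by gcongr)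
  have b2 : |inner ℝ y (B y)| ≤ P.m * (‖B‖ * P.m) :=
    (abs_real_inner_le_norm _ _).trans (by gcongr)
  have b3 : |inner ℝ y (B v)| ≤ P.m * (‖B‖ * ‖v‖) :=
    (abs_real_inner_le_norm _ _).trans (by gcongr; exact B.le_opNorm v)
  have b4 : |inner ℝ (B y) v| ≤ ‖B‖ * P.m * ‖v‖ :=
    (abs_real_inner_le_norm _ _).trans (by gcongr)
  have b5 : |inner ℝ y v| ≤ P.m * ‖v‖ := (abs_real_inner_le_norm _ _).trans (by gcongr)
  have c1 : |P.cut (‖y‖ ^ 2) * inner ℝ y (B y)| ≤ C * (P.m * (‖B‖ * P.m)) := by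
    rw [abs_mul]; gcongr
  have c2 : |P.cut (‖y‖ ^ 2) * (inner ℝ y (B v) + inner ℝ (B y) v)| ≤
      C * (P.m * (‖B‖ * ‖v‖) + ‖B‖ * P.m * ‖v‖) := by
    rw [abs_mul]; gcongr
    exact (abs_add_le _ _).trans (add_le_add b3 b4)
  have c3 : |inner ℝ y (B y) * (deriv P.cut (‖y‖ ^ 2) * (2 * inner ℝ y v))| ≤
      P.m * (‖B‖ * P.m) * (C' * (2 * (P.m * ‖v‖))) := by
    rw [abs_mul, abs_mul, abs_mul, abs_two]; gcongr
  rw [DV_apply]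
  refine (norm_add_le _ _).trans ?_
  rw [norm_smul, norm_smul, Real.norm_eq_abs, Real.norm_eq_abs]
  calc _ ≤ C * (P.m * (‖B‖ * P.m)) * ‖v‖ + (C * (P.m * (‖B‖ * ‖v‖) + ‖B‖ * P.m * ‖v‖) +
        P.m * (‖B‖ * P.m) * (C' * (2 * (P.m * ‖v‖)))) * P.m := by
        gcongr
        exact (abs_add_le _ _).trans (add_le_add c2 c3)
    _ = (3 * (C * P.m ^ 2) + 2 * (C' * P.m ^ 4)) * ‖B‖ * ‖v‖ := by ring
    _ ≤ _ := mul_le_mul_of_nonneg_right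
        (mul_le_mul_of_nonneg_right (by linarith) (norm_nonneg _)) (norm_nonneg _)

/-- A bound for the derivative of the displacement fields. -/
def K : ℝ := P.exists_DV_le.choose

lemma K_pos : 0 < P.K := P.exists_DV_le.choose_spec.1

lemma norm_DV_le (B : End3) (y : E3) : ‖P.DV B y‖ ≤ P.K * ‖B‖ := P.exists_DV_le.choose_spec.2 B y

lemma norm_V_sub_le (B : End3) (x y : E3) : ‖P.V B x - P.V B y‖ ≤ P.K * ‖B‖ * ‖x - y‖ :=
  Convex.norm_image_sub_le_of_norm_fderiv_le (s := univ) (𝕜 := ℝ)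
    (fun z _ => (P.contDiff_V B).differentiable (by simp) z) (fun z _ => P.norm_DV_le B z)
    convex_univ (mem_univ y) (mem_univ x)

section Diffeo

variable {B : End3}

/-- A perturbation of the identity with Lipschitz constant below `1` is a homeomorphism of the whole
space; its derivative is invertible everywhere, so the inverse is smooth. -/
lemma exists_diffeo (hB : P.K * ‖B‖ < 1) : ∃ Φ : E3 ≃ₜ E3, (∀ y, Φ y = y + P.V B y) ∧
    ContDiff ℝ ∞ Φ ∧ ContDiff ℝ ∞ Φ.symm ∧ (∀ y, fderiv ℝ Φ y = 1 + P.DV B y) ∧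
    ∀ y, IsUnit (1 + P.DV B y) := by
  have hK0 : 0 ≤ P.K * ‖B‖ := by have := P.K_pos; positivity
  have ha : ApproximatesLinearOn (fun y => y + P.V B y)
      ((ContinuousLinearEquiv.refl ℝ E3 : E3 ≃L[ℝ] E3) : E3 →L[ℝ] E3) univ (P.K * ‖B‖).toNNReal := by
    intro x _ y _
    have : x + P.V B x - (y + P.V B y) - (ContinuousLinearEquiv.refl ℝ E3 : E3 →L[ℝ] E3) (x - y) =
        P.V B x - P.V B y := by simp; abel
    rw [this, Real.coe_toNNReal _ hK0]
    exact P.norm_V_sub_le B x y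
  have hc : Subsingleton E3 ∨ (P.K * ‖B‖).toNNReal <
      ‖((ContinuousLinearEquiv.refl ℝ E3).symm : E3 →L[ℝ] E3)‖₊⁻¹ := by
    right
    have : ‖((ContinuousLinearEquiv.refl ℝ E3).symm : E3 →L[ℝ] E3)‖₊ = 1 := by
      simp
    rw [this, inv_one]
    exact Real.toNNReal_lt_one.2 hB
  let Φ : E3 ≃ₜ E3 := ha.toHomeomorph _ hc
  have hΦ : ∀ y, Φ y = y + P.V B y := fun y => rfl
  have hs : ContDiff ℝ ∞ Φ := contDiff_id.add (P.contDiff_V B)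
  have hd : ∀ y, HasFDerivAt Φ (1 + P.DV B y) y := fun y =>
    (hasFDerivAt_id y).add ((P.contDiff_V B).differentiable (by simp) y).hasFDerivAt
  have hu : ∀ y, IsUnit (1 + P.DV B y) := fun y => by
    have := isUnit_one_sub_of_norm_lt_one (x := -P.DV B y)
      (by rw [norm_neg]; exact (P.norm_DV_le B y).trans_lt hB)
    rwa [sub_neg_eq_add] at this
  refine ⟨Φ, hΦ, hs, ?_, fun y => (hd y).fderiv, hu⟩
  refine Φ.contDiff_symm (f₀' := fun y => ContinuousLinearEquiv.ofUnit (hu y).unit) ?_ hs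
  intro y
  exact hd y

end Diffeo

end CoatedBall

/-! ### First variation of the pulled-back conductivity at the coated ball -/

lemma trace3_smulRight (y z : E3) : trace3 ((innerSL ℝ y).smulRight z) = inner ℝ y z := by
  rw [trace3_apply]
  simp only [ContinuousLinearMap.smulRight_apply, innerSL_apply_apply, inner_smul_right]
  exact (EuclideanSpace.basisFun (Fin 3) ℝ).sum_inner_mul_inner y z

lemma trace3_one : trace3 (1 : End3) = 3 := trace3_id

lemma inner_jac'_smul_add_smulRight (s : ℝ) (y z v w : E3) :
    inner ℝ (jac' (s • (1 : End3) + (innerSL ℝ y).smulRight z) v) w =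
      (s + inner ℝ y z) * inner ℝ v w - inner ℝ y v * inner ℝ z w - inner ℝ z v * inner ℝ y w := by
  rw [jac'_apply, map_add, map_smul, trace3_one, trace3_smulRight]
  have h : inner ℝ (star (s • (1 : End3) + (innerSL ℝ y).smulRight z) v) w =
      inner ℝ v ((s • (1 : End3) + (innerSL ℝ y).smulRight z) w) :=
    ContinuousLinearMap.adjoint_inner_left _ _ _
  have h1 : ∀ u, (s • (1 : End3) + (innerSL ℝ y).smulRight z) u = s • u + inner ℝ y u • z :=
    fun u => rfl
  have h2 : ∀ (c : ℝ) (u : E3), (c • (1 : End3)) u = c • u := fun c u => rfl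
  rw [add_apply, h2, sub_apply, neg_apply, inner_add_left, inner_sub_left, inner_neg_left, h, h1,
    h1]
  simp only [inner_add_left, inner_add_right, inner_smul_left, inner_smul_right,
    RCLike.conj_to_real, smul_eq_mul]
  rw [real_inner_comm z v]
  ring

namespace CoatedBall

variable (P : CoatedBall)

/-- The derivative of the pulled back conductivity with respect to the inner boundary. -/
def dA (B : End3) (y : E3) : End3 := P.σ0 y • jac' (P.DV B y)

lemma norm_dA_le (B : End3) (y : E3) :
    ‖P.dA B y‖ ≤ (P.σc + P.σs + P.σm) * (‖jac'‖ * (P.K * ‖B‖)) := by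
  rw [dA, norm_smul]
  have h := P.abs_sg_le ‖y‖
  have h' : 0 ≤ P.σc + P.σs + P.σm := (abs_nonneg _).trans h
  exact mul_le_mul h ((jac'.le_opNorm _).trans (by gcongr; exact P.norm_DV_le B y))
    (norm_nonneg _) h'

lemma measurable_dA (B : End3) : AEStronglyMeasurable (P.dA B) volume :=
  P.measurable_σ0.aestronglyMeasurable.smul
    (jac'.continuous.comp (P.continuous_DV B)).aestronglyMeasurable

lemma memLp_dA (B : End3) : MemLp (P.dA B) ⊤ (volume : Measure E3) :=
  memLp_top_of_norm_le (P.measurable_dA B) (P.norm_dA_le B)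

lemma dA_of_ge (B : End3) {y : E3} (h : P.m ≤ ‖y‖) : P.dA B y = 0 := by
  rw [dA, P.DV_of_ge B h, map_zero]
  exact ContinuousLinearMap.ext fun v => smul_zero (A := E3) (P.σ0 y)

variable {B : End3}

/-- In polar coordinates the derivative is a multiple of the identity plus a rank-one map, the shape
for which the bilinear form of `jac'` has a closed formula. -/
lemma DV_smul_S2 (hB : ∀ x y, inner ℝ (B x) y = inner ℝ x (B y)) (p : S2) {r : ℝ} (hr : 0 < r) :
    P.DV B (r • (p : E3)) = (P.cut (r ^ 2) * r ^ 2 * inner ℝ (p : E3) (B p)) • (1 : End3) +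
      (innerSL ℝ ((2 * (P.cut (r ^ 2) * r ^ 2)) • B p +
        (2 * deriv P.cut (r ^ 2) * r ^ 4 * inner ℝ (p : E3) (B p)) • (p : E3))).smulRight
          (p : E3) := by
  ext1 v
  have h2 : ∀ (c : ℝ) (u : E3), (c • (1 : End3)) u = c • u := fun c u => rfl
  rw [DV_apply, norm_smul_S2 p hr.le, add_apply, h2, ContinuousLinearMap.smulRight_apply,
    innerSL_apply_apply, map_smul]
  simp only [inner_add_left, inner_smul_left, inner_smul_right, RCLike.conj_to_real, smul_smul]
  rw [← hB p v]
  congr 2 <;> ring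

/-- The density of the derivative form in polar coordinates. -/
lemma inner_dA_U (hB : ∀ x y, inner ℝ (B x) y = inner ℝ x (B y)) (a v : E3) (p : S2) {r : ℝ}
    (hr : 0 < r) :
    inner ℝ (P.dA B (r • (p : E3)) (P.U a (r • (p : E3)))) (P.U v (r • (p : E3))) =
      P.sg r * ((2 * deriv P.cut (r ^ 2) * r ^ 4 + 3 * (P.cut (r ^ 2) * r ^ 2)) * P.f r ^ 2) *
          (inner ℝ (p : E3) (B p) * inner ℝ a v) +
        P.sg r * ((2 * deriv P.cut (r ^ 2) * r ^ 4 + 3 * (P.cut (r ^ 2) * r ^ 2)) *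
            (P.c r ^ 2 - P.f r ^ 2) - 4 * deriv P.cut (r ^ 2) * r ^ 4 * P.c r ^ 2 -
            4 * (P.cut (r ^ 2) * r ^ 2) * P.c r * (P.c r - P.f r)) *
          (inner ℝ (p : E3) (B p) * (inner ℝ a (p : E3) * inner ℝ v (p : E3))) -
        P.sg r * (2 * (P.cut (r ^ 2) * r ^ 2) * P.c r * P.f r) *
          (inner ℝ (B a) (p : E3) * inner ℝ v (p : E3) +
            inner ℝ (B v) (p : E3) * inner ℝ a (p : E3)) := by
  rw [dA, smul_apply, inner_smul_left, RCLike.conj_to_real, σ0, norm_smul_S2 p hr.le,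
    P.DV_smul_S2 hB p hr, inner_jac'_smul_add_smulRight, P.U_smul a p hr, P.U_smul v p hr,
    tangentProj_apply, tangentProj_apply]
  have hp : (inner ℝ (p : E3) (p : E3) : ℝ) = 1 := inner_self_S2 p
  have e1 : (inner ℝ (B a) (p : E3) : ℝ) = inner ℝ (B p) a := by
    rw [hB, real_inner_comm]
  have e2 : (inner ℝ (B v) (p : E3) : ℝ) = inner ℝ (B p) v := by
    rw [hB, real_inner_comm]
  have e3 : (inner ℝ (p : E3) (B p) : ℝ) = inner ℝ (B p) (p : E3) := real_inner_comm _ _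
  have e4 : (inner ℝ a (p : E3) : ℝ) = inner ℝ (p : E3) a := real_inner_comm _ _
  have e5 : (inner ℝ v (p : E3) : ℝ) = inner ℝ (p : E3) v := real_inner_comm _ _
  simp only [inner_add_left, inner_add_right, inner_smul_left, inner_smul_right,
    RCLike.conj_to_real, inner_sub_left, inner_sub_right, e1, e2, e3, e4, e5, hp]
  ring

/-- The density is a combination of second and fourth moments. All of them are expressed through two
numbers: `I` for the integral of the quadratic form times `⟪a, v⟫`, and `J` for the quartic moment.
-/
lemma integral_sphere_inner_dA_U (hB : ∀ x y, inner ℝ (B x) y = inner ℝ x (B y)) (a v : E3)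
    {r : ℝ} (hr : 0 < r) {I J : ℝ} (hI : I = sphereArea / 3 * trace3 B * inner ℝ a v)
    (hJ : J = sphereArea / 15 * (trace3 B * inner ℝ a v + 2 * inner ℝ (B a) v)) :
    ∫ p : S2, inner ℝ (P.dA B (r • (p : E3)) (P.U a (r • (p : E3)))) (P.U v (r • (p : E3)))
        ∂surf =
      P.sg r * ((2 * deriv P.cut (r ^ 2) * r ^ 4 + 3 * (P.cut (r ^ 2) * r ^ 2)) *
          (P.f r ^ 2 * (I - J) - P.c r ^ 2 * J) +
        P.cut (r ^ 2) * r ^ 2 * (2 * P.c r ^ 2 * J + P.c r * P.f r * (2 * I - 6 * J))) := by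
  simp only [P.inner_dA_U hB a v _ hr]
  rw [integral_sub (integrable_surf (by fun_prop)) (integrable_surf (by fun_prop)),
    integral_add (integrable_surf (by fun_prop)) (integrable_surf (by fun_prop)),
    integral_const_mul, integral_const_mul, integral_const_mul,
    integral_add (integrable_surf (by fun_prop)) (integrable_surf (by fun_prop)),
    integral_mul_const, integral_quadratic, integral_quartic hB, integral_inner_mul_inner,
    integral_inner_mul_inner, ← hJ]
  have h1 : (inner ℝ (B v) a : ℝ) = inner ℝ (B a) v := by rw [hB, real_inner_comm]
  have h2 : sphereArea * (inner ℝ (B a) v : ℝ) = (15 * J - 3 * I) / 2 := by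
    rw [hI, hJ]; ring
  rw [h1, ← hI]
  linear_combination -2 * P.sg r * (2 * (P.cut (r ^ 2) * r ^ 2) * P.c r * P.f r) / 3 * h2

/-! ### The radial integral -/

lemma continuous_deriv_cut : Continuous (deriv P.cut) := P.contDiff_cut.continuous_deriv (by simp)

lemma hasDerivAt_cut_sq (r : ℝ) :
    HasDerivAt (fun r => P.cut (r ^ 2)) (deriv P.cut (r ^ 2) * (2 * r)) r := by
  have h1 : HasDerivAt P.cut (deriv P.cut (r ^ 2)) (r ^ 2) :=
    (P.contDiff_cut.differentiable (by simp) _).hasDerivAt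
  have h2 : HasDerivAt (fun r : ℝ => r ^ 2) (2 * r) r :=
    (hasDerivAt_pow 2 r).congr_deriv (by norm_num)
  exact HasDerivAt.comp (h₂ := P.cut) (h := fun r : ℝ => r ^ 2) r h1 h2

/-- With `f = a + b / r³` and `c = a - 2 b / r³` one has `r f' = c - f` and `r c' = 2 (f - c)`;
these relations make the radial density an exact derivative wherever the conductivity is constant.
-/
lemma hasDerivAt_radial (s a b I J : ℝ) {r : ℝ} (hr : 0 < r) :
    HasDerivAt (fun r => P.cut (r ^ 2) * r ^ 5 *
        (s * ((a + b / r ^ 3) ^ 2 * (I - J) - (a - 2 * b / r ^ 3) ^ 2 * J)))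
      (r ^ 2 * (s * ((2 * deriv P.cut (r ^ 2) * r ^ 4 + 3 * (P.cut (r ^ 2) * r ^ 2)) *
          ((a + b / r ^ 3) ^ 2 * (I - J) - (a - 2 * b / r ^ 3) ^ 2 * J) +
        P.cut (r ^ 2) * r ^ 2 * (2 * (a - 2 * b / r ^ 3) ^ 2 * J +
          (a - 2 * b / r ^ 3) * (a + b / r ^ 3) * (2 * I - 6 * J))))) r := by
  have h3 : HasDerivAt (fun r : ℝ => r ^ 3) (3 * r ^ 2) r :=
    (hasDerivAt_pow 3 r).congr_deriv (by norm_num)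
  have hb : ∀ c : ℝ, HasDerivAt (fun r : ℝ => c / r ^ 3) (-3 * c / r ^ 4) r := fun c => by
    refine (h3.fun_inv (by positivity) |>.const_mul c).congr_deriv ?_
    field_simp
  have h5 : HasDerivAt (fun r : ℝ => r ^ 5) (5 * r ^ 4) r :=
    (hasDerivAt_pow 5 r).congr_deriv (by norm_num)
  have hf := (((hb b).const_add a).fun_pow 2).mul_const (I - J)
  have hc := (((hb (2 * b)).const_sub a).fun_pow 2).mul_const J
  refine (((P.hasDerivAt_cut_sq r).fun_mul h5).fun_mul ((hf.fun_sub hc).const_mul s)).congr_deriv ?_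
  generalize deriv P.cut (r ^ 2) = d
  generalize P.cut (r ^ 2) = e
  simp only [Nat.cast_ofNat, Nat.add_one_sub_one, pow_one]
  field_simp
  ring

lemma c_of_lt {r : ℝ} (h : r < P.ri) : P.c r = P.α + P.β / P.ri ^ 3 := by
  rw [c, f, P.g_of_le h.le, χ, if_neg fun h' => absurd h (not_lt.2 h'.1), div_eq_mul_inv]; ring

lemma f_of_lt {r : ℝ} (h : r < P.ri) : P.f r = P.α + P.β / P.ri ^ 3 := by
  rw [f, P.g_of_le h.le, div_eq_mul_inv]

lemma f_of_mem {r : ℝ} (h : P.ri ≤ r) (h' : r < P.re) : P.f r = P.α + P.β / r ^ 3 := by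
  rw [f, P.g_of_mem h h'.le, div_eq_mul_inv]

lemma c_of_mem {r : ℝ} (h : P.ri ≤ r) (h' : r < P.re) : P.c r = P.α - 2 * P.β / r ^ 3 := by
  rw [c, f, P.g_of_mem h h'.le, χ, if_pos ⟨h, h'⟩, div_eq_mul_inv]; ring

lemma sg_of_lt {r : ℝ} (h : r < P.ri) : P.sg r = P.σc := if_pos h

lemma sg_of_mem {r : ℝ} (h : P.ri ≤ r) (h' : r < P.re) : P.sg r = P.σs := by
  rw [sg, if_neg (not_lt.2 h), if_pos h']

/-- The amplitude of the field in the core. -/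
def γ : ℝ := P.α + P.β / P.ri ^ 3

/-- A vanishing field in the core would force zero flux at the inner sphere, hence `α = β = 0`,
against the normalization at the outer sphere. -/
lemma γ_ne_zero : P.γ ≠ 0 := by
  intro h
  have h1 := P.flux_inner
  have h3 := P.α_add_β
  have hi := P.ri_pos
  have hs := P.σs_pos
  unfold γ at h
  rw [h, mul_zero, mul_eq_zero, or_iff_right hs.ne'] at h1
  have hb : P.β / P.ri ^ 3 = 0 := by
    have : 2 * P.β / P.ri ^ 3 = 2 * (P.β / P.ri ^ 3) := by ring
    linarith
  have hb' : P.β = 0 := by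
    rcases div_eq_zero_iff.1 hb with h | h
    · exact h
    · exact absurd h (by positivity)
  rw [hb'] at h h3
  simp at h h3
  linarith

/-- The density is an exact derivative on each side of the inner sphere, and the profile `cut`
vanishes at the middle radius. Only the jump at `ri` remains, and the factor `ri ^ 2` is `cut` times
`r ^ 5` there; the flux condition simplifies the jump. -/
lemma integral_radial (I J : ℝ) {E : ℝ → ℝ}
    (hE : ∀ r, 0 < r → E r = r ^ 2 * (P.sg r *
      ((2 * deriv P.cut (r ^ 2) * r ^ 4 + 3 * (P.cut (r ^ 2) * r ^ 2)) *
          (P.f r ^ 2 * (I - J) - P.c r ^ 2 * J) +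
        P.cut (r ^ 2) * r ^ 2 * (2 * P.c r ^ 2 * J + P.c r * P.f r * (2 * I - 6 * J)))))
    (hE0 : ∀ r, P.m ≤ r → E r = 0) (hint : IntegrableOn E (Ioi 0)) :
    ∫ r in Ioi 0, E r =
      P.ri ^ 2 * P.γ ^ 2 * (P.σc - P.σs) * (I + (P.σc / P.σs - 1) * J) := by
  have hri := P.ri_pos
  have hm := P.ri_lt_m
  have hme := P.m_lt_re
  have hcut := P.contDiff_cut.continuous
  have hcut' := P.continuous_deriv_cut
  have hs := P.σs_pos
  have e1 : ∫ r in Ioi 0, E r = (∫ r in Ioo 0 P.ri, E r) + ∫ r in Ico P.ri P.m, E r := by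
    have u1 : Ioo 0 P.ri ∪ Ici P.ri = Ioi 0 := Ioo_union_Ici_eq_Ioi hri
    have u2 : Ico P.ri P.m ∪ Ici P.m = Ici P.ri := Ico_union_Ici_eq_Ici hm.le
    rw [← u1, setIntegral_union _ measurableSet_Ici (hint.mono_set Ioo_subset_Ioi_self)
      (hint.mono_set fun r hr => hri.trans_le hr), ← u2, setIntegral_union _ measurableSet_Ici
      (hint.mono_set fun r hr => hri.trans_le hr.1)
      (hint.mono_set fun r hr => (hri.trans hm).trans_le hr),
      setIntegral_congr_fun measurableSet_Ici (g := fun _ => 0) fun r hr => hE0 r hr,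
      integral_zero, add_zero]
    · exact disjoint_left.2 fun r h h' => absurd h.2 (not_lt.2 h')
    · exact disjoint_left.2 fun r h h' => absurd h.2 (not_lt.2 h')
  have e2 : ∫ r in Ioo 0 P.ri, E r = P.ri ^ 2 * (P.σc * P.γ ^ 2 * (I - 2 * J)) := by
    have hd : ∀ r ∈ uIcc 0 P.ri, HasDerivAt
        (fun r => P.cut (r ^ 2) * r ^ 5 * (P.σc * P.γ ^ 2 * (I - 2 * J)))
        ((deriv P.cut (r ^ 2) * (2 * r) * r ^ 5 + P.cut (r ^ 2) * (5 * r ^ 4)) *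
          (P.σc * P.γ ^ 2 * (I - 2 * J))) r := fun r _ =>
      (((P.hasDerivAt_cut_sq r).fun_mul ((hasDerivAt_pow 5 r).congr_deriv (by norm_num))).mul_const
        _)
    have := intervalIntegral.integral_eq_sub_of_hasDerivAt hd
      (Continuous.intervalIntegrable (by fun_prop) _ _)
    rw [intervalIntegral.integral_of_le hri.le, integral_Ioc_eq_integral_Ioo,
      P.cut_of_le le_rfl] at this
    rw [setIntegral_congr_fun measurableSet_Ioo, this]
    · field_simp; ring
    · intro r hr
      simp only [hE r hr.1, P.sg_of_lt hr.2, P.f_of_lt hr.2, P.c_of_lt hr.2]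
      unfold γ
      ring
  have e3 : ∫ r in Ico P.ri P.m, E r = -(P.ri ^ 2 * (P.σs * ((P.α + P.β / P.ri ^ 3) ^ 2 * (I - J) -
      (P.α - 2 * P.β / P.ri ^ 3) ^ 2 * J))) := by
    have hne : ∀ r ∈ uIcc P.ri P.m, r ^ 3 ≠ 0 := fun r hr => by
      rw [uIcc_of_le hm.le] at hr
      have := hri.trans_le hr.1
      positivity
    have := intervalIntegral.integral_eq_sub_of_hasDerivAt (a := P.ri) (b := P.m)
      (fun r hr => P.hasDerivAt_radial P.σs P.α P.β I J (by
        rw [uIcc_of_le hm.le] at hr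
        exact hri.trans_le hr.1))
      (ContinuousOn.intervalIntegrable (by fun_prop (disch := assumption)))
    rw [intervalIntegral.integral_of_le hm.le, ← integral_Ico_eq_integral_Ioc,
      P.cut_of_le le_rfl, P.cut_of_ge le_rfl] at this
    rw [setIntegral_congr_fun measurableSet_Ico, this]
    · field_simp; ring
    · intro r hr
      have hr2 := hr.2.trans hme
      simp only [hE r (hri.trans_le hr.1), P.sg_of_mem hr.1 hr2, P.f_of_mem hr.1 hr2,
        P.c_of_mem hr.1 hr2]
  have e4 : P.α - 2 * P.β / P.ri ^ 3 = P.σc * P.γ / P.σs := by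
    rw [eq_div_iff hs.ne', γ, ← P.flux_inner]; ring
  rw [e1, e2, e3, e4, ← γ]
  field_simp
  ring

/-- The derivative of the polarization form with respect to the inner boundary. -/
lemma inner_mulOp_dA_total {R : ℝ} (hR : P.re ≤ R)
    (hB : ∀ x y, inner ℝ (B x) y = inner ℝ x (B y)) (a v : E3) :
    inner ℝ (mulOp (P.dA B) (P.total R a)) (P.total R v) =
      P.ri ^ 2 * P.γ ^ 2 * (P.σc - P.σs) * (sphereArea / 3 * trace3 B * inner ℝ a v +
        (P.σc / P.σs - 1) *
          (sphereArea / 15 * (trace3 B * inner ℝ a v + 2 * inner ℝ (B a) v))) := by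
  have hint := integrable_inner_mul (P.memLp_dA B) (P.total R a) (P.total R v)
  have hae : (fun x => inner ℝ (P.dA B x (P.total R a x)) (P.total R v x)) =ᵐ[volume]
      fun x => (inner ℝ (P.dA B x (P.U a x)) (P.U v x) : ℝ) := by
    filter_upwards [P.coeFn_total (R := R) a, P.coeFn_total (R := R) v] with x h1 h2
    by_cases hx : x ∈ Metric.ball (0 : E3) R
    · rw [h1 hx, h2 hx]
    · rw [mem_ball_zero_iff, not_lt] at hx
      rw [P.dA_of_ge B (P.m_lt_re.le.trans (hR.trans hx))]
      simp
  replace hint := hint.congr hae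
  have hm := hint.aestronglyMeasurable
  rw [inner_mulOp (P.memLp_dA B), integral_congr_ae hae, integral_polar hm]
  rw [integrable_polar_iff hm] at hint
  rw [integral_prod_symm _ hint]
  have hE : ∀ r, ∫ p : S2, r ^ 2 • (inner ℝ (P.dA B (r • (p : E3)) (P.U a (r • (p : E3))))
      (P.U v (r • (p : E3))) : ℝ) ∂surf = r ^ 2 * ∫ p : S2, (inner ℝ (P.dA B (r • (p : E3))
        (P.U a (r • (p : E3)))) (P.U v (r • (p : E3))) : ℝ) ∂surf := fun r => by
    rw [← integral_const_mul]; rfl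
  refine P.integral_radial _ _ (fun r hr => ?_) (fun r hr => ?_) hint.integral_prod_right
  · simp only [hE, P.integral_sphere_inner_dA_U hB a v hr rfl rfl]
  · have hr0 := P.m_pos.trans_le hr
    have : ∀ p : S2, P.dA B (r • (p : E3)) = 0 := fun p =>
      P.dA_of_ge B (by rwa [norm_smul_S2 p hr0.le])
    simp [this]

end CoatedBall

/-! ### The polarization form as an endomorphism -/

/-- The endomorphism that represents the polarization form of `s + Q`. -/
def form (s R : ℝ) (Q : L2 →L[ℝ] L2) : End3 :=
  (ContinuousLinearMap.adjoint (ballVec R)).comp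
    (Q.comp ((fieldOp gradSpace s Q).comp (ballVec R)))

section Form

variable {s R l l' : ℝ} {Q Q' : L2 →L[ℝ] L2}

lemma inner_form (a v : E3) : inner ℝ (form s R Q a) v =
    inner ℝ (Q (fieldOp gradSpace s Q (ballVec R a))) (ballVec R v) := by
  rw [form, ContinuousLinearMap.comp_apply, ContinuousLinearMap.adjoint_inner_left]
  simp only [ContinuousLinearMap.comp_apply]

lemma inner_form_comm (hl : IsElliptic s l Q) (hQ : ∀ v w, inner ℝ (Q v) w = inner ℝ v (Q w))
    (a v : E3) : inner ℝ (form s R Q a) v = inner ℝ a (form s R Q v) := by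
  have h := (isField_fieldOp (X := gradSpace) hl (ballVec R a)).inner_sub_inner hQ
    (isField_fieldOp hl (ballVec R v))
  rw [sub_self, zero_apply, inner_zero_left, sub_eq_zero] at h
  rw [inner_form, h, real_inner_comm, ← inner_form, real_inner_comm]

/-- Exact variation formula from reciprocity; it is the source of both the derivative of the
polarization tensor and its continuity. -/
lemma inner_form_sub (hl : IsElliptic s l Q) (hl' : IsElliptic s l' Q')
    (hQ' : ∀ v w, inner ℝ (Q' v) w = inner ℝ v (Q' w)) (a v : E3) :
    inner ℝ ((form s R Q - form s R Q') a) v =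
      inner ℝ ((Q - Q') (fieldOp gradSpace s Q (ballVec R a)))
        (fieldOp gradSpace s Q' (ballVec R v)) := by
  rw [← (isField_fieldOp (X := gradSpace) hl (ballVec R a)).inner_sub_inner hQ'
    (isField_fieldOp hl' (ballVec R v)), sub_apply, inner_sub_left, inner_form_comm hl' hQ',
    inner_form, real_inner_comm _ a, inner_form, real_inner_comm _ (ballVec R a)]

end Form

lemma norm_le_of_inner_le {A : End3} {C : ℝ} (hC : 0 ≤ C)
    (h : ∀ a v, |inner ℝ (A a) v| ≤ C * ‖a‖ * ‖v‖) : ‖A‖ ≤ C := by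
  refine ContinuousLinearMap.opNorm_le_bound _ hC fun a => ?_
  rcases (norm_nonneg (A a)).eq_or_lt with h0 | h0
  · rw [← h0]; positivity
  · have := h a (A a)
    rw [real_inner_self_eq_norm_sq, abs_of_nonneg (by positivity), sq] at this
    exact le_of_mul_le_mul_right this h0

lemma norm_smul_id_sub_le {A : E3 → End3} {s C : ℝ} (hs : ∀ x, ‖A x‖ ≤ C) (x : E3) :
    ‖A x - s • ContinuousLinearMap.id ℝ E3‖ ≤ C + |s| := by
  refine (norm_sub_le _ _).trans (add_le_add (hs x) ?_)
  rw [norm_smul, Real.norm_eq_abs]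
  exact mul_le_of_le_one_right (abs_nonneg _) ContinuousLinearMap.norm_id_le

lemma exists_jac_sub_one_le : ∃ δ, 0 < δ ∧ ∀ D : End3, ‖D‖ ≤ δ →
    ‖jac D - 1‖ ≤ (1 + ‖jac'‖) * ‖D‖ ∧ ‖jac D - 1‖ ≤ 1 / 2 := by
  obtain ⟨δ, hδ, h⟩ := exists_jac_sub_le one_pos
  have hc : 0 < 1 + ‖jac'‖ := by positivity
  have h1 : ∀ D : End3, ‖D‖ ≤ δ → ‖jac D - 1‖ ≤ (1 + ‖jac'‖) * ‖D‖ := fun D hD => by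
    have h2 := h D 0 hD (by rw [norm_zero]; exact hδ.le)
    rw [jac_zero, sub_zero, one_mul] at h2
    have h3 : jac D - 1 = jac D - 1 - jac' D + jac' D := by abel
    calc ‖jac D - 1‖ = ‖jac D - 1 - jac' D + jac' D‖ := by rw [← h3]
      _ ≤ ‖D‖ + ‖jac'‖ * ‖D‖ := (norm_add_le _ _).trans (add_le_add h2 (jac'.le_opNorm _))
      _ = _ := by ring
  refine ⟨min δ (1 / (2 * (1 + ‖jac'‖))), by positivity, fun D hD => ?_⟩
  have h2 := h1 D (hD.trans (min_le_left _ _))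
  refine ⟨h2, h2.trans ?_⟩
  calc (1 + ‖jac'‖) * ‖D‖ ≤ (1 + ‖jac'‖) * (1 / (2 * (1 + ‖jac'‖))) := by
        gcongr; exact hD.trans (min_le_right _ _)
    _ = 1 / 2 := by field_simp

/-! ### Conductivities pulled back by the deformation of the core -/

namespace CoatedBall

variable (P : CoatedBall)

/-- Conductivities that differ from that of the coated ball only near the outer sphere. -/
structure IsOuter (σ : E3 → ℝ) : Prop where
  measurable : Measurable σ
  lower : ∀ x, P.lam ≤ σ x
  upper : ∀ x, σ x ≤ P.σc + P.σs + P.σm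
  eq_of_lt : ∀ x, ‖x‖ < P.m → σ x = P.σ0 x
  eq_of_ge : ∀ x, 2 * P.re ≤ ‖x‖ → σ x = P.σm

/-- Deformations that are close to the identity. -/
structure IsSmall (B : End3) : Prop where
  lt_one : P.K * ‖B‖ < 1
  jac_sub_le : ∀ y, ‖jac (P.DV B y) - 1‖ ≤ (1 + ‖jac'‖) * (P.K * ‖B‖)
  jac_sub_le_half : ∀ y, ‖jac (P.DV B y) - 1‖ ≤ 1 / 2

lemma exists_isSmall : ∃ δ, 0 < δ ∧ ∀ B : End3, ‖B‖ ≤ δ → P.IsSmall B := by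
  obtain ⟨δ, hδ, h⟩ := exists_jac_sub_one_le
  have hK := P.K_pos
  refine ⟨min δ (1 / 2) / P.K, by positivity, fun B hB => ?_⟩
  rw [le_div_iff₀ hK, mul_comm] at hB
  have h1 : ∀ y, ‖P.DV B y‖ ≤ δ := fun y =>
    (P.norm_DV_le B y).trans (hB.trans (min_le_left _ _))
  refine ⟨(hB.trans (min_le_right _ _)).trans_lt (by norm_num), fun y => ?_, fun y => (h _ (h1 y)).2⟩
  exact (h _ (h1 y)).1.trans (by gcongr; exact P.norm_DV_le B y)

/-- The conductivity `σ` pulled back by the deformation of the core. -/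
def pull (σ : E3 → ℝ) (B : End3) (y : E3) : End3 := σ y • jac (P.DV B y)

variable {P} {σ σ' : E3 → ℝ} {B B' : End3}

lemma IsOuter.nonneg (h : P.IsOuter σ) (x : E3) : 0 ≤ σ x := P.lam_pos.le.trans (h.lower x)

lemma IsOuter.abs_le (h : P.IsOuter σ) (x : E3) : |σ x| ≤ P.σc + P.σs + P.σm := by
  rw [abs_of_nonneg (h.nonneg x)]; exact h.upper x

lemma IsSmall.isUnit (hB : P.IsSmall B) (y : E3) : IsUnit (1 + P.DV B y) := by
  obtain ⟨Φ, -, -, -, -, h⟩ := P.exists_diffeo hB.lt_one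
  exact h y

lemma IsSmall.continuous_jac (hB : P.IsSmall B) : Continuous fun y => jac (P.DV B y) := by
  have h1 : Continuous fun y => (1 : End3) + P.DV B y :=
    continuous_const.add (P.continuous_DV B)
  have h2 : Continuous fun y => Ring.inverse ((1 : End3) + P.DV B y) := by
    rw [continuous_iff_continuousAt]
    intro y
    obtain ⟨u, hu⟩ := hB.isUnit y
    have h3 := NormedRing.inverse_continuousAt u
    rw [hu] at h3
    exact ContinuousAt.comp (g := Ring.inverse) h3 h1.continuousAt
  exact (contDiff_det.continuous.comp h1).abs.smul 
    (h2.mul (ContinuousLinearMap.adjoint.continuous.comp h2))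

lemma aestronglyMeasurable_pull (h : P.IsOuter σ) (hB : P.IsSmall B) :
    AEStronglyMeasurable (P.pull σ B) volume :=
  h.measurable.aestronglyMeasurable.smul hB.continuous_jac.aestronglyMeasurable

lemma norm_pull_le (h : P.IsOuter σ) (hB : P.IsSmall B) (y : E3) :
    ‖P.pull σ B y‖ ≤ (P.σc + P.σs + P.σm) * (1 / 2 + ‖(1 : End3)‖) := by
  have h0 := (abs_nonneg _).trans (h.abs_le y)
  rw [pull, norm_smul]
  have h1 : ‖jac (P.DV B y)‖ ≤ 1 / 2 + ‖(1 : End3)‖ := by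
    have := norm_add_le (jac (P.DV B y) - 1) 1
    rw [sub_add_cancel] at this
    exact this.trans (by gcongr; exact hB.jac_sub_le_half y)
  exact mul_le_mul (h.abs_le y) h1 (norm_nonneg _) h0

lemma memLp_pull (h : P.IsOuter σ) (hB : P.IsSmall B) :
    MemLp (fun x => P.pull σ B x - P.σm • ContinuousLinearMap.id ℝ E3) ⊤
      (volume : Measure E3) :=
  memLp_top_of_norm_le ((aestronglyMeasurable_pull h hB).sub aestronglyMeasurable_const)
    (norm_smul_id_sub_le (norm_pull_le h hB))

lemma inner_pull_comm (σ : E3 → ℝ) (B : End3) (x v w : E3) :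
    inner ℝ (P.pull σ B x v) w = inner ℝ v (P.pull σ B x w) := by
  rw [pull, smul_apply, smul_apply, inner_smul_left, inner_smul_right, inner_jac_comm]; rfl

lemma inner_matContrast_pull_comm (h : P.IsOuter σ) (hB : P.IsSmall B) (F G : L2) :
    inner ℝ (matContrast (P.pull σ B) P.σm F) G = inner ℝ F (matContrast (P.pull σ B) P.σm G) := by
  refine mulOp_symm (memLp_pull h hB) (fun x v w => ?_) F G
  simp [inner_smul_left, inner_smul_right, inner_sub_left, inner_sub_right, inner_pull_comm]

/-- The factor `jac` differs from `1` by at most `1 / 2`, so at most half of the ellipticity is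
lost. -/
lemma isElliptic_pull (h : P.IsOuter σ) (hB : P.IsSmall B) :
    IsElliptic P.σm (P.lam / 2) (matContrast (P.pull σ B) P.σm) := by
  refine isElliptic_mulOp (memLp_pull h hB) (half_pos P.lam_pos) fun x v => ?_
  have h1 : |inner ℝ ((jac (P.DV B x) - 1) v) v| ≤ 1 / 2 * ‖v‖ * ‖v‖ :=
    (abs_real_inner_le_norm _ _).trans (by
      gcongr
      exact ((jac (P.DV B x) - 1).le_opNorm v).trans (by gcongr; exact hB.jac_sub_le_half x))
  have h2 : inner ℝ ((jac (P.DV B x) - 1) v) v = inner ℝ (jac (P.DV B x) v) v - ‖v‖ ^ 2 := by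
    rw [← real_inner_self_eq_norm_sq, ← inner_sub_left]; rfl
  have h3 := (abs_le.1 h1).1
  have h4 := h.lower x
  have h5 := P.lam_pos
  rw [sub_apply, pull, smul_apply, smul_apply, ContinuousLinearMap.id_apply, inner_sub_left,
    inner_smul_left, inner_smul_left, RCLike.conj_to_real, RCLike.conj_to_real,
    real_inner_self_eq_norm_sq]
  have h6 : 1 / 2 * ‖v‖ ^ 2 ≤ inner ℝ (jac (P.DV B x) v) v := by nlinarith
  nlinarith [mul_le_mul h4 h6 (by positivity) (h5.le.trans h4)]

lemma isOuter_σ0 : P.IsOuter P.σ0 := by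
  refine ⟨P.measurable_σ0, fun x => P.lam_le_sg _, fun x => (le_abs_self _).trans (P.abs_sg_le _),
    fun _ _ => rfl, fun x hx => ?_⟩
  have h1 := P.re_pos
  have h2 := P.ri_lt_re
  rw [σ0, sg, if_neg (by linarith), if_neg (by linarith)]

lemma isSmall_zero : P.IsSmall 0 := by
  obtain ⟨δ, hδ, h⟩ := P.exists_isSmall
  exact h 0 (by rw [norm_zero]; exact hδ.le)

lemma DV_zero (y : E3) : P.DV 0 y = 0 := by
  have := P.DV_sub 0 0 y
  rwa [sub_self, sub_self] at this

lemma pull_zero (σ : E3 → ℝ) (y : E3) : P.pull σ 0 y = σ y • ContinuousLinearMap.id ℝ E3 := by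
  rw [pull, DV_zero, jac_zero]; rfl

lemma matContrast_pull_zero (σ : E3 → ℝ) :
    matContrast (P.pull σ 0) P.σm = contrast σ P.σm := by
  have : (fun x => P.pull σ 0 x - P.σm • ContinuousLinearMap.id ℝ E3) =
      fun x => (σ x - P.σm) • ContinuousLinearMap.id ℝ E3 := by
    funext x
    rw [pull_zero]
    exact ContinuousLinearMap.ext fun v => by
      simp only [smul_apply, sub_apply, ContinuousLinearMap.id_apply, sub_smul]
  rw [matContrast, this]

end CoatedBall

lemma exists_fixedPoint_of_norm_le {E : Type*} [NormedAddCommGroup E] [CompleteSpace E]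
    {S : Set E} (hS : IsClosed S) {x : E} (hx : x ∈ S) {F : E → E} (hF : MapsTo F S S)
    (hc : ∀ x ∈ S, ∀ y ∈ S, ‖F x - F y‖ ≤ 1 / 2 * ‖x - y‖) : ∃ y ∈ S, F y = y := by
  have hK : ContractingWith (1 / 2 : NNReal) (hF.restrict F S S) := by
    refine ⟨by rw [← NNReal.coe_lt_coe]; norm_num, LipschitzWith.of_dist_le_mul fun x y => ?_⟩
    rw [Subtype.dist_eq, Subtype.dist_eq, dist_eq_norm, dist_eq_norm]
    simpa using hc x x.2 y y.2
  obtain ⟨y, hy, h, -⟩ := hK.exists_fixedPoint' hS.isComplete hF hx (edist_ne_top _ _)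
  exact ⟨y, hy, h⟩

/-! ### The polarization tensor on the reference configuration -/

namespace CoatedBall

variable (P : CoatedBall)

/-- The fields in the deformed core-shell structure, on the reference configuration. -/
def field (σ : E3 → ℝ) (B : End3) : E3 →L[ℝ] L2 :=
  (fieldOp gradSpace P.σm (matContrast (P.pull σ B) P.σm)).comp (ballVec (2 * P.re))

/-- The polarization tensor of the deformed core-shell structure. -/
def pt (σ : E3 → ℝ) (B : End3) : End3 :=
  form P.σm (2 * P.re) (matContrast (P.pull σ B) P.σm)

/-- Multiplication by the difference of two conductivities. -/
def dev (σ σ' : E3 → ℝ) : L2 →L[ℝ] L2 :=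
  mulOp fun x => (σ x - σ' x) • ContinuousLinearMap.id ℝ E3

variable {P} {σ σ' : E3 → ℝ} {B B' : End3}

/-- Outer conductivities differ only where `‖x‖ ≥ m`, while the deformation acts only where `‖x‖ <
m`. Hence the effect of changing `σ` is independent of `B`. -/
lemma matContrast_pull_sub_pull (h : P.IsOuter σ) (h' : P.IsOuter σ') (hB : P.IsSmall B) :
    matContrast (P.pull σ B) P.σm - matContrast (P.pull σ' B) P.σm = dev σ σ' := by
  rw [matContrast, matContrast, mulOp_sub (memLp_pull h hB) (memLp_pull h' hB), dev]
  congr 1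
  funext x
  refine ContinuousLinearMap.ext fun v => ?_
  simp only [Pi.sub_apply, pull, sub_apply, smul_apply, ContinuousLinearMap.id_apply]
  rcases lt_or_ge ‖x‖ P.m with hx | hx
  · rw [h.eq_of_lt x hx, h'.eq_of_lt x hx, sub_self, sub_self, zero_smul]
  · have h1 : (1 : End3) v = v := rfl
    rw [P.DV_of_ge B hx, jac_zero, h1]
    module

lemma matContrast_pull_sub (h : P.IsOuter σ) (hB : P.IsSmall B) (hB' : P.IsSmall B') :
    matContrast (P.pull σ B) P.σm - matContrast (P.pull σ B') P.σm =
      mulOp fun x => σ x • (jac (P.DV B x) - jac (P.DV B' x)) := by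
  rw [matContrast, matContrast, mulOp_sub (memLp_pull h hB) (memLp_pull h hB')]
  congr 1
  funext x
  refine ContinuousLinearMap.ext fun v => ?_
  simp only [Pi.sub_apply, pull, sub_apply, smul_apply, ContinuousLinearMap.id_apply]
  module

lemma σsum_pos : 0 < P.σc + P.σs + P.σm := by
  have h1 := P.σc_pos; have h2 := P.σs_pos; have h3 := P.σm_pos
  linarith

lemma aestronglyMeasurable_smul_jac_sub (h : P.IsOuter σ) (hB : P.IsSmall B)
    (hB' : P.IsSmall B') :
    AEStronglyMeasurable (fun x => σ x • (jac (P.DV B x) - jac (P.DV B' x))) volume :=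
  h.measurable.aestronglyMeasurable.smul
    (hB.continuous_jac.sub hB'.continuous_jac).aestronglyMeasurable

lemma norm_matContrast_pull_sub_zero_le (h : P.IsOuter σ) (hB : P.IsSmall B) :
    ‖matContrast (P.pull σ B) P.σm - matContrast (P.pull σ 0) P.σm‖ ≤
      (P.σc + P.σs + P.σm) * ((1 + ‖jac'‖) * (P.K * ‖B‖)) := by
  rw [matContrast_pull_sub h hB isSmall_zero]
  refine norm_mulOp_le (aestronglyMeasurable_smul_jac_sub h hB isSmall_zero) fun x => ?_
  rw [norm_smul, DV_zero, jac_zero]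
  exact mul_le_mul (h.abs_le x) (hB.jac_sub_le x) (norm_nonneg _) P.σsum_pos.le

/-- The linearization `dA` is formed with the coated-ball conductivity, yet it applies to every
outer `σ`: where the deformation acts, `σ` is that conductivity. Its error is therefore controlled
in operator norm. -/
lemma norm_matContrast_pull_sub_sub_le {ε : ℝ} (h : P.IsOuter σ) (hB : P.IsSmall B)
    (hB' : P.IsSmall B')
    (hε : ∀ x, ‖jac (P.DV B x) - jac (P.DV B' x) - jac' (P.DV B x - P.DV B' x)‖ ≤
      ε * ‖P.DV B x - P.DV B' x‖) (h0 : 0 ≤ ε) :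
    ‖matContrast (P.pull σ B) P.σm - matContrast (P.pull σ B') P.σm - mulOp (P.dA (B - B'))‖ ≤
      (P.σc + P.σs + P.σm) * (ε * (P.K * ‖B - B'‖)) := by
  have hm := aestronglyMeasurable_smul_jac_sub h hB hB'
  have hL : MemLp (fun x => σ x • (jac (P.DV B x) - jac (P.DV B' x))) ⊤
      (volume : Measure E3) := by
    refine memLp_top_of_norm_le hm (C := (P.σc + P.σs + P.σm) * (1 / 2 + 1 / 2)) fun x => ?_
    rw [norm_smul]
    refine mul_le_mul (h.abs_le x) ?_ (norm_nonneg _) P.σsum_pos.le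
    have h1 : jac (P.DV B x) - jac (P.DV B' x) =
      (jac (P.DV B x) - 1) - (jac (P.DV B' x) - 1) := by abel
    rw [h1]
    exact (norm_sub_le _ _).trans (add_le_add (hB.jac_sub_le_half x) (hB'.jac_sub_le_half x))
  rw [matContrast_pull_sub h hB hB', mulOp_sub hL (P.memLp_dA _)]
  refine norm_mulOp_le (hm.sub (P.measurable_dA _)) fun x => ?_
  have h1 : (fun x => σ x • (jac (P.DV B x) - jac (P.DV B' x))) x - P.dA (B - B') x =
      σ x • (jac (P.DV B x) - jac (P.DV B' x) - jac' (P.DV B x - P.DV B' x)) := by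
    rw [dA, DV_sub]
    beta_reduce
    rcases lt_or_ge ‖x‖ P.m with hx | hx
    · rw [h.eq_of_lt x hx]
      refine ContinuousLinearMap.ext fun v => ?_
      simp only [sub_apply, smul_apply]
      module
    · rw [P.DV_of_ge B hx, P.DV_of_ge B' hx, sub_self, sub_self, map_zero, sub_zero]
      refine ContinuousLinearMap.ext fun v => ?_
      simp only [sub_apply, smul_apply, zero_apply]
      module
  rw [Pi.sub_apply, h1, norm_smul]
  refine mul_le_mul (h.abs_le x) ((hε x).trans ?_) (norm_nonneg _) P.σsum_pos.le
  rw [← DV_sub]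
  gcongr
  exact P.norm_DV_le _ _

lemma isField_field (h : P.IsOuter σ) (hB : P.IsSmall B) (a : E3) :
    IsField gradSpace P.σm (matContrast (P.pull σ B) P.σm) (ballVec (2 * P.re) a)
      (P.field σ B a) :=
  isField_fieldOp (isElliptic_pull h hB) _

lemma field_zero (a : E3) : P.field P.σ0 0 a = P.total (2 * P.re) a := by
  have h1 := isField_field P.isOuter_σ0 P.isSmall_zero a
  have h2 := P.isField_total (R := 2 * P.re) (by linarith [P.re_pos]) a
  rw [← matContrast_pull_zero] at h2
  exact h1.unique (isElliptic_pull isOuter_σ0 isSmall_zero) h2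

lemma pt_zero : P.pt P.σ0 0 = 0 := by
  refine ContinuousLinearMap.ext fun a => ext_inner_right ℝ fun v => ?_
  have h := P.inner_contrast_total (R := 2 * P.re) (by linarith [P.re_pos]) a v
  rw [← field_zero, ← matContrast_pull_zero] at h
  rw [pt, inner_form, zero_apply, inner_zero_left]
  exact h

lemma inner_pt_comm (h : P.IsOuter σ) (hB : P.IsSmall B) (a v : E3) :
    inner ℝ (P.pt σ B a) v = inner ℝ a (P.pt σ B v) :=
  inner_form_comm (isElliptic_pull h hB) (inner_matContrast_pull_comm h hB) a v

lemma inner_pt_sub (h : P.IsOuter σ) (hB : P.IsSmall B) (h' : P.IsOuter σ') (hB' : P.IsSmall B')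
    (a v : E3) : inner ℝ ((P.pt σ B - P.pt σ' B') a) v =
      inner ℝ ((matContrast (P.pull σ B) P.σm - matContrast (P.pull σ' B') P.σm)
        (P.field σ B a)) (P.field σ' B' v) :=
  inner_form_sub (isElliptic_pull h hB) (isElliptic_pull h' hB')
    (inner_matContrast_pull_comm h' hB') a v

/-- The change of core is small in operator norm, whereas the change of outer boundary is assumed
small only on the reference fields. The stability estimate accepts this because it evaluates the
perturbation at the second field. -/
lemma norm_field_sub_le {τ : ℝ} (h : P.IsOuter σ) (hB : P.IsSmall B)
    (hτ : ∀ a, ‖dev σ P.σ0 (P.field P.σ0 0 a)‖ ≤ τ * ‖a‖) (a : E3) :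
    ‖P.field σ B a - P.field P.σ0 0 a‖ ≤ 2 / P.lam * ((P.σc + P.σs + P.σm) *
      ((1 + ‖jac'‖) * (P.K * ‖B‖)) * ‖P.field P.σ0 0‖ + τ) * ‖a‖ := by
  have h1 := (isField_field h hB a).norm_sub_le (isElliptic_pull h hB)
    (isField_field P.isOuter_σ0 P.isSmall_zero a)
  have h2 : matContrast (P.pull σ B) P.σm - matContrast (P.pull P.σ0 0) P.σm =
      (matContrast (P.pull σ B) P.σm - matContrast (P.pull σ 0) P.σm) + dev σ P.σ0 := by
    rw [← matContrast_pull_sub_pull h isOuter_σ0 isSmall_zero]; abel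
  have h3 : ‖(matContrast (P.pull σ B) P.σm - matContrast (P.pull P.σ0 0) P.σm)
      (P.field P.σ0 0 a)‖ ≤ (P.σc + P.σs + P.σm) * ((1 + ‖jac'‖) * (P.K * ‖B‖)) *
        (‖P.field P.σ0 0‖ * ‖a‖) + τ * ‖a‖ := by
    rw [h2, add_apply]
    refine (norm_add_le _ _).trans (add_le_add ?_ (hτ a))
    exact (ContinuousLinearMap.le_opNorm _ _).trans (mul_le_mul
      (norm_matContrast_pull_sub_zero_le h hB) (ContinuousLinearMap.le_opNorm _ _)
      (norm_nonneg _) (by have := P.K_pos; have := P.σsum_pos; positivity))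
  have hl := P.lam_pos
  rw [div_mul_eq_mul_div, div_mul_eq_mul_div, le_div_iff₀ hl]
  linarith

/-! ### The derivative of the polarization tensor -/

variable (P) in
/-- The coefficient of the trace in the derivative of the polarization tensor. -/
def k₁ : ℝ := P.ri ^ 2 * P.γ ^ 2 * (P.σc - P.σs) * sphereArea *
  (1 / 3 + (P.σc / P.σs - 1) / 15)

variable (P) in
/-- The coefficient of the identity in the derivative of the polarization tensor. -/
def k₂ : ℝ := P.ri ^ 2 * P.γ ^ 2 * (P.σc - P.σs) * sphereArea * (2 * (P.σc / P.σs - 1) / 15)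

/-- The eigenvalue of the derivative on traceless matrices. -/
lemma k₂_ne_zero (hne : P.σc ≠ P.σs) : P.k₂ ≠ 0 := by
  have h1 := P.ri_pos.ne'
  have h2 := P.γ_ne_zero
  have h3 := sphereArea_pos.ne'
  have h4 : P.σc / P.σs - 1 ≠ 0 := by
    rw [sub_ne_zero, ne_eq, div_eq_one_iff_eq P.σs_pos.ne']; exact hne
  have h5 := sub_ne_zero.2 hne
  unfold k₂
  positivity

/-- The eigenvalue of the derivative on multiples of the identity; up to nonzero factors it is `(σc
- σs) (2 + σc / σs)`. -/
lemma k₁_k₂_ne_zero (hne : P.σc ≠ P.σs) : 3 * P.k₁ + P.k₂ ≠ 0 := by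
  have h1 := P.ri_pos.ne'
  have h2 := P.γ_ne_zero
  have h3 := sphereArea_pos.ne'
  have h5 := sub_ne_zero.2 hne
  have h4 : 0 < P.σc / P.σs := div_pos P.σc_pos P.σs_pos
  have : 3 * P.k₁ + P.k₂ = P.ri ^ 2 * P.γ ^ 2 * (P.σc - P.σs) * sphereArea *
      ((2 + P.σc / P.σs) / 3) := by unfold k₁ k₂; ring
  rw [this]
  positivity

variable (P) in
/-- The derivative of the polarization tensor with respect to the core, at the coated ball. -/
def dpt (B : End3) : End3 := (P.k₁ * trace3 B) • (1 : End3) + P.k₂ • B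

lemma inner_mulOp_dA_field (hB : ∀ x y, inner ℝ (B x) y = inner ℝ x (B y)) (a v : E3) :
    inner ℝ (mulOp (P.dA B) (P.field P.σ0 0 a)) (P.field P.σ0 0 v) = inner ℝ (P.dpt B a) v := by
  have h1 : P.dpt B a = (P.k₁ * trace3 B) • a + P.k₂ • B a := rfl
  rw [field_zero, field_zero, P.inner_mulOp_dA_total (by linarith [P.re_pos]) hB, h1,
    inner_add_left, inner_smul_left, inner_smul_left, RCLike.conj_to_real, RCLike.conj_to_real, k₁,
    k₂]
  ring

variable (P) in
/-- The inverse of the derivative of the polarization tensor. -/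
def dptInv : End3 →L[ℝ] End3 :=
  P.k₂⁻¹ • (ContinuousLinearMap.id ℝ End3 -
    (P.k₁ / (3 * P.k₁ + P.k₂)) • trace3.smulRight (1 : End3))

lemma dptInv_apply (B : End3) : P.dptInv B =
    P.k₂⁻¹ • (B - (P.k₁ / (3 * P.k₁ + P.k₂)) • trace3 B • (1 : End3)) := rfl

/-- The trace of `dpt B` is `(3 k₁ + k₂) tr B`, so the trace of `B` can be recovered first and its
contribution subtracted. -/
lemma dptInv_dpt (hne : P.σc ≠ P.σs) (B : End3) : P.dptInv (P.dpt B) = B := by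
  have h1 := P.k₂_ne_zero hne
  have h2 := P.k₁_k₂_ne_zero hne
  have h3 : trace3 (P.dpt B) = (3 * P.k₁ + P.k₂) * trace3 B := by
    rw [dpt, map_add, map_smul, map_smul, trace3_one, smul_eq_mul, smul_eq_mul]; ring
  rw [dptInv_apply, h3]
  refine ContinuousLinearMap.ext fun v => ?_
  simp only [dpt, smul_apply, sub_apply, add_apply]
  have h4 : P.k₁ / (3 * P.k₁ + P.k₂) * ((3 * P.k₁ + P.k₂) * trace3 B) = P.k₁ * trace3 B := by
    rw [← mul_assoc, div_mul_cancel₀ _ h2]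
  rw [smul_smul (P.k₁ / _), h4, add_sub_cancel_left, smul_smul, inv_mul_cancel₀ h1, one_smul]

lemma eq_zero_of_dptInv_eq_zero (hne : P.σc ≠ P.σs) {C : End3} (h : P.dptInv C = 0) : C = 0 := by
  have h1 := P.k₂_ne_zero hne
  have h2 := P.k₁_k₂_ne_zero hne
  have h3 : C = (P.k₁ / (3 * P.k₁ + P.k₂) * trace3 C) • (1 : End3) := by
    refine ContinuousLinearMap.ext fun v => ?_
    have h4 := congrArg (fun A : End3 => P.k₂ • A v) h
    simp only [dptInv_apply, smul_apply, sub_apply, zero_apply, smul_zero, smul_smul,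
      mul_inv_cancel₀ h1, one_smul, sub_eq_zero] at h4
    exact h4
  have h5 : trace3 C = 0 := by
    have h6 := congrArg trace3 h3
    rw [map_smul, trace3_one, smul_eq_mul] at h6
    rw [div_mul_eq_mul_div, div_mul_eq_mul_div, eq_div_iff h2] at h6
    have : trace3 C * P.k₂ = 0 := by linear_combination h6
    exact (mul_eq_zero.1 this).resolve_right h1
  rw [h3, h5, mul_zero]
  exact ContinuousLinearMap.ext fun v => zero_smul ℝ v

lemma inner_dptInv_comm {C : End3} (hC : ∀ x y, inner ℝ (C x) y = inner ℝ x (C y)) (x y : E3) :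
    inner ℝ (P.dptInv C x) y = inner ℝ x (P.dptInv C y) := by
  have h1 : ∀ x, P.dptInv C x =
      P.k₂⁻¹ • (C x - (P.k₁ / (3 * P.k₁ + P.k₂)) • trace3 C • x) := fun x => rfl
  rw [h1, h1]
  simp only [inner_sub_left, inner_sub_right, inner_smul_left, inner_smul_right,
    RCLike.conj_to_real, hC]

/-- The derivative at the coated ball approximates all difference quotients in `B`, uniformly over
the outer conductivities that are close to `σ0` on the reference fields. The increment has to be
symmetric because the derivative formula is established for symmetric matrices. -/
lemma exists_norm_pt_sub_le {q : ℝ} (hq : 0 < q) : ∃ δ, 0 < δ ∧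
    (∀ B : End3, ‖B‖ ≤ δ → P.IsSmall B) ∧
    ∀ σ, P.IsOuter σ → (∀ a, ‖dev σ P.σ0 (P.field P.σ0 0 a)‖ ≤ δ * ‖a‖) →
      (∀ B, ‖B‖ ≤ δ → ∀ a, ‖P.field σ B a‖ ≤ (‖P.field P.σ0 0‖ + 1) * ‖a‖) ∧
      ∀ B B', ‖B‖ ≤ δ → ‖B'‖ ≤ δ →
        (∀ x y, inner ℝ ((B - B') x) y = inner ℝ x ((B - B') y)) →
        ‖P.pt σ B - P.pt σ B' - P.dpt (B - B')‖ ≤ q * ‖B - B'‖ := by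
  have hK := P.K_pos
  have hΛ := P.σsum_pos
  have hl := P.lam_pos
  set N := ‖P.field P.σ0 0‖ with hN
  set Λ := P.σc + P.σs + P.σm with hΛd
  have hN0 : 0 ≤ N := norm_nonneg _
  set c := 2 / P.lam * (Λ * ((1 + ‖jac'‖) * P.K) * N + 1) with hc
  have hc0 : 0 < c := by positivity
  set D := 2 * (Λ * (‖jac'‖ * P.K)) * (N + 1) with hD
  have hD0 : 0 ≤ D := by positivity
  -- Half of `q` is reserved for the nonlinearity of `jac`.
  set ε := q / (2 * (Λ * P.K * (N + 1) ^ 2)) with hε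
  have hε0 : 0 < ε := by positivity
  obtain ⟨δ₁, hδ₁, h1⟩ := P.exists_isSmall
  obtain ⟨δ₂, hδ₂, h2⟩ := exists_jac_sub_le hε0
  -- The other half is reserved for replacing the true fields by the reference fields; `D + 1`
  -- avoids division by zero, and `θ ≤ 1` keeps the fields bounded by `N + 1`.
  set θ := min 1 (q / (2 * (D + 1))) with hθ
  have hθ0 : 0 < θ := by positivity
  refine ⟨min δ₁ (min (δ₂ / P.K) (θ / c)), by positivity, fun B hB => h1 B (hB.trans
    (min_le_left _ _)), fun σ hσ hτ => ?_⟩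
  set δ := min δ₁ (min (δ₂ / P.K) (θ / c)) with hδ
  have hd1 : δ ≤ δ₁ := min_le_left _ _
  have hd2 : P.K * δ ≤ δ₂ := by
    have : δ ≤ δ₂ / P.K := (min_le_right _ _).trans (min_le_left _ _)
    rwa [le_div_iff₀ hK, mul_comm] at this
  have hd3 : c * δ ≤ θ := by
    have : δ ≤ θ / c := (min_le_right _ _).trans (min_le_right _ _)
    rwa [le_div_iff₀ hc0, mul_comm] at this
  have hT : ∀ B, ‖B‖ ≤ δ → ∀ a, ‖P.field σ B a - P.field P.σ0 0 a‖ ≤ θ * ‖a‖ := by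
    intro B hB a
    refine (norm_field_sub_le hσ (h1 B (hB.trans hd1)) hτ a).trans ?_
    refine mul_le_mul_of_nonneg_right (le_trans ?_ hd3) (norm_nonneg _)
    calc 2 / P.lam * (Λ * ((1 + ‖jac'‖) * (P.K * ‖B‖)) * N + δ) ≤
        2 / P.lam * (Λ * ((1 + ‖jac'‖) * (P.K * δ)) * N + δ) := by gcongr
      _ = c * δ := by rw [hc]; ring
  have hN' : ∀ a, ‖P.field P.σ0 0 a‖ ≤ N * ‖a‖ := fun a => ContinuousLinearMap.le_opNorm _ _
  have hT' : ∀ B, ‖B‖ ≤ δ → ∀ a, ‖P.field σ B a‖ ≤ (N + 1) * ‖a‖ := by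
    intro B hB a
    have e : P.field σ B a = P.field P.σ0 0 a + (P.field σ B a - P.field P.σ0 0 a) := by abel
    rw [e]
    refine (norm_add_le _ _).trans ((add_le_add (hN' a) (hT B hB a)).trans ?_)
    rw [← add_mul]
    gcongr
    exact min_le_left _ _
  refine ⟨hT', fun B B' hB hB' hs => ?_⟩
  have sB := h1 B (hB.trans hd1)
  have sB' := h1 B' (hB'.trans hd1)
  set X := matContrast (P.pull σ B) P.σm - matContrast (P.pull σ B') P.σm with hX
  set Z := mulOp (P.dA (B - B')) with hZ
  have hXZ : ‖X - Z‖ ≤ Λ * (ε * (P.K * ‖B - B'‖)) := by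
    refine norm_matContrast_pull_sub_sub_le hσ sB sB' (fun x => ?_) hε0.le
    refine h2 _ _ ?_ ?_
    · exact (P.norm_DV_le B x).trans (le_trans (by gcongr) hd2)
    · exact (P.norm_DV_le B' x).trans (le_trans (by gcongr) hd2)
  have hZn : ‖Z‖ ≤ Λ * (‖jac'‖ * (P.K * ‖B - B'‖)) :=
    norm_mulOp_le (P.measurable_dA _) (P.norm_dA_le _)
  refine norm_le_of_inner_le (by positivity) fun a v => ?_
  -- The exact variation formula, with the operator difference `X` replaced by its linearization `Z`
  -- and then each of the two fields by its reference field.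
  have key : inner ℝ ((P.pt σ B - P.pt σ B' - P.dpt (B - B')) a) v =
      inner ℝ ((X - Z) (P.field σ B a)) (P.field σ B' v) +
      inner ℝ (Z (P.field σ B a - P.field P.σ0 0 a)) (P.field σ B' v) +
      inner ℝ (Z (P.field P.σ0 0 a)) (P.field σ B' v - P.field P.σ0 0 v) := by
    rw [sub_apply, inner_sub_left, inner_pt_sub hσ sB hσ sB', ← inner_mulOp_dA_field hs,
      sub_apply X Z, map_sub Z, inner_sub_left, inner_sub_left, inner_sub_right (Z _)]
    ring
  rw [key]
  have i1 : |inner ℝ ((X - Z) (P.field σ B a)) (P.field σ B' v)| ≤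
      Λ * (ε * (P.K * ‖B - B'‖)) * ((N + 1) * ‖a‖) * ((N + 1) * ‖v‖) :=
    (abs_real_inner_le_norm _ _).trans (mul_le_mul ((ContinuousLinearMap.le_opNorm _ _).trans
      (mul_le_mul hXZ (hT' B hB a) (norm_nonneg _) (by positivity))) (hT' B' hB' v)
      (norm_nonneg _) (by positivity))
  have i2 : |inner ℝ (Z (P.field σ B a - P.field P.σ0 0 a)) (P.field σ B' v)| ≤
      Λ * (‖jac'‖ * (P.K * ‖B - B'‖)) * (θ * ‖a‖) * ((N + 1) * ‖v‖) :=
    (abs_real_inner_le_norm _ _).trans (mul_le_mul ((ContinuousLinearMap.le_opNorm _ _).trans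
      (mul_le_mul hZn (hT B hB a) (norm_nonneg _) (by positivity))) (hT' B' hB' v)
      (norm_nonneg _) (by positivity))
  have i3 : |inner ℝ (Z (P.field P.σ0 0 a)) (P.field σ B' v - P.field P.σ0 0 v)| ≤
      Λ * (‖jac'‖ * (P.K * ‖B - B'‖)) * ((N + 1) * ‖a‖) * (θ * ‖v‖) :=
    (abs_real_inner_le_norm _ _).trans (mul_le_mul ((ContinuousLinearMap.le_opNorm _ _).trans
      (mul_le_mul hZn ((hN' a).trans (by gcongr; linarith)) (norm_nonneg _) (by positivity)))
      (hT B' hB' v) (norm_nonneg _) (by positivity))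
  refine (abs_add_le _ _).trans ((add_le_add ((abs_add_le _ _).trans (add_le_add i1 i2)) i3).trans ?_)
  have e1 : Λ * (ε * P.K) * (N + 1) ^ 2 = q / 2 := by rw [hε]; field_simp
  have e2 : D * θ ≤ q / 2 := by
    calc D * θ ≤ (D + 1) * (q / (2 * (D + 1))) := by
          gcongr
          · linarith
          · exact min_le_right _ _
      _ = q / 2 := by field_simp
  calc _ = (Λ * (ε * P.K) * (N + 1) ^ 2 + D * θ) * (‖B - B'‖ * ‖a‖ * ‖v‖) := by rw [hD]; ring
    _ ≤ q * (‖B - B'‖ * ‖a‖ * ‖v‖) := by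
        refine mul_le_mul_of_nonneg_right (by linarith) (by positivity)
    _ = _ := by ring

lemma norm_pt_sub_le {C ζ : ℝ} (hC : 0 ≤ C) (hζ : 0 ≤ ζ) (h : P.IsOuter σ) (h' : P.IsOuter σ')
    (hB : P.IsSmall B) (hT : ∀ a, ‖P.field σ' B a‖ ≤ C * ‖a‖)
    (hd : ∀ a, ‖dev σ σ' (P.field σ B a)‖ ≤ ζ * ‖a‖) : ‖P.pt σ B - P.pt σ' B‖ ≤ ζ * C := by
  refine norm_le_of_inner_le (by positivity) fun a v => ?_
  rw [inner_pt_sub h hB h' hB, matContrast_pull_sub_pull h h' hB]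
  refine (abs_real_inner_le_norm _ _).trans ((mul_le_mul (hd a) (hT v) (norm_nonneg _)
    (by positivity)).trans (le_of_eq (by ring)))

lemma norm_dev_comm (h : P.IsOuter σ) (h' : P.IsOuter σ') (F : L2) :
    ‖dev σ σ' F‖ = ‖dev σ' σ F‖ := by
  rw [← matContrast_pull_sub_pull h h' isSmall_zero, ← matContrast_pull_sub_pull h' h isSmall_zero,
    ← norm_neg, ← neg_apply, neg_sub]

/-! ### Solving for the core by a simplified Newton iteration -/

/-- For every outer conductivity near that of the coated ball there is a core for which the
polarization tensor vanishes. -/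
theorem exists_core (hne : P.σc ≠ P.σs) {δ₀ : ℝ} (hδ₀ : 0 < δ₀) : ∃ τ, 0 < τ ∧
    ∃ β : (E3 → ℝ) → End3, ∀ σ, P.IsOuter σ →
      (∀ a, ‖dev P.σ0 σ (P.field P.σ0 0 a)‖ ≤ τ * ‖a‖) →
      (∀ x y, inner ℝ (β σ x) y = inner ℝ x (β σ y)) ∧ ‖β σ‖ ≤ δ₀ ∧ P.IsSmall (β σ) ∧
      P.pt σ (β σ) = 0 ∧
      ∀ η, 0 < η → ∃ ζ, 0 < ζ ∧ ∀ σ', P.IsOuter σ' →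
        (∀ a, ‖dev P.σ0 σ' (P.field P.σ0 0 a)‖ ≤ τ * ‖a‖) →
        (∀ a, ‖dev σ σ' (P.field σ (β σ) a)‖ ≤ ζ * ‖a‖) → ‖β σ' - β σ‖ ≤ η := by
  set c := ‖P.dptInv‖ + 1 with hc
  have hc0 : 0 < c := by positivity
  have hle : ∀ C, ‖P.dptInv C‖ ≤ c * ‖C‖ := fun C =>
    (P.dptInv.le_opNorm C).trans (by gcongr; linarith)
  -- With this `q` the approximation error, multiplied by the bound `c` for the inverse derivative,
  -- gives contraction factor `1 / 2`.
  obtain ⟨δ₁, hδ₁, hs, hmain⟩ := P.exists_norm_pt_sub_le (q := 1 / (2 * c)) (by positivity)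
  set N := ‖P.field P.σ0 0‖ with hN
  have hN0 : 0 ≤ N := norm_nonneg _
  set δ := min δ₀ δ₁ with hδ
  have hδ0 : 0 < δ := by positivity
  set τ := min δ₁ (δ / (2 * c * (N + 1))) with hτ
  have hτ0 : 0 < τ := by positivity
  have hτ1 : τ ≤ δ₁ := min_le_left _ _
  have hτ2 : c * (τ * (N + 1)) ≤ δ / 2 := by
    calc c * (τ * (N + 1)) ≤ c * (δ / (2 * c * (N + 1)) * (N + 1)) := by
          gcongr; exact min_le_right _ _
      _ = δ / 2 := by field_simp
  -- Symmetric matrices in a small closed ball: symmetry is preserved by the iteration, and the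
  -- derivative is known for symmetric increments.
  set S : Set End3 := {B | (∀ x y, inner ℝ (B x) y = inner ℝ x (B y)) ∧ ‖B‖ ≤ δ} with hS
  have hSc : IsClosed S := by
    have : S = (⋂ x : E3, ⋂ y : E3, {B : End3 | inner ℝ (B x) y = inner ℝ x (B y)}) ∩
        {B | ‖B‖ ≤ δ} := by
      ext B; simp [hS]
    rw [this]
    refine (isClosed_iInter fun x => isClosed_iInter fun y => isClosed_eq ?_ ?_).inter
      (isClosed_le continuous_norm continuous_const)
    · exact (ContinuousLinearMap.apply ℝ E3 x).continuous.inner continuous_const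
    · exact continuous_const.inner (ContinuousLinearMap.apply ℝ E3 y).continuous
  have hS0 : (0 : End3) ∈ S := ⟨by simp, by rw [norm_zero]; exact hδ0.le⟩
  -- Newton's iteration with the derivative frozen at the coated ball. Since `dptInv` is injective,
  -- its fixed points are the zeros of the polarization tensor.
  let F : (E3 → ℝ) → End3 → End3 := fun σ B => B - P.dptInv (P.pt σ B)
  have hgood : ∀ σ, P.IsOuter σ → (∀ a, ‖dev P.σ0 σ (P.field P.σ0 0 a)‖ ≤ τ * ‖a‖) →
      (∀ B ∈ S, ∀ a, ‖P.field σ B a‖ ≤ (N + 1) * ‖a‖) ∧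
      (∀ B ∈ S, ∀ B' ∈ S, ‖F σ B - F σ B'‖ ≤ 1 / 2 * ‖B - B'‖) ∧ MapsTo (F σ) S S := by
    intro σ hσ hτσ
    obtain ⟨m1, m2⟩ := hmain σ hσ fun a => by
      rw [norm_dev_comm hσ isOuter_σ0]; exact (hτσ a).trans (by gcongr)
    have hS1 : ∀ B ∈ S, ‖B‖ ≤ δ₁ := fun B hB => hB.2.trans (min_le_right _ _)
    have hlip : ∀ B ∈ S, ∀ B' ∈ S, ‖F σ B - F σ B'‖ ≤ 1 / 2 * ‖B - B'‖ := by
      intro B hB B' hB'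
      have hsym : ∀ x y, inner ℝ ((B - B') x) y = inner ℝ x ((B - B') y) := fun x y => by
        rw [sub_apply, sub_apply, inner_sub_left, inner_sub_right, hB.1, hB'.1]
      have e : F σ B - F σ B' = -P.dptInv (P.pt σ B - P.pt σ B' - P.dpt (B - B')) := by
        rw [map_sub, map_sub, dptInv_dpt hne]
        simp only [F]
        abel
      rw [e, norm_neg]
      refine (hle _).trans ?_
      calc c * ‖P.pt σ B - P.pt σ B' - P.dpt (B - B')‖ ≤ c * (1 / (2 * c) * ‖B - B'‖) := by
            gcongr; exact m2 B B' (hS1 B hB) (hS1 B' hB') hsym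
        _ = _ := by field_simp
    refine ⟨fun B hB => m1 B (hS1 B hB), hlip, fun B hB => ⟨fun x y => ?_, ?_⟩⟩
    · have h1 := inner_dptInv_comm (P := P) (inner_pt_comm hσ (hs B (hS1 B hB))) x y
      simp only [F, sub_apply, inner_sub_left, inner_sub_right, hB.1, h1]
    · have h0 : ‖F σ 0‖ ≤ δ / 2 := by
        have h1 : ‖P.pt P.σ0 0 - P.pt σ 0‖ ≤ τ * (N + 1) :=
          norm_pt_sub_le (by positivity) hτ0.le isOuter_σ0 hσ isSmall_zero
            (m1 0 (hS1 0 hS0)) hτσ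
        rw [pt_zero, zero_sub, norm_neg] at h1
        simp only [F, zero_sub, norm_neg]
        exact (hle _).trans ((mul_le_mul_of_nonneg_left h1 hc0.le).trans hτ2)
      have h1 := hlip B hB 0 hS0
      rw [sub_zero] at h1
      have h2 := norm_add_le (F σ B - F σ 0) (F σ 0)
      rw [sub_add_cancel] at h2
      have h3 := hB.2
      linarith
  -- For conductivities outside the admissible class the core is arbitrary; this makes the selection
  -- a total function.
  have hex : ∀ σ, ∃ B, P.IsOuter σ → (∀ a, ‖dev P.σ0 σ (P.field P.σ0 0 a)‖ ≤ τ * ‖a‖) →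
      B ∈ S ∧ F σ B = B := by
    intro σ
    by_cases h : P.IsOuter σ ∧ (∀ a, ‖dev P.σ0 σ (P.field P.σ0 0 a)‖ ≤ τ * ‖a‖)
    · obtain ⟨-, h2, h3⟩ := hgood σ h.1 h.2
      obtain ⟨B, hB, hB'⟩ := exists_fixedPoint_of_norm_le hSc hS0 h3 h2
      exact ⟨B, fun _ _ => ⟨hB, hB'⟩⟩
    · exact ⟨0, fun h1 h2 => absurd ⟨h1, h2⟩ h⟩
  choose β hβ using hex
  refine ⟨τ, hτ0, β, fun σ hσ hτσ => ?_⟩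
  obtain ⟨hβS, hβF⟩ := hβ σ hσ hτσ
  have hsm := hs (β σ) (hβS.2.trans (min_le_right _ _))
  have hz : P.dptInv (P.pt σ (β σ)) = 0 := by simpa [F] using hβF
  refine ⟨hβS.1, hβS.2.trans (min_le_left _ _), hsm, ?_, fun η hη => ?_⟩
  · exact eq_zero_of_dptInv_eq_zero hne hz
  -- The old fixed point almost solves the new equation, with residual at most `η / 2`, and
  -- contraction by `1 / 2` doubles this to `η`. Only the fields of `σ` at its own fixed point are
  -- tested.
  refine ⟨η / (2 * c * (N + 1)), by positivity, fun σ' hσ' hτσ' hd => ?_⟩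
  obtain ⟨hβS', hβF'⟩ := hβ σ' hσ' hτσ'
  obtain ⟨g1, g2, -⟩ := hgood σ' hσ' hτσ'
  have h1 : ‖P.pt σ (β σ) - P.pt σ' (β σ)‖ ≤ η / (2 * c * (N + 1)) * (N + 1) :=
    norm_pt_sub_le (by positivity) (by positivity) hσ hσ' hsm (g1 _ hβS) hd
  have h2 : ‖F σ' (β σ) - β σ‖ ≤ η / 2 := by
    have e : F σ' (β σ) - β σ = P.dptInv (P.pt σ (β σ) - P.pt σ' (β σ)) := by
      rw [map_sub, hz]; simp only [F]; abel
    rw [e]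
    refine (hle _).trans ?_
    calc c * ‖P.pt σ (β σ) - P.pt σ' (β σ)‖ ≤ c * (η / (2 * c * (N + 1)) * (N + 1)) := by gcongr
      _ = η / 2 := by field_simp
  have h3 := g2 _ hβS' _ hβS
  rw [hβF'] at h3
  have h4 := norm_add_le (β σ' - F σ' (β σ)) (F σ' (β σ) - β σ)
  rw [sub_add_sub_cancel] at h4
  linarith

end CoatedBall

/-! ### Perturbed balls -/

lemma exists_smul_S2_eq (x : E3) : ∃ p : S2, x = ‖x‖ • (p : E3) := by
  by_cases hx : x = 0
  · obtain ⟨p⟩ : Nonempty S2 := (NormedSpace.sphere_nonempty.2 zero_le_one).to_subtype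
    exact ⟨p, by simp [hx]⟩
  · refine ⟨⟨‖x‖⁻¹ • x, ?_⟩, ?_⟩
    · rw [mem_sphere_zero_iff_norm, norm_smul, norm_inv, norm_norm,
        inv_mul_cancel₀ (norm_ne_zero_iff.2 hx)]
    · rw [smul_smul, mul_inv_cancel₀ (norm_ne_zero_iff.2 hx), one_smul]

lemma smul_S2_inj {p q : S2} {s t : ℝ} (hs : 0 < s) (ht : 0 ≤ t)
    (h : s • (p : E3) = t • (q : E3)) : p = q ∧ s = t := by
  have h1 := congrArg norm h
  rw [norm_smul_S2 p hs.le, norm_smul_S2 q ht] at h1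
  subst h1
  exact ⟨Subtype.ext (smul_right_injective E3 hs.ne' h), rfl⟩

section PerturbedBall

variable {r c C : ℝ} {h : S2 → ℝ}

lemma smul_mem_perturbedBall (hpos : ∀ p, 0 < r + h p) (p : S2) {t : ℝ} (ht : 0 ≤ t) :
    t • (p : E3) ∈ perturbedBall r h ↔ t < r + h p := by
  refine ⟨fun ⟨q, s, hs, hs', e⟩ => ?_, fun h => ⟨p, t, ht, h, rfl⟩⟩
  rcases ht.eq_or_lt with h0 | h0
  · rw [← h0]; exact hpos p
  · obtain ⟨rfl, rfl⟩ := smul_S2_inj h0 hs e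
    exact hs'

lemma mem_perturbedBall_of_norm_lt (hc : ∀ p, c ≤ r + h p) {x : E3} (hx : ‖x‖ < c) :
    x ∈ perturbedBall r h := by
  obtain ⟨p, hp⟩ := exists_smul_S2_eq x
  exact ⟨p, ‖x‖, norm_nonneg _, hx.trans_le (hc p), hp⟩

lemma norm_lt_of_mem_perturbedBall (hC : ∀ p, r + h p ≤ C) {x : E3}
    (hx : x ∈ perturbedBall r h) : ‖x‖ < C := by
  obtain ⟨p, t, ht, ht', rfl⟩ := hx
  rw [norm_smul_S2 p ht]
  exact ht'.trans_le (hC p)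

/-- The polar homeomorphism misses the origin, which is supplied by a small ball contained in the
domain. -/
lemma isOpen_perturbedBall (hh : Continuous h) (hc0 : 0 < c) (hc : ∀ p, c ≤ r + h p) :
    IsOpen (perturbedBall r h) := by
  let e := homeomorphUnitSphereProd E3
  have h1 : IsOpen (Subtype.val '' (e.symm '' {q | (q.2 : ℝ) < r + h q.1})) :=
    isOpen_compl_singleton.isOpenMap_subtype_val _ (e.symm.isOpenMap _
      (isOpen_lt (continuous_subtype_val.comp continuous_snd)
        (continuous_const.add (hh.comp continuous_fst))))
  have h2 : perturbedBall r h = Metric.ball 0 c ∪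
      Subtype.val '' (e.symm '' {q | (q.2 : ℝ) < r + h q.1}) := by
    ext x
    constructor
    · rintro ⟨p, t, ht, ht', rfl⟩
      rcases ht.eq_or_lt with h0 | h0
      · left; rw [← h0, zero_smul]; exact Metric.mem_ball_self hc0
      · right
        exact ⟨e.symm (p, ⟨t, h0⟩), ⟨(p, ⟨t, h0⟩), ht', rfl⟩, rfl⟩
    · rintro (hx | ⟨-, ⟨⟨p, t⟩, hq, rfl⟩, rfl⟩)
      · exact mem_perturbedBall_of_norm_lt hc (mem_ball_zero_iff.1 hx)
      · exact ⟨p, t, (mem_Ioi.1 t.2).le, hq, rfl⟩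
  rw [h2]
  exact Metric.isOpen_ball.union h1

lemma isBounded_perturbedBall (hC : ∀ p, r + h p ≤ C) :
    Bornology.IsBounded (perturbedBall r h) :=
  Metric.isBounded_ball.subset fun _ hx =>
    mem_ball_zero_iff.2 (norm_lt_of_mem_perturbedBall hC hx)

/-- The domain is star-shaped about the origin, hence contractible. -/
lemma simplyConnectedSpace_perturbedBall (hc0 : 0 < c) (hc : ∀ p, c ≤ r + h p) :
    SimplyConnectedSpace (perturbedBall r h) := by
  have h1 : StarConvex ℝ 0 (perturbedBall r h) := by
    rw [starConvex_zero_iff]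
    rintro _ ⟨p, t, ht, ht', rfl⟩ a ha ha'
    exact ⟨p, a * t, by positivity, (mul_le_of_le_one_left ht ha').trans_lt ht', smul_smul _ _ _⟩
  have := h1.contractibleSpace ⟨0, mem_perturbedBall_of_norm_lt hc (by rwa [norm_zero])⟩
  infer_instance

lemma isCoreShell_perturbedBall {r' s : ℝ} {b : S2 → ℝ} (hb : Continuous b) (hh : Continuous h)
    (hc0 : 0 < c) (hc : ∀ p, c ≤ r + b p) (hs : ∀ p, r + b p ≤ s) (hs' : ∀ p, s < r' + h p)
    (hC : ∀ p, r' + h p ≤ C) : IsCoreShell (perturbedBall r b) (perturbedBall r' h) := by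
  have hs0 : 0 < s := by
    obtain ⟨p⟩ : Nonempty S2 := (NormedSpace.sphere_nonempty.2 zero_le_one).to_subtype
    exact hc0.trans_le ((hc p).trans (hs p))
  refine ⟨isOpen_perturbedBall hb hc0 hc, isOpen_perturbedBall hh hs0 fun p => (hs' p).le,
    isBounded_perturbedBall hs, isBounded_perturbedBall hC,
    simplyConnectedSpace_perturbedBall hc0 hc,
    simplyConnectedSpace_perturbedBall hs0 fun p => (hs' p).le, ?_⟩
  intro x hx
  have h1 : closure (perturbedBall r b) ⊆ Metric.closedBall 0 s :=
    closure_minimal (fun y hy => mem_closedBall_zero_iff.2 (norm_lt_of_mem_perturbedBall hs hy).le)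
      Metric.isClosed_closedBall
  have h2 := mem_closedBall_zero_iff.1 (h1 hx)
  obtain ⟨p, hp⟩ := exists_smul_S2_eq x
  rw [hp]
  exact ⟨p, ‖x‖, norm_nonneg _, h2.trans_lt (hs' p), rfl⟩

lemma perturbedBall_zero (r : ℝ) : perturbedBall r 0 = Metric.ball 0 r := by
  ext x
  rw [mem_ball_zero_iff]
  refine ⟨fun hx => norm_lt_of_mem_perturbedBall (by simp) hx, fun hx =>
    mem_perturbedBall_of_norm_lt (c := r) (by simp) hx⟩

end PerturbedBall

/-- The graph of a continuous function over the sphere is a null set. -/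
lemma volume_range_smul_S2 {f : S2 → ℝ} (hf : Continuous f) (h0 : ∀ p, 0 < f p) :
    volume (range fun p : S2 => f p • (p : E3)) = 0 := by
  have hc : Continuous fun q : S2 × ℝ => q.2 • (q.1 : E3) := by fun_prop
  have hm : MeasurableSet (range fun p : S2 => f p • (p : E3)) :=
    (isCompact_range (by fun_prop)).isClosed.measurableSet
  rw [← map_smul_polar, Measure.map_apply hc.measurable hm]
  refine withDensity_absolutelyContinuous _ _ ?_
  rw [Measure.measure_prod_null (hc.measurable hm)]
  refine ae_of_all _ fun p => ?_
  beta_reduce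
  rw [Pi.zero_apply, Measure.restrict_apply' measurableSet_Ioi]
  refine measure_mono_null (t := {f p}) ?_ (by simp)
  rintro t ⟨⟨q, hq⟩, ht⟩
  obtain ⟨rfl, h⟩ := smul_S2_inj (h0 q) (mem_Ioi.1 ht).le hq
  exact h.symm

lemma measurable_conductivity {D Ω : Set E3} (hD : MeasurableSet D) (hΩ : MeasurableSet Ω)
    (σc σs σm : ℝ) : Measurable (conductivity D Ω σc σs σm) :=
  Measurable.ite hD measurable_const (Measurable.ite hΩ measurable_const measurable_const)

/-! ### Dependence of the conductivity on the outer boundary -/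

namespace CoatedBall

variable (P : CoatedBall)

lemma lam_le : P.lam ≤ P.σc ∧ P.lam ≤ P.σs ∧ P.lam ≤ P.σm := by
  have h1 := P.ri_pos
  have h2 := P.ri_lt_re
  have h3 := P.lam_le_sg 0
  have h4 := P.lam_le_sg P.ri
  have h5 := P.lam_le_sg P.re
  rw [P.sg_of_lt h1] at h3
  rw [P.sg_of_mem le_rfl h2] at h4
  rw [sg, if_neg (by linarith), if_neg (lt_irrefl _)] at h5
  exact ⟨h3, h4, h5⟩

lemma conductivity_mem_Icc (D Ω : Set E3) (x : E3) :
    conductivity D Ω P.σc P.σs P.σm x ∈ Icc P.lam (P.σc + P.σs + P.σm) := by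
  have h1 := P.σc_pos; have h2 := P.σs_pos; have h3 := P.σm_pos
  obtain ⟨h4, h5, h6⟩ := P.lam_le
  unfold conductivity
  split_ifs <;> constructor <;> linarith

/-- The conductivity with a perturbed outer boundary. -/
def outer (h : S2 → ℝ) : E3 → ℝ :=
  conductivity (Metric.ball 0 P.ri) (perturbedBall P.re h) P.σc P.σs P.σm

variable {P} {h k : S2 → ℝ}

lemma isOuter_outer (hh : Continuous h) (hm : ∀ p, |h p| < P.re - P.m) :
    P.IsOuter (P.outer h) := by
  have hc : ∀ p, P.m ≤ P.re + h p := fun p => by linarith [(abs_lt.1 (hm p)).1]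
  have hC : ∀ p, P.re + h p ≤ 2 * P.re := fun p => by
    linarith [(abs_lt.1 (hm p)).2, P.m_pos]
  refine ⟨measurable_conductivity Metric.isOpen_ball.measurableSet
    (isOpen_perturbedBall hh P.m_pos hc).measurableSet _ _ _,
    fun x => (P.conductivity_mem_Icc _ _ x).1, fun x => (P.conductivity_mem_Icc _ _ x).2,
    fun x hx => ?_, fun x hx => ?_⟩
  · rw [outer, conductivity, σ0, sg, if_pos (mem_perturbedBall_of_norm_lt hc hx),
      if_pos (hx.trans P.m_lt_re)]
    simp only [mem_ball_zero_iff]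
  · rw [outer, conductivity, if_neg, if_neg]
    · exact fun h' => absurd (norm_lt_of_mem_perturbedBall hC h') (not_lt.2 hx)
    · rw [mem_ball_zero_iff]
      have := P.ri_lt_re; have := P.re_pos
      linarith

lemma outer_zero : P.outer 0 = P.σ0 := by
  funext x
  rw [outer, perturbedBall_zero, conductivity, σ0, sg]
  simp only [mem_ball_zero_iff]

lemma coeFn_dev {σ σ' : E3 → ℝ} (hσ : P.IsOuter σ) (hσ' : P.IsOuter σ') (F : L2) :
    dev σ σ' F =ᵐ[volume] fun x => (σ x - σ' x) • F x := by
  refine coeFn_mulOp (memLp_top_of_norm_le (C := (P.σc + P.σs + P.σm + (P.σc + P.σs + P.σm)))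
    ((hσ.measurable.sub hσ'.measurable).aestronglyMeasurable.smul aestronglyMeasurable_const)
      fun x => ?_) F
  change ‖(σ x - σ' x) • ContinuousLinearMap.id ℝ E3‖ ≤ _
  rw [norm_smul]
  refine (mul_le_of_le_one_right (norm_nonneg _) ContinuousLinearMap.norm_id_le).trans ?_
  exact (norm_sub_le _ _).trans (add_le_add (hσ.abs_le x) (hσ'.abs_le x))

/-- For a fixed field `F`, uniform convergence of the outer boundaries gives convergence of the
conductivities at every point off the limiting surface. That surface is null, and dominated
convergence concludes. The resulting `δ` depends on `F`. -/
lemma exists_norm_dev_outer_le (hh : Continuous h) (hm : ∀ p, |h p| < P.re - P.m) (F : L2) {ζ : ℝ}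
    (hζ : 0 < ζ) : ∃ δ, 0 < δ ∧ ∀ k, Continuous k → (∀ p, |k p| < P.re - P.m) →
      (∀ p, |k p - h p| ≤ δ) → ‖dev (P.outer h) (P.outer k) F‖ ≤ ζ := by
  -- Arguing by contradiction yields a sequence, to which dominated convergence applies.
  by_contra! hcon
  choose k hk hkm hkh hkn using fun n : ℕ => hcon (1 / ((n : ℝ) + 1)) (by positivity)
  have hO := isOuter_outer hh hm
  have hOk := fun n => isOuter_outer (hk n) (hkm n)
  have hpos : ∀ p, 0 < P.re + h p := fun p => by
    linarith [(abs_lt.1 (hm p)).1, P.m_pos]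
  have hposk : ∀ n p, 0 < P.re + k n p := fun n p => by
    linarith [(abs_lt.1 (hkm n p)).1, P.m_pos]
  have hlim : Tendsto (fun n => ∫ x, (P.outer h x - P.outer (k n) x) ^ 2 * ‖F x‖ ^ 2) atTop
      (𝓝 (∫ _ : E3, (0 : ℝ))) := by
    refine tendsto_integral_of_dominated_convergence
      (fun x => (P.σc + P.σs + P.σm + (P.σc + P.σs + P.σm)) ^ 2 * ‖F x‖ ^ 2) (fun n => ?_) ?_
      (fun n => ae_of_all _ fun x => ?_) ?_
    · exact ((hO.measurable.sub (hOk n).measurable).pow_const 2).aestronglyMeasurable.mul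
        ((Lp.aestronglyMeasurable F).norm.pow 2)
    · have := L2.integrable_inner (𝕜 := ℝ) F F
      simp only [real_inner_self_eq_norm_sq] at this
      exact this.const_mul _
    · rw [norm_mul, norm_pow, norm_pow, norm_norm]
      gcongr
      exact (norm_sub_le _ _).trans (add_le_add (hO.abs_le x) ((hOk n).abs_le x))
    · have hnull := volume_range_smul_S2 (f := fun p => P.re + h p) (by fun_prop) hpos
      filter_upwards [measure_eq_zero_iff_ae_notMem.1 hnull] with x hx
      obtain ⟨p, hp⟩ := exists_smul_S2_eq x
      have hne : ‖x‖ ≠ P.re + h p := fun e => hx ⟨p, by beta_reduce; rw [← e]; exact hp.symm⟩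
      have hlim : Tendsto (fun n => k n p) atTop (𝓝 (h p)) := by
        refine tendsto_iff_norm_sub_tendsto_zero.2
          (squeeze_zero (fun n => norm_nonneg _) (fun n => hkh n p)
            tendsto_one_div_add_atTop_nhds_zero_nat)
      have hiff : ∀ᶠ n in atTop, (‖x‖ < P.re + h p ↔ ‖x‖ < P.re + k n p) := by
        rcases lt_or_gt_of_ne hne with h1 | h1
        · filter_upwards [(hlim.const_add P.re).eventually_const_lt h1] with n hn
          exact ⟨fun _ => hn, fun _ => h1⟩
        · filter_upwards [(hlim.const_add P.re).eventually_lt_const h1] with n hn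
          exact ⟨fun h2 => absurd h2 (not_lt.2 h1.le), fun h2 => absurd h2 (not_lt.2 hn.le)⟩
      refine tendsto_const_nhds.congr' ?_
      filter_upwards [hiff] with n hn
      have h3 : x ∈ perturbedBall P.re h ↔ x ∈ perturbedBall P.re (k n) := by
        rw [hp, smul_mem_perturbedBall hpos p (norm_nonneg x),
          smul_mem_perturbedBall (hposk n) p (norm_nonneg x), hn]
      have h4 : P.outer h x = P.outer (k n) x := by
        unfold outer conductivity
        by_cases h5 : x ∈ perturbedBall P.re h
        · rw [if_pos h5, if_pos (h3.1 h5)]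
        · rw [if_neg h5, if_neg fun h6 => h5 (h3.2 h6)]
      rw [h4, sub_self]; simp
  rw [integral_zero] at hlim
  obtain ⟨n, hn⟩ := (hlim.eventually_lt_const (show 0 < ζ ^ 2 by positivity)).exists
  have h5 : ∫ x, (P.outer h x - P.outer (k n) x) ^ 2 * ‖F x‖ ^ 2 =
      ‖dev (P.outer h) (P.outer (k n)) F‖ ^ 2 := by
    rw [← real_inner_self_eq_norm_sq, L2.inner_def]
    refine integral_congr_ae ?_
    filter_upwards [coeFn_dev hO (hOk n) F] with x hx
    rw [hx, real_inner_self_eq_norm_sq, norm_smul, mul_pow, Real.norm_eq_abs, sq_abs]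
  rw [h5] at hn
  exact absurd (lt_of_pow_lt_pow_left₀ 2 hζ.le hn) (not_lt.2 (hkn n).le)

/-- Only three basis fields have to be controlled, so the smallest of three radii works uniformly in
`a`. -/
lemma exists_norm_dev_outer_apply_le (hh : Continuous h) (hm : ∀ p, |h p| < P.re - P.m)
    (T : E3 →L[ℝ] L2) {ζ : ℝ} (hζ : 0 < ζ) : ∃ δ, 0 < δ ∧ ∀ k, Continuous k →
      (∀ p, |k p| < P.re - P.m) → (∀ p, |k p - h p| ≤ δ) →
      ∀ a, ‖dev (P.outer h) (P.outer k) (T a)‖ ≤ ζ * ‖a‖ := by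
  set e := EuclideanSpace.basisFun (Fin 3) ℝ with he
  choose δ hδ hd using fun i => exists_norm_dev_outer_le hh hm (T (e i))
    (show 0 < ζ / 3 by positivity)
  refine ⟨min (δ 0) (min (δ 1) (δ 2)), lt_min (hδ 0) (lt_min (hδ 1) (hδ 2)),
    fun k hk hkm hkh a => ?_⟩
  have h1 : ∀ i, ‖dev (P.outer h) (P.outer k) (T (e i))‖ ≤ ζ / 3 := fun i => by
    refine hd i k hk hkm fun p => (hkh p).trans ?_
    fin_cases i
    · exact min_le_left _ _
    · exact (min_le_right _ _).trans (min_le_left _ _)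
    · exact (min_le_right _ _).trans (min_le_right _ _)
  have h2 : a = ∑ i, a i • e i := (e.sum_repr a).symm
  conv_lhs => rw [h2]
  rw [map_sum, map_sum]
  refine (norm_sum_le _ _).trans ?_
  have h3 : ∀ i ∈ Finset.univ, ‖dev (P.outer h) (P.outer k) (T (a i • e i))‖ ≤
      ‖a‖ * (ζ / 3) := fun i _ => by
    rw [map_smul, map_smul, norm_smul]
    exact mul_le_mul (PiLp.norm_apply_le a i) (h1 i) (norm_nonneg _) (norm_nonneg _)
  refine (Finset.sum_le_sum h3).trans (le_of_eq ?_)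
  rw [Finset.sum_const, Finset.card_univ, Fintype.card_fin]
  simp only [nsmul_eq_mul]
  push_cast
  ring

end CoatedBall

/-! ### Return to the physical configuration -/

namespace CoatedBall

variable {P : CoatedBall} {B : End3} {h : S2 → ℝ}

variable (P) in
/-- The radial component of the deformation along a ray. -/
def rad (B : End3) (p : S2) (r : ℝ) : ℝ := r + P.cut (r ^ 2) * r ^ 3 * sphereQuad B p

lemma smul_add_V (p : S2) {r : ℝ} (hr : 0 ≤ r) :
    r • (p : E3) + P.V B (r • (p : E3)) = P.rad B p r • (p : E3) := by
  rw [V, norm_smul_S2 p hr, map_smul, inner_smul_left, inner_smul_right, RCLike.conj_to_real,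
    smul_smul, ← add_smul, rad, sphereQuad]
  congr 1
  ring

lemma rad_zero (p : S2) : P.rad B p 0 = 0 := by simp [rad]

lemma rad_ri (p : S2) : P.rad B p P.ri = P.ri + sphereQuad B p := by
  have := P.ri_pos
  rw [rad, P.cut_of_le le_rfl, inv_mul_cancel₀ (by positivity), one_mul]

lemma rad_m (p : S2) : P.rad B p P.m = P.m := by
  rw [rad, P.cut_of_ge le_rfl, zero_mul, zero_mul, add_zero]

/-- Along a ray the displacement has Lipschitz constant below `1`, so the identity dominates it. -/
lemma rad_strictMonoOn (hB : P.K * ‖B‖ < 1) (p : S2) : StrictMonoOn (P.rad B p) (Ici 0) := by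
  intro r hr s hs hrs
  have h1 := P.norm_V_sub_le B (s • (p : E3)) (r • (p : E3))
  have h2 : ∀ t ∈ Ici (0 : ℝ), P.V B (t • (p : E3)) = (P.rad B p t - t) • (p : E3) :=
    fun t ht => by rw [sub_smul, ← smul_add_V p ht]; abel
  rw [h2 s hs, h2 r hr, ← sub_smul, ← sub_smul, norm_smul, norm_smul, norm_coe_S2, mul_one, mul_one,
    Real.norm_eq_abs, Real.norm_eq_abs, abs_of_pos (sub_pos.2 hrs)] at h1
  have h3 := (abs_le.1 h1).1
  nlinarith [sub_pos.2 hrs]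

/-- The deformation preserves rays, is increasing on each of them, carries the radius `ri` to `ri +
sphereQuad B` and fixes all points beyond `m`. The perturbed core thus pulls back to the ball, and
the outer domain to itself. -/
lemma conductivity_add_V (hB : P.K * ‖B‖ < 1) (hb : ‖B‖ < P.ri) (hm : ∀ p, |h p| < P.re - P.m)
    (y : E3) : conductivity (perturbedBall P.ri (sphereQuad B)) (perturbedBall P.re h) P.σc P.σs
      P.σm (y + P.V B y) = P.outer h y := by
  obtain ⟨p, r, hr, rfl⟩ : ∃ (p : S2) (r : ℝ), 0 ≤ r ∧ y = r • (p : E3) :=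
    (exists_smul_S2_eq y).imp fun p hp => ⟨‖y‖, norm_nonneg _, hp⟩
  have hi : (0 : ℝ) ≤ P.ri := P.ri_pos.le
  have hmono := P.rad_strictMonoOn hB p
  have hr0 : 0 ≤ P.rad B p r := by
    rw [← rad_zero (P := P) (B := B) p]
    exact hmono.monotoneOn (mem_Ici.2 le_rfl) hr hr
  have hpos : ∀ p, 0 < P.ri + sphereQuad B p := fun p => by
    linarith [(abs_le.1 (abs_sphereQuad_le B p)).1]
  have hc : ∀ p, P.m < P.re + h p := fun p => by linarith [(abs_lt.1 (hm p)).1]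
  have e1 : P.rad B p r • (p : E3) ∈ perturbedBall P.ri (sphereQuad B) ↔
      r • (p : E3) ∈ Metric.ball 0 P.ri := by
    rw [smul_mem_perturbedBall hpos p hr0, mem_ball_zero_iff, norm_smul_S2 p hr, ← rad_ri,
      hmono.lt_iff_lt hr hi]
  have e2 : P.rad B p r • (p : E3) ∈ perturbedBall P.re h ↔
      r • (p : E3) ∈ perturbedBall P.re h := by
    rw [smul_mem_perturbedBall (fun p => P.m_pos.trans (hc p)) p hr0,
      smul_mem_perturbedBall (fun p => P.m_pos.trans (hc p)) p hr]
    rcases lt_or_ge r P.m with h1 | h1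
    · have h2 := hmono hr P.m_pos.le h1
      rw [rad_m] at h2
      exact ⟨fun _ => h1.trans (hc p), fun _ => h2.trans (hc p)⟩
    · have hm0 := P.m_pos
      have : P.rad B p r = r := by
        rw [rad, P.cut_of_ge (by gcongr), zero_mul, zero_mul, add_zero]
      rw [this]
  rw [smul_add_V p hr, outer]
  unfold conductivity
  by_cases h1 : r • (p : E3) ∈ Metric.ball 0 P.ri
  · rw [if_pos h1, if_pos (e1.2 h1)]
  · rw [if_neg h1, if_neg fun h2 => h1 (e1.1 h2)]
    by_cases h3 : r • (p : E3) ∈ perturbedBall P.re h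
    · rw [if_pos h3, if_pos (e2.2 h3)]
    · rw [if_neg h3, if_neg fun h4 => h3 (e2.1 h4)]

lemma isCoreShell (hb : ‖B‖ < P.ri) (hb' : ‖B‖ ≤ P.m - P.ri) (hh : Continuous h)
    (hm : ∀ p, |h p| < P.re - P.m) :
    IsCoreShell (perturbedBall P.ri (sphereQuad B)) (perturbedBall P.re h) :=
  isCoreShell_perturbedBall (c := P.ri - ‖B‖) (s := P.m) (C := 2 * P.re)
    (continuous_sphereQuad B) hh (sub_pos.2 hb)
    (fun p => by linarith [(abs_le.1 (abs_sphereQuad_le B p)).1])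
    (fun p => by linarith [(abs_le.1 (abs_sphereQuad_le B p)).2])
    (fun p => by linarith [(abs_lt.1 (hm p)).1])
    (fun p => by linarith [(abs_lt.1 (hm p)).2, P.m_pos])

lemma isAdmissible_conductivity (hb : ‖B‖ < P.ri) (hb' : ‖B‖ ≤ P.m - P.ri) (hh : Continuous h)
    (hm : ∀ p, |h p| < P.re - P.m) :
    IsAdmissible (conductivity (perturbedBall P.ri (sphereQuad B)) (perturbedBall P.re h) P.σc P.σs
      P.σm) P.σm P.lam (2 * P.re) := by
  have hcs := isCoreShell hb hb' hh hm
  refine ⟨measurable_conductivity hcs.isOpen_core.measurableSet hcs.isOpen_outer.measurableSet _ _ _,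
    P.lam_pos, fun x => (P.conductivity_mem_Icc _ _ x).1, ⟨_, fun x =>
      (P.conductivity_mem_Icc _ _ x).2⟩, fun x hx => ?_⟩
  have h1 : x ∉ perturbedBall P.re h := fun h' => hx (mem_ball_zero_iff.2
    (norm_lt_of_mem_perturbedBall (fun p => by linarith [(abs_lt.1 (hm p)).2, P.m_pos]) h'))
  rw [conductivity, if_neg fun h2 => h1 (hcs.closure_subset (subset_closure h2)), if_neg h1]

/-- The polarization tensor of the deformed core-shell structure vanishes if it vanishes on the
reference configuration. -/
lemma isPTVanishing_of_pt_eq_zero (hB : P.IsSmall B) (hb : ‖B‖ < P.ri) (hb' : ‖B‖ ≤ P.m - P.ri)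
    (hh : Continuous h) (hm : ∀ p, |h p| < P.re - P.m) (h0 : P.pt (P.outer h) B = 0) :
    IsPTVanishing (perturbedBall P.ri (sphereQuad B)) (perturbedBall P.re h) P.σc P.σs P.σm := by
  refine ⟨isCoreShell hb hb' hh hm, ?_⟩
  have hadm := isAdmissible_conductivity hb hb' hh hm
  have hO := isOuter_outer hh hm
  set σ := conductivity (perturbedBall P.ri (sphereQuad B)) (perturbedBall P.re h) P.σc P.σs P.σm
    with hσ
  obtain ⟨Φ, hΦ, hs, hs', hd, hu⟩ := P.exists_diffeo hB.lt_one
  have hout : ∀ x ∉ Metric.ball (0 : E3) (2 * P.re), P.m ≤ ‖x‖ := fun x hx => by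
    rw [mem_ball_zero_iff, not_lt] at hx
    linarith [P.m_lt_re, P.re_pos]
  -- The energy principle compares quadratic forms only, so transport gives the vanishing of the
  -- diagonal values.
  have hdiag : ∀ a, inner ℝ (form P.σm (2 * P.re) (contrast σ P.σm) a) a = 0 := by
    intro a
    rw [inner_form, polarization_transport (A := P.pull (P.outer h) B) hs hs' (fun x hx => ?_) hadm
      (memLp_pull hO hB) (fun x hx => ?_) (inner_pull_comm _ _) (isElliptic_pull hO hB)
      (fun y w => ?_) a, ← inner_form, ← pt, h0, zero_apply, inner_zero_left]
    · rw [hΦ, P.V_of_ge B (hout x hx), add_zero]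
    · rw [pull, P.DV_of_ge B (hout x hx), jac_zero, hO.eq_of_ge x (by
        rwa [mem_ball_zero_iff, not_lt] at hx)]
      rfl
    · rw [hd, pull, smul_apply, inner_smul_left, RCLike.conj_to_real, inner_jac_adjoint (hu y), hΦ,
        hσ, conductivity_add_V hB.lt_one hb hm]
      ring
  refine hadm.isPolarizationTensor_zero P.σm_pos.ne' fun a v => ?_
  -- Symmetry and polarization extend the vanishing to all pairs of vectors.
  have hsym := inner_form_comm (R := 2 * P.re) hadm.isElliptic
    (mulOp_symm hadm.memLp fun x v w => by simp [inner_smul_left, inner_smul_right])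
  have h1 := hdiag (a + v)
  rw [map_add, inner_add_left, inner_add_right, inner_add_right, hdiag, hdiag, zero_add, add_zero,
    show inner ℝ (form P.σm (2 * P.re) (contrast σ P.σm) v) a =
      inner ℝ (form P.σm (2 * P.re) (contrast σ P.σm) a) v by rw [hsym, real_inner_comm]] at h1
  rw [← inner_form]
  linarith

end CoatedBall

lemma isPolarizationTensor_const {s : ℝ} (hs : 0 < s) :
    IsPolarizationTensor (fun _ => s) 0 := by
  have h : IsAdmissible (fun _ => s) s s 1 :=
    ⟨measurable_const, hs, fun _ => le_rfl, ⟨s, fun _ => le_rfl⟩, fun _ _ => rfl⟩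
  refine h.isPolarizationTensor_zero hs.ne' fun a v => ?_
  rw [inner_mulOp h.memLp]
  simp

/-! ### Conclusion: existence and continuity of the neutral core -/

namespace CoatedBall

variable (P : CoatedBall)

/-- Existence and continuity of the core in terms of quadratic forms and the sup norm. -/
def HasNeutralCores (ε : ℝ) (β : (S2 → ℝ) → End3) : Prop :=
  (∀ h, Continuous h → (∀ p, |h p| < ε) → IsPTVanishing (perturbedBall P.ri (sphereQuad (β h)))
    (perturbedBall P.re h) P.σc P.σs P.σm) ∧
  ∀ h, Continuous h → (∀ p, |h p| < ε) → ∀ η, 0 < η → ∃ δ, 0 < δ ∧ ∀ k, Continuous k →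
    (∀ p, |k p| < ε) → (∀ p, |k p - h p| ≤ δ) → ‖β k - β h‖ ≤ η

/-- Neutrality then forces `σm = σs`, the conductivity is constant, and the undeformed core serves
for every `h`. -/
lemma exists_hasNeutralCores_of_eq (hne : P.σc = P.σs) : ∃ ε, 0 < ε ∧ ∃ β, P.HasNeutralCores ε β := by
  have hm : P.σm = P.σs := by
    have h := P.neutral
    have hs := P.σs_pos
    rw [hne, sub_self, mul_zero, zero_mul, add_zero, mul_eq_zero] at h
    rcases h with h | h
    · linarith
    · linarith
  refine ⟨P.re - P.m, sub_pos.2 P.m_lt_re, fun _ => 0, fun h hh hhε => ?_,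
    fun _ _ _ η hη => ⟨1, one_pos, fun _ _ _ _ => by rw [sub_zero, norm_zero]; exact hη.le⟩⟩
  refine ⟨isCoreShell (by rw [norm_zero]; exact P.ri_pos)
    (by rw [norm_zero]; exact (sub_pos.2 P.ri_lt_m).le) hh hhε, ?_⟩
  have : conductivity (perturbedBall P.ri (sphereQuad 0)) (perturbedBall P.re h) P.σc P.σs P.σm =
      fun _ => P.σs := by
    funext x
    rw [conductivity, hne, hm, ite_self, ite_self]
  rw [this]
  exact isPolarizationTensor_const P.σs_pos

lemma exists_hasNeutralCores_of_ne (hne : P.σc ≠ P.σs) :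
    ∃ ε, 0 < ε ∧ ∃ β, P.HasNeutralCores ε β := by
  have hri := P.ri_pos
  have hrm := sub_pos.2 P.ri_lt_m
  have hme := sub_pos.2 P.m_lt_re
  -- The bound `ri / 2` keeps the radius of the core positive, and `m - ri` keeps the core inside
  -- the middle sphere, hence inside the outer domain.
  obtain ⟨τ, hτ, β, hβ⟩ := exists_core hne (δ₀ := min (P.ri / 2) (P.m - P.ri)) (by positivity)
  have hz : ∀ p : S2, |(0 : S2 → ℝ) p| < P.re - P.m := fun p => by simpa using P.m_lt_re
  obtain ⟨ε, hε, hdev⟩ := exists_norm_dev_outer_apply_le (P := P) (h := 0) continuous_const hz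
    (P.field P.σ0 0) hτ
  rw [outer_zero] at hdev
  have hlt : ∀ h : S2 → ℝ, (∀ p, |h p| < min ε (P.re - P.m)) → ∀ p, |h p| < P.re - P.m :=
    fun h hh p => (hh p).trans_le (min_le_right _ _)
  have hout : ∀ h, Continuous h → (∀ p, |h p| < min ε (P.re - P.m)) →
      ∀ a, ‖dev P.σ0 (P.outer h) (P.field P.σ0 0 a)‖ ≤ τ * ‖a‖ := fun h hh hhε =>
    hdev h hh (hlt h hhε) fun p => by
      rw [Pi.zero_apply, sub_zero]
      exact ((hhε p).trans_le (min_le_left _ _)).le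
  refine ⟨min ε (P.re - P.m), by positivity, fun h => β (P.outer h), fun h hh hhε => ?_,
    fun h hh hhε η hη => ?_⟩
  · obtain ⟨-, hb, hs, h0, -⟩ := hβ _ (isOuter_outer hh (hlt h hhε)) (hout h hh hhε)
    have hb1 := hb.trans (min_le_left _ _)
    exact isPTVanishing_of_pt_eq_zero hs (by linarith) (hb.trans (min_le_right _ _)) hh
      (hlt h hhε) h0
  · obtain ⟨-, -, -, -, hc⟩ := hβ _ (isOuter_outer hh (hlt h hhε)) (hout h hh hhε)
    obtain ⟨ζ, hζ, hc⟩ := hc η hη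
    obtain ⟨δ, hδ, hd⟩ := exists_norm_dev_outer_apply_le hh (hlt h hhε)
      (P.field (P.outer h) (β (P.outer h))) hζ
    exact ⟨δ, hδ, fun k hk hkε hkh => hc _ (isOuter_outer hk (hlt k hkε)) (hout k hk hkε)
      (hd k hk (hlt k hkε) hkh)⟩

lemma exists_neutral_core : ∃ ε : ℝ, 0 < ε ∧ ∃ b : (S2 → ℝ) → (S2 → ℝ),
    (∀ h ∈ W2inf, norm2inf h < ENNReal.ofReal ε → b h ∈ W6 ∧
      IsPTVanishing (perturbedBall P.ri (b h)) (perturbedBall P.re h) P.σc P.σs P.σm) ∧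
    (∀ h ∈ W2inf, norm2inf h < ENNReal.ofReal ε → ∀ η : ℝ, 0 < η → ∃ δ : ℝ, 0 < δ ∧
      ∀ k ∈ W2inf, norm2inf k < ENNReal.ofReal ε → norm2inf (k - h) < ENNReal.ofReal δ →
        norm2inf (b k - b h) < ENNReal.ofReal η) := by
  obtain ⟨ε, hε, β, h1, h2⟩ : ∃ ε, 0 < ε ∧ ∃ β, P.HasNeutralCores ε β := by
    by_cases hne : P.σc = P.σs
    · exact P.exists_hasNeutralCores_of_eq hne
    · exact P.exists_hasNeutralCores_of_ne hne
  refine ⟨ε, hε, fun h => sphereQuad (β h), fun h hh hhε => ⟨sphereQuad_mem_W6 _,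
    h1 h hh.1 fun p => abs_lt_of_norm2inf_lt hh.1 hhε p⟩, fun h hh hhε η hη => ?_⟩
  -- Since `41 / 82 = 1 / 2`, the bound for the norm of a quadratic form gives at most `η / 2`,
  -- which is the strict inequality required.
  obtain ⟨δ, hδ, h3⟩ := h2 h hh.1 (fun p => abs_lt_of_norm2inf_lt hh.1 hhε p) (η / 82)
    (by positivity)
  refine ⟨δ, hδ, fun k hk hkε hkh => ?_⟩
  have h4 := h3 k hk.1 (fun p => abs_lt_of_norm2inf_lt hk.1 hkε p)
    fun p => (abs_lt_of_norm2inf_lt (hk.1.sub hh.1) hkh p).le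
  rw [← sphereQuad_sub]
  refine (norm2inf_sphereQuad_le _).trans_lt ((ENNReal.ofReal_lt_ofReal_iff hη).2 ?_)
  linarith

end CoatedBall

end CoreShell

end

theorem theorem1p2 (σc σs σm ri re : ℝ) (hσc : 0 < σc) (hσs : 0 < σs) (hσm : 0 < σm)
    (hri : 0 < ri) (hre : ri < re)
    (hneutral : (2 * σs + σc) * (σm - σs) + (ri / re) ^ 3 * (σs - σc) * (2 * σs + σm) = 0) :
    ∃ ε : ℝ, 0 < ε ∧
      ∃ b : (CoreShell.S2 → ℝ) → (CoreShell.S2 → ℝ),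
        (∀ h ∈ CoreShell.W2inf, CoreShell.norm2inf h < ENNReal.ofReal ε →
          b h ∈ CoreShell.W6 ∧
          CoreShell.IsPTVanishing (CoreShell.perturbedBall ri (b h))
            (CoreShell.perturbedBall re h) σc σs σm) ∧
        (∀ h ∈ CoreShell.W2inf, CoreShell.norm2inf h < ENNReal.ofReal ε →
          ∀ η : ℝ, 0 < η → ∃ δ : ℝ, 0 < δ ∧
            ∀ k ∈ CoreShell.W2inf, CoreShell.norm2inf k < ENNReal.ofReal ε →
              CoreShell.norm2inf (k - h) < ENNReal.ofReal δ →
              CoreShell.norm2inf (b k - b h) < ENNReal.ofReal η) :=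
  CoreShell.CoatedBall.exists_neutral_core ⟨σc, σs, σm, ri, re, hσc, hσs, hσm, hri, hre, hneutral⟩
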